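/- Let $d\ge 1$, let $\Omega\subset\mathbb R^d$ be a bounded open set with Lipschitz boundary, and let $\mathcal S^{d\times d}$ be the space of symmetric $d\times d$ matrices. Fix $1\le r\le\infty$; $|\cdot|_r$ denotes the $\ell^r$ norm on $\mathbb R^d$ and, on matrices, either the entrywise $\ell^r$ norm or the operator norm induced by $\ell^r$ (the statement holds for each choice). Let $\alpha_0,\alpha_1\in C(\overline\Omega)$ with $\alpha_0,\alpha_1>\underline\alpha>0$ on $\Omega$. Let $f\in L^2(\Omega)$, let $T:L^2(\Omega)\to L^2(\Omega)$ be bounded and linear with $B:=T^*T$ invertible, and put $\|v\|_B^2=\int_\Omega v\,B^{-1}v\,dx$. For $p\in L^2(\Omega,\mathcal S^{d\times d})$ let $(\operatorname{div}p)_i=\sum_j\partial_jp_{ij}$ and $\operatorname{div}^2p=\operatorname{div}(\operatorname{div}p)$ in the weak sense. Let $H(\operatorname{div}^2;\Omega)$ be the space of those $p$ with $\operatorname{div}p\in L^2(\Omega,\mathbb R^d)$ and $\operatorname{div}^2p\in L^2(\Omega)$, with norm $(\|p\|_{L^2}^2+\|\operatorname{div}p\|_{L^2}^2+\|\operatorname{div}^2p\|_{L^2}^2)^{1/2}$;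 let $H_0(\operatorname{div}^2;\Omega)$ be the closure of $C_c^\infty(\Omega,\mathcal S^{d\times d})$ in it. Let $H_0^2(\Omega,\mathcal S^{d\times d})$ be the closure of $C_c^\infty(\Omega,\mathcal S^{d\times d})$ in $H^2$. Set $$K=\{p\in H_0(\operatorname{div}^2;\Omega):\ |p(x)|_r\le\alpha_0(x),\ |\operatorname{div}p(x)|_r\le\alpha_1(x)\ \text{for a.e. }x\in\Omega\}.$$ The predual problem is $$\text{(P)}\qquad \min_{p\in K}\ \tfrac12\|T^*f-\operatorname{div}^2p\|_B^2-\tfrac12\|f\|_{L^2(\Omega)}^2 .$$ Let $M:H_0(\operatorname{div}^2;\Omega)\to[0,\infty)$ be convex and continuous, with $M(p)=0$ if and only if $p\in K$, and coercive in the sense that $M(p_n)\to\infty$ for every sequence $(p_n)$ in $H_0(\operatorname{div}^2;\Omega)$ with $\max\{\|p_n\|_{L^2},\|\operatorname{div}p_n\|_{L^2}\}\to\infty$. For $\varepsilon>0$ consider $$\text{(P}_\varepsilon)\qquad \min_{p\in H_0^2(\Omega,\mathcal S^{d\times d})}\ \tfrac\varepsilon2\|\Delta p\|_{L^2}^2+\tfrac\varepsilon2\|p\|_{L^2}^2+\tfrac12\|T^*f-\operatorname{div}^2p\|_B^2+\tfrac1\varepsilon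 M(p),$$ where $\Delta$ acts componentwise. Then: 1. for every $\varepsilon>0$, problem (P$_\varepsilon$) has a unique solution $p_\varepsilon\in H_0^2(\Omega,\mathcal S^{d\times d})$; 2. for every sequence $\varepsilon_n>0$ with $\varepsilon_n\to0$ there are a subsequence $(\varepsilon_{n_k})$ and a solution $p$ of (P) such that $\operatorname{div}^2p_{\varepsilon_{n_k}}\to\operatorname{div}^2p$ in $L^2(\Omega)$ as $k\to\infty$. -/

import Mathlib

open MeasureTheory Filter Topology
open scoped ENNReal NNReal ContDiff InnerProductSpace

noncomputable section

namespace TGV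

/-! ### Domains and test functions -/

/-- `∂Ω` is Lipschitz: near each boundary point, in a suitable orthonormal frame with last
direction `e`, the set `Ω` is the strict subgraph of a Lipschitz function on `e^⊥`. -/
def HasLipschitzBoundary {d : ℕ} (Ω : Set (EuclideanSpace ℝ (Fin d))) : Prop :=
  ∀ x ∈ frontier Ω, ∃ ρ : ℝ, 0 < ρ ∧ ∃ e : EuclideanSpace ℝ (Fin d), ‖e‖ = 1 ∧
    ∃ (K : ℝ≥0) (γ : (Submodule.span ℝ {e})ᗮ → ℝ), LipschitzWith K γ ∧
      ∀ y ∈ Metric.ball x ρ,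
        (y ∈ Ω ↔ ⟪e, y⟫_ℝ < γ ((Submodule.span ℝ {e})ᗮ.orthogonalProjectionOnto y))

/-- `φ ∈ C_c^∞(Ω)`. -/
def IsTestFunction {d : ℕ} (Ω : Set (EuclideanSpace ℝ (Fin d)))
    (φ : EuclideanSpace ℝ (Fin d) → ℝ) : Prop :=
  ContDiff ℝ ∞ φ ∧ HasCompactSupport φ ∧ tsupport φ ⊆ Ω

/-- The classical partial derivative `∂φ/∂x_k` at `x`. -/
def partialDeriv {d : ℕ} (k : Fin d) (φ : EuclideanSpace ℝ (Fin d) → ℝ)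
    (x : EuclideanSpace ℝ (Fin d)) : ℝ :=
  fderiv ℝ φ x (EuclideanSpace.single k 1)

/-! ### Lebesgue spaces -/

/-- `L²(Ω)`. -/
abbrev L2 {d : ℕ} (Ω : Set (EuclideanSpace ℝ (Fin d))) : Type :=
  Lp ℝ 2 (volume.restrict Ω)

/-- `L²(Ω, ℝ^d)`, with `‖q‖² = ∑ i, ‖q i‖²`. -/
abbrev L2Vec {d : ℕ} (Ω : Set (EuclideanSpace ℝ (Fin d))) : Type :=
  PiLp 2 (fun _ : Fin d => L2 Ω)

/-- `L²(Ω, ℝ^{d×d})`, with `‖p‖² = ∑ i j, ‖p (i, j)‖²`. -/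
abbrev L2Mat {d : ℕ} (Ω : Set (EuclideanSpace ℝ (Fin d))) : Type :=
  PiLp 2 (fun _ : Fin d × Fin d => L2 Ω)

/-- `p` takes values in the symmetric matrices. -/
def IsSymmField {d : ℕ} {Ω : Set (EuclideanSpace ℝ (Fin d))} (p : L2Mat Ω) : Prop :=
  ∀ i j, p (i, j) = p (j, i)

/-- The class `u ∈ L²(Ω)` has a representative in `C_c^∞(Ω)`. -/
def IsTestClass {d : ℕ} {Ω : Set (EuclideanSpace ℝ (Fin d))} (u : L2 Ω) : Prop :=
  ∃ φ, IsTestFunction Ω φ ∧ u =ᵐ[volume.restrict Ω] φ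

/-- `p` has a representative in `C_c^∞(Ω, S^{d×d})`. -/
def IsTestField {d : ℕ} {Ω : Set (EuclideanSpace ℝ (Fin d))} (p : L2Mat Ω) : Prop :=
  IsSymmField p ∧ ∀ ij, IsTestClass (p ij)

/-! ### Weak derivatives and the space `H₀²(Ω, S^{d×d})` -/

/-- `g ∈ L²(Ω)` is the weak partial derivative of `u` in the direction `x_k`. -/
def IsWeakPartial {d : ℕ} {Ω : Set (EuclideanSpace ℝ (Fin d))} (k : Fin d) (u g : L2 Ω) : Prop :=
  ∀ φ, IsTestFunction Ω φ →
    ∫ x in Ω, partialDeriv k φ x * u x = - ∫ x in Ω, φ x * g x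

open Classical in
/-- The weak partial derivative `∂_k u ∈ L²(Ω)` (`0` if there is none). -/
def weakPartial {d : ℕ} {Ω : Set (EuclideanSpace ℝ (Fin d))} (k : Fin d) (u : L2 Ω) : L2 Ω :=
  if h : ∃ g, IsWeakPartial k u g then h.choose else 0

/-- `H²(Ω)`. -/
def H2 {d : ℕ} (Ω : Set (EuclideanSpace ℝ (Fin d))) : Set (L2 Ω) :=
  {u | ∃ (g : Fin d → L2 Ω) (h : Fin d → Fin d → L2 Ω),
    (∀ k, IsWeakPartial k u (g k)) ∧ ∀ k l, IsWeakPartial l (g k) (h k l)}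

/-- The norm of `H²(Ω)`. -/
def h2Norm {d : ℕ} {Ω : Set (EuclideanSpace ℝ (Fin d))} (u : L2 Ω) : ℝ :=
  Real.sqrt (‖u‖ ^ 2 + ∑ k, ‖weakPartial k u‖ ^ 2
    + ∑ k, ∑ l, ‖weakPartial l (weakPartial k u)‖ ^ 2)

/-- `H₀²(Ω)`: the closure of `C_c^∞(Ω)` in `H²(Ω)`. -/
def H02 {d : ℕ} (Ω : Set (EuclideanSpace ℝ (Fin d))) : Set (L2 Ω) :=
  {u | u ∈ H2 Ω ∧ ∀ δ : ℝ, 0 < δ → ∃ v : L2 Ω, IsTestClass v ∧ h2Norm (u - v) < δ}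

/-- `H₀²(Ω, S^{d×d})`: symmetric fields with components in `H₀²(Ω)`. -/
def H02Sym {d : ℕ} (Ω : Set (EuclideanSpace ℝ (Fin d))) : Set (L2Mat Ω) :=
  {p | IsSymmField p ∧ ∀ ij, p ij ∈ H02 Ω}

/-- The (weak) Laplacian applied to each component. -/
def laplacian {d : ℕ} {Ω : Set (EuclideanSpace ℝ (Fin d))} (p : L2Mat Ω) : L2Mat Ω :=
  WithLp.toLp 2 (fun ij => ∑ k, weakPartial k (weakPartial k (p ij)))

/-! ### Weak divergences and the space `H₀(div²; Ω)` -/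

/-- `w ∈ L²(Ω)` is the weak divergence of `q ∈ L²(Ω, ℝ^d)`. -/
def IsWeakDiv {d : ℕ} {Ω : Set (EuclideanSpace ℝ (Fin d))} (q : L2Vec Ω) (w : L2 Ω) : Prop :=
  ∀ φ, IsTestFunction Ω φ →
    ∫ x in Ω, ∑ k, partialDeriv k φ x * q k x = - ∫ x in Ω, φ x * w x

open Classical in
/-- The weak divergence `div q ∈ L²(Ω)` of a vector field (`0` if there is none). -/
def vecDiv {d : ℕ} {Ω : Set (EuclideanSpace ℝ (Fin d))} (q : L2Vec Ω) : L2 Ω :=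
  if h : ∃ w, IsWeakDiv q w then h.choose else 0

/-- The `i`-th row of a matrix field. -/
def row {d : ℕ} {Ω : Set (EuclideanSpace ℝ (Fin d))} (p : L2Mat Ω) (i : Fin d) : L2Vec Ω :=
  WithLp.toLp 2 (fun j => p (i, j))

/-- `(div p)_i = ∑ j, ∂_j p_{ij}`. -/
def matDiv {d : ℕ} {Ω : Set (EuclideanSpace ℝ (Fin d))} (p : L2Mat Ω) : L2Vec Ω :=
  WithLp.toLp 2 (fun i => vecDiv (row p i))

/-- `div² p = div (div p)`. -/
def matDiv2 {d : ℕ} {Ω : Set (EuclideanSpace ℝ (Fin d))} (p : L2Mat Ω) : L2 Ω :=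
  vecDiv (matDiv p)

/-- `H(div²; Ω)`: symmetric fields `p ∈ L²` with `div p ∈ L²` and `div² p ∈ L²`. -/
def HDiv2 {d : ℕ} (Ω : Set (EuclideanSpace ℝ (Fin d))) : Set (L2Mat Ω) :=
  {p | IsSymmField p ∧ ∃ (q : L2Vec Ω) (w : L2 Ω),
    (∀ i, IsWeakDiv (row p i) (q i)) ∧ IsWeakDiv q w}

/-- The norm of `H(div²; Ω)`. -/
def hDiv2Norm {d : ℕ} {Ω : Set (EuclideanSpace ℝ (Fin d))} (p : L2Mat Ω) : ℝ :=
  Real.sqrt (‖p‖ ^ 2 + ‖matDiv p‖ ^ 2 + ‖matDiv2 p‖ ^ 2)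

/-- `H₀(div²; Ω)`: the closure of `C_c^∞(Ω, S^{d×d})` in `H(div²; Ω)`. -/
def H0Div2 {d : ℕ} (Ω : Set (EuclideanSpace ℝ (Fin d))) : Set (L2Mat Ω) :=
  {p | p ∈ HDiv2 Ω ∧ ∀ δ : ℝ, 0 < δ → ∃ ψ : L2Mat Ω, IsTestField ψ ∧ hDiv2Norm (p - ψ) < δ}

/-! ### Pointwise norms and the constraints -/

/-- The `ℓ^r` norm on `ℝ^d`. -/
def vecNorm {d : ℕ} (r : ℝ≥0∞) [Fact (1 ≤ r)] (v : Fin d → ℝ) : ℝ :=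
  ‖(WithLp.toLp r v : PiLp r (fun _ : Fin d => ℝ))‖

/-- The entrywise `ℓ^r` norm of a matrix (Frobenius for `r = 2`). -/
def entrywiseNorm {d : ℕ} (r : ℝ≥0∞) [Fact (1 ≤ r)] (A : Matrix (Fin d) (Fin d) ℝ) : ℝ :=
  ‖(WithLp.toLp r (fun ij => A ij.1 ij.2) : PiLp r (fun _ : Fin d × Fin d => ℝ))‖

/-- The operator norm of a matrix on `(ℝ^d, ℓ^r)`: the least `c ≥ 0` with
`|A v|_r ≤ c |v|_r` for all `v`. -/
def inducedNorm {d : ℕ} (r : ℝ≥0∞) [Fact (1 ≤ r)] (A : Matrix (Fin d) (Fin d) ℝ) : ℝ :=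
  sInf {c : ℝ | 0 ≤ c ∧ ∀ v : Fin d → ℝ, vecNorm r (A.mulVec v) ≤ c * vecNorm r v}

/-- `N` is one of the two usual matrix norms attached to the `ℓ^r` norm. -/
def IsMatrixNorm {d : ℕ} (r : ℝ≥0∞) [Fact (1 ≤ r)] (N : Matrix (Fin d) (Fin d) ℝ → ℝ) : Prop :=
  N = entrywiseNorm r ∨ N = inducedNorm r

/-- `|p(x)|_r ≤ α₀(x)` and `|div p(x)|_r ≤ α₁(x)` for almost every `x ∈ Ω`, where `N` is the
matrix norm `|·|_r`. -/
def SatisfiesBounds {d : ℕ} {Ω : Set (EuclideanSpace ℝ (Fin d))} (r : ℝ≥0∞) [Fact (1 ≤ r)]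
    (N : Matrix (Fin d) (Fin d) ℝ → ℝ) (α₀ α₁ : EuclideanSpace ℝ (Fin d) → ℝ)
    (p : L2Mat Ω) : Prop :=
  ∀ᵐ x ∂(volume.restrict Ω),
    N (Matrix.of fun i j => p (i, j) x) ≤ α₀ x ∧ vecNorm r (fun i => matDiv p i x) ≤ α₁ x

/-- An admissible weight: `α ∈ C(closure Ω)`, bounded below on `Ω` by a positive constant. -/
def IsWeight {d : ℕ} (Ω : Set (EuclideanSpace ℝ (Fin d)))
    (α : EuclideanSpace ℝ (Fin d) → ℝ) : Prop :=
  ContinuousOn α (closure Ω) ∧ ∃ a : ℝ, 0 < a ∧ ∀ x ∈ Ω, a < α x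

/-! ### The fidelity term, the penalty and the two problems -/

/-- `B = T* T`. -/
def opB {d : ℕ} {Ω : Set (EuclideanSpace ℝ (Fin d))} (T : L2 Ω →L[ℝ] L2 Ω) : L2 Ω →L[ℝ] L2 Ω :=
  ContinuousLinearMap.adjoint T * T

/-- `‖v‖_B² = ∫_Ω v B⁻¹ v`. -/
def bNormSq {d : ℕ} {Ω : Set (EuclideanSpace ℝ (Fin d))} (T : L2 Ω →L[ℝ] L2 Ω) (v : L2 Ω) : ℝ :=
  ∫ x in Ω, v x * (Ring.inverse (opB T) v) x

/-- `M : H₀(div²; Ω) → [0, ∞)` is convex, continuous for the `H(div²; Ω)` norm, vanishes exactly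
on the fields that satisfy the bounds, and is coercive. Only the values of `M` on `H₀(div²; Ω)`
matter. -/
structure IsPenalty {d : ℕ} {Ω : Set (EuclideanSpace ℝ (Fin d))} (r : ℝ≥0∞) [Fact (1 ≤ r)]
    (N : Matrix (Fin d) (Fin d) ℝ → ℝ) (α₀ α₁ : EuclideanSpace ℝ (Fin d) → ℝ)
    (M : L2Mat Ω → ℝ) : Prop where
  nonneg : ∀ p ∈ H0Div2 Ω, 0 ≤ M p
  convex : ∀ p ∈ H0Div2 Ω, ∀ q ∈ H0Div2 Ω, ∀ t : ℝ, 0 ≤ t → t ≤ 1 →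
    M ((1 - t) • p + t • q) ≤ (1 - t) * M p + t * M q
  continuous : ∀ p ∈ H0Div2 Ω, ∀ η : ℝ, 0 < η → ∃ δ : ℝ, 0 < δ ∧
    ∀ q ∈ H0Div2 Ω, hDiv2Norm (q - p) < δ → |M q - M p| < η
  eq_zero_iff : ∀ p ∈ H0Div2 Ω, M p = 0 ↔ SatisfiesBounds r N α₀ α₁ p
  coercive : ∀ p : ℕ → L2Mat Ω, (∀ n, p n ∈ H0Div2 Ω) →
    Tendsto (fun n => max ‖p n‖ ‖matDiv (p n)‖) atTop atTop →
    Tendsto (fun n => M (p n)) atTop atTop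

/-- The objective `½ ‖T* f - div² p‖_B² - ½ ‖f‖²` of the predual problem. -/
def predualObjective {d : ℕ} {Ω : Set (EuclideanSpace ℝ (Fin d))} (T : L2 Ω →L[ℝ] L2 Ω)
    (f : L2 Ω) (p : L2Mat Ω) : ℝ :=
  1 / 2 * bNormSq T (ContinuousLinearMap.adjoint T f - matDiv2 p) - 1 / 2 * ‖f‖ ^ 2

/-- The feasible set of the predual problem. -/
def feasibleSet {d : ℕ} (Ω : Set (EuclideanSpace ℝ (Fin d))) (r : ℝ≥0∞) [Fact (1 ≤ r)]
    (N : Matrix (Fin d) (Fin d) ℝ → ℝ) (α₀ α₁ : EuclideanSpace ℝ (Fin d) → ℝ) : Set (L2Mat Ω) :=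
  {p | p ∈ H0Div2 Ω ∧ SatisfiesBounds r N α₀ α₁ p}

/-- `p` solves the predual problem. -/
def SolvesPredual {d : ℕ} {Ω : Set (EuclideanSpace ℝ (Fin d))} (r : ℝ≥0∞) [Fact (1 ≤ r)]
    (N : Matrix (Fin d) (Fin d) ℝ → ℝ) (α₀ α₁ : EuclideanSpace ℝ (Fin d) → ℝ)
    (T : L2 Ω →L[ℝ] L2 Ω) (f : L2 Ω) (p : L2Mat Ω) : Prop :=
  p ∈ feasibleSet Ω r N α₀ α₁ ∧ IsMinOn (predualObjective T f) (feasibleSet Ω r N α₀ α₁) p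

/-- The objective of the regularized predual problem. -/
def regObjective {d : ℕ} {Ω : Set (EuclideanSpace ℝ (Fin d))} (T : L2 Ω →L[ℝ] L2 Ω)
    (f : L2 Ω) (M : L2Mat Ω → ℝ) (ε : ℝ) (p : L2Mat Ω) : ℝ :=
  ε / 2 * ‖laplacian p‖ ^ 2 + ε / 2 * ‖p‖ ^ 2
    + 1 / 2 * bNormSq T (ContinuousLinearMap.adjoint T f - matDiv2 p) + 1 / ε * M p

/-- `p` solves the regularized predual problem with parameter `ε`. -/
def SolvesRegularized {d : ℕ} {Ω : Set (EuclideanSpace ℝ (Fin d))} (T : L2 Ω →L[ℝ] L2 Ω)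
    (f : L2 Ω) (M : L2Mat Ω → ℝ) (ε : ℝ) (p : L2Mat Ω) : Prop :=
  p ∈ H02Sym Ω ∧ IsMinOn (regObjective T f M ε) (H02Sym Ω) p

end TGV

end

/-! For fixed ε the problem lives in a Hilbert space. On test functions two integrations by parts
give ‖D²u‖ = ‖Δu‖, and Σ‖∂ₖu‖² = -⟨u, Δu⟩. Hence the pair (p, Δp) controls the H² norm and the
triple (p, div p, div² p), and p ↦ (p, Δp) identifies H₀² with a closed subspace. There the
objective is ε/2 times the squared norm plus a continuous, convex, nonnegative function, and the
parallelogram law gives a unique minimizer (`existsUnique_minimizer`).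

For ε → 0 write F for the fidelity as a function of div² p, and m for its infimum on K. Comparison
with a feasible ψ in H₀² gives F(div² p_ε) + M(p_ε)/ε ≤ O(ε) + F(div² ψ). Taking ψ = 0 yields M(p_ε)
= O(ε) and, by coercivity, bounds in H(div²). If such ψ approximate every feasible field in the
sense of div², then limsup F(div² p_ε) ≤ m. A bounded family with M → 0 produces a feasible field
without loss in F (`IsPenalty.exists_feasible`). Applied to p_ε this gives a solution q of the
predual problem; applied to the midpoints of p_ε and q it gives F ≥ m - o(1) there. As F is
quadratic with a definite leading part, the midpoint identity forces div² p_ε → div² q strongly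
(`tendsto_matDiv2_of_dense`).

The main work is the density statement `exists_feasible_testField_near`. A Lipschitz boundary admits
a smooth inward field b. With Φ = id + t b and a mollifier k of radius proportional to t, the field
x ↦ ∫ k(x - Φ(y)) DΦ p DΦᵀ dy is a symmetric test field. By a Piola identity its divergence is the
same integral of DΦ div p + t (D²b : p), so both pointwise bounds survive up to a factor close to 1,
which is scaled away. In the second divergence a derivative of k hits t (D²b : p); that term is of
order t · 1/t, so it is only bounded, but it tends to zero weakly. Since the feasible test fields
form a convex set, weak approximation upgrades to strong approximation (`exists_near_of_weak`). -/

noncomputable section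

namespace TGV

/-! ### Test functions -/

section TestFunctions

variable {d : ℕ} {Ω U V : Set (EuclideanSpace ℝ (Fin d))}
  {φ ψ : EuclideanSpace ℝ (Fin d) → ℝ}

theorem IsTestFunction.mono (h : IsTestFunction U φ) (hUV : U ⊆ V) : IsTestFunction V φ :=
  ⟨h.1, h.2.1, h.2.2.trans hUV⟩

theorem IsTestFunction.univ (h : IsTestFunction U φ) : IsTestFunction Set.univ φ :=
  h.mono (Set.subset_univ _)

theorem IsTestFunction.zero : IsTestFunction U (fun _ => 0) :=
  ⟨contDiff_const, HasCompactSupport.zero, by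
    have : tsupport (fun _ : EuclideanSpace ℝ (Fin d) => (0 : ℝ)) = ∅ := by
      rw [tsupport_eq_empty_iff]; rfl
    simp [this]⟩

theorem IsTestFunction.mul_left (hφ : ContDiff ℝ ∞ φ) (hψ : IsTestFunction U ψ) :
    IsTestFunction U (fun x => φ x * ψ x) :=
  ⟨hφ.mul hψ.1, hψ.2.1.mul_left, (tsupport_mul_subset_right).trans hψ.2.2⟩

theorem IsTestFunction.add (hφ : IsTestFunction U φ) (hψ : IsTestFunction U ψ) :
    IsTestFunction U (fun x => φ x + ψ x) :=
  ⟨hφ.1.add hψ.1, hφ.2.1.add hψ.2.1,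
    (tsupport_add φ ψ).trans (Set.union_subset hφ.2.2 hψ.2.2)⟩

theorem IsTestFunction.sum {ι : Type*} (s : Finset ι)
    {f : ι → EuclideanSpace ℝ (Fin d) → ℝ} (h : ∀ i ∈ s, IsTestFunction U (f i)) :
    IsTestFunction U (fun x => ∑ i ∈ s, f i x) := by
  classical
  induction s using Finset.induction_on with
  | empty => simpa using IsTestFunction.zero
  | insert a s ha ih =>
    simp only [Finset.sum_insert ha]
    exact (h a (by simp)).add (ih fun i hi => h i (by simp [hi]))

theorem IsTestFunction.const_mul (c : ℝ) (hψ : IsTestFunction U ψ) :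
    IsTestFunction U (fun x => c * ψ x) :=
  hψ.mul_left contDiff_const

theorem tsupport_partialDeriv_subset (k : Fin d) :
    tsupport (partialDeriv k φ) ⊆ tsupport φ :=
  (closure_mono fun x hx => by
    by_contra h
    exact hx (by
      have : fderiv ℝ φ x = 0 := by
        by_contra h'
        exact h (support_fderiv_subset ℝ h')
      simp [partialDeriv, this])).trans (isClosed_tsupport φ).closure_eq.subset

theorem contDiff_partialDeriv (k : Fin d) (h : ContDiff ℝ ∞ φ) :
    ContDiff ℝ ∞ (partialDeriv k φ) :=
  (h.fderiv_right (m := ∞) (by simp)).clm_apply contDiff_const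

theorem IsTestFunction.partialDeriv (k : Fin d) (h : IsTestFunction U φ) :
    IsTestFunction U (partialDeriv k φ) :=
  ⟨contDiff_partialDeriv k h.1,
    h.2.1.of_isClosed_subset (isClosed_tsupport _) (tsupport_partialDeriv_subset k),
    (tsupport_partialDeriv_subset k).trans h.2.2⟩

theorem partialDeriv_mul (k : Fin d) (hφ : ContDiff ℝ ∞ φ) (hψ : ContDiff ℝ ∞ ψ)
    (x : EuclideanSpace ℝ (Fin d)) :
    partialDeriv k (fun y => φ y * ψ y) x = φ x * partialDeriv k ψ x + ψ x * partialDeriv k φ x := by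
  have h1 := (hφ.differentiable (by simp)) x
  have h2 := (hψ.differentiable (by simp)) x
  simp [TGV.partialDeriv, fderiv_fun_mul h1 h2]

theorem partialDeriv_comm (k l : Fin d) (hφ : ContDiff ℝ ∞ φ) :
    TGV.partialDeriv k (TGV.partialDeriv l φ) = TGV.partialDeriv l (TGV.partialDeriv k φ) := by
  ext x
  have hs : IsSymmSndFDerivAt ℝ φ x :=
    (hφ.contDiffAt).isSymmSndFDerivAt (by
      rw [minSmoothness_of_isRCLikeNormedField]; exact WithTop.coe_le_coe.2 le_top)
  have hd : DifferentiableAt ℝ (fderiv ℝ φ) x :=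
    ((hφ.fderiv_right (m := ∞) (by simp)).differentiable (by simp)) x
  have key : ∀ a b : Fin d, TGV.partialDeriv a (TGV.partialDeriv b φ) x
      = fderiv ℝ (fderiv ℝ φ) x (EuclideanSpace.single a 1) (EuclideanSpace.single b 1) := by
    intro a b
    unfold TGV.partialDeriv
    rw [fderiv_clm_apply hd (by fun_prop)]
    simp
  rw [key, key]
  exact hs _ _

theorem IsTestFunction.memLp (h : IsTestFunction U φ) (Ω : Set (EuclideanSpace ℝ (Fin d)))
    (p : ℝ≥0∞) : MemLp φ p (volume.restrict Ω) :=
  h.1.continuous.memLp_of_hasCompactSupport h.2.1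

theorem IsTestFunction.integrable (h : IsTestFunction U φ) : Integrable φ :=
  h.1.continuous.integrable_of_hasCompactSupport h.2.1

theorem IsTestFunction.integrable_mul (h : IsTestFunction U φ) (u : L2 Ω) :
    Integrable (fun x => φ x * u x) (volume.restrict Ω) :=
  (h.memLp Ω 2).integrable_mul (Lp.memLp u)

/-- Both integrands vanish outside the support of ψ, so the integrals extend to the whole space.
There is no boundary term even though φ may be nonzero on ∂Ω; this asymmetry is what later allows
testing up to the boundary. -/
theorem integral_partialDeriv_mul (k : Fin d) (hφ : IsTestFunction Set.univ φ)
    (hψ : IsTestFunction Ω ψ) :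
    ∫ x in Ω, partialDeriv k φ x * ψ x = - ∫ x in Ω, φ x * partialDeriv k ψ x := by
  have e1 : ∫ x in Ω, partialDeriv k φ x * ψ x = ∫ x, partialDeriv k φ x * ψ x :=
    setIntegral_eq_integral_of_forall_compl_eq_zero fun x hx => by
      rw [image_eq_zero_of_notMem_tsupport (fun h => hx (hψ.2.2 h)), mul_zero]
  have e2 : ∫ x in Ω, φ x * partialDeriv k ψ x = ∫ x, φ x * partialDeriv k ψ x :=
    setIntegral_eq_integral_of_forall_compl_eq_zero fun x hx => by
      rw [image_eq_zero_of_notMem_tsupport (fun h => hx ((hψ.partialDeriv k).2.2 h)), mul_zero]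
  have := integral_mul_fderiv_eq_neg_fderiv_mul_of_integrable (μ := volume) (f := φ) (g := ψ)
    (v := EuclideanSpace.single k (1 : ℝ)) (𝕜 := ℝ)
    (IsTestFunction.integrable (hψ.mul_left (hφ.partialDeriv k).1))
    (IsTestFunction.integrable ((hψ.partialDeriv k).mul_left hφ.1))
    (IsTestFunction.integrable (hψ.mul_left hφ.1))
    (fun x _ => (hφ.1.differentiable (by simp)) x) (fun x _ => (hψ.1.differentiable (by simp)) x)
  rw [e1, e2]
  have this' : ∫ x, φ x * partialDeriv k ψ x = - ∫ x, partialDeriv k φ x * ψ x := this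
  rw [this', neg_neg]

/-- The class in `L²(Ω)` of a function (`0` if the function is not square integrable). -/
def toL2 (Ω : Set (EuclideanSpace ℝ (Fin d))) (φ : EuclideanSpace ℝ (Fin d) → ℝ) : L2 Ω :=
  open Classical in
  if h : MemLp φ 2 (volume.restrict Ω) then h.toLp φ else 0

theorem coeFn_toL2 (h : MemLp φ 2 (volume.restrict Ω)) : toL2 Ω φ =ᵐ[volume.restrict Ω] φ := by
  rw [toL2, dif_pos h]; exact h.coeFn_toLp

theorem toL2_eq (h : MemLp φ 2 (volume.restrict Ω)) {u : L2 Ω} (hu : u =ᵐ[volume.restrict Ω] φ) :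
    u = toL2 Ω φ :=
  Lp.ext (hu.trans (coeFn_toL2 h).symm)

theorem inner_L2 (u v : L2 Ω) : ⟪u, v⟫_ℝ = ∫ x in Ω, u x * v x := by
  rw [L2.inner_def]
  exact integral_congr_ae (.of_forall fun x => by simp [mul_comm])

theorem inner_toL2 (h : MemLp φ 2 (volume.restrict Ω)) (u : L2 Ω) :
    ⟪toL2 Ω φ, u⟫_ℝ = ∫ x in Ω, φ x * u x := by
  rw [inner_L2]
  exact integral_congr_ae ((coeFn_toL2 h).mono fun x hx => by simp [hx])

theorem IsTestFunction.inner_toL2 (h : IsTestFunction U φ) (u : L2 Ω) :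
    ⟪toL2 Ω φ, u⟫_ℝ = ∫ x in Ω, φ x * u x :=
  TGV.inner_toL2 (h.memLp Ω 2) u

theorem IsTestFunction.inner_toL2_toL2 (h : IsTestFunction U φ) (h' : IsTestFunction V ψ) :
    ⟪toL2 Ω φ, toL2 Ω ψ⟫_ℝ = ∫ x in Ω, φ x * ψ x := by
  rw [h.inner_toL2]
  exact integral_congr_ae ((coeFn_toL2 (h'.memLp Ω 2)).mono fun x hx => by simp [hx])

theorem IsTestFunction.isTestClass (h : IsTestFunction Ω φ) : IsTestClass (toL2 Ω φ) :=
  ⟨φ, h, coeFn_toL2 (h.memLp Ω 2)⟩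

theorem IsTestClass.exists_eq {u : L2 Ω} (h : IsTestClass u) :
    ∃ φ, IsTestFunction Ω φ ∧ u = toL2 Ω φ := by
  obtain ⟨φ, hφ, hu⟩ := h
  exact ⟨φ, hφ, toL2_eq (hφ.memLp Ω 2) hu⟩

theorem toL2_add (hφ : MemLp φ 2 (volume.restrict Ω)) (hψ : MemLp ψ 2 (volume.restrict Ω)) :
    toL2 Ω (fun x => φ x + ψ x) = toL2 Ω φ + toL2 Ω ψ := by
  refine (toL2_eq (hφ.add hψ) ?_).symm
  filter_upwards [Lp.coeFn_add (toL2 Ω φ) (toL2 Ω ψ), coeFn_toL2 hφ, coeFn_toL2 hψ] with x h1 h2 h3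
  rw [h1, Pi.add_apply, h2, h3]; rfl

theorem toL2_const_mul (c : ℝ) (hφ : MemLp φ 2 (volume.restrict Ω)) :
    toL2 Ω (fun x => c * φ x) = c • toL2 Ω φ := by
  refine (toL2_eq (hφ.const_mul c) ?_).symm
  filter_upwards [Lp.coeFn_smul c (toL2 Ω φ), coeFn_toL2 hφ] with x h1 h2
  rw [h1, Pi.smul_apply, h2, smul_eq_mul]

/-- A class that is orthogonal to all test functions vanishes. -/
theorem eq_zero_of_forall_inner (hΩ : IsOpen Ω) {g : L2 Ω}
    (h : ∀ φ, IsTestFunction Ω φ → ⟪toL2 Ω φ, g⟫_ℝ = 0) : g = 0 := by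
  have hloc : LocallyIntegrableOn (g : EuclideanSpace ℝ (Fin d) → ℝ) Ω volume := by
    rw [locallyIntegrableOn_iff (hΩ.isLocallyClosed)]
    intro K hK hKc
    have : IsFiniteMeasure (volume.restrict K) := ⟨by
      rw [Measure.restrict_apply_univ]; exact hKc.measure_lt_top⟩
    have h2 : MemLp (g : EuclideanSpace ℝ (Fin d) → ℝ) 2 (volume.restrict K) :=
      (Lp.memLp g).mono_measure (Measure.restrict_mono hK le_rfl)
    exact h2.integrable (by norm_num)
  have h0 := hΩ.ae_eq_zero_of_integral_contDiff_smul_eq_zero hloc fun φ h1 h2 h3 => by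
    have ht : IsTestFunction Ω φ := ⟨h1, h2, h3⟩
    have e := h φ ht
    rw [ht.inner_toL2] at e
    rw [← e]
    refine (setIntegral_eq_integral_of_forall_compl_eq_zero fun x hx => ?_).symm
    rw [image_eq_zero_of_notMem_tsupport (fun h => hx (h3 h)), zero_smul]
  refine Lp.ext ?_
  filter_upwards [(ae_restrict_iff' hΩ.measurableSet).2 h0, Lp.coeFn_zero ℝ 2 (volume.restrict Ω)]
    with x h1 h2
  rw [h1, h2]; rfl

end TestFunctions

end TGV

end

noncomputable section

namespace TGV

/-! ### Weak derivatives -/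

section Weak

variable {d : ℕ} {Ω : Set (EuclideanSpace ℝ (Fin d))}

/-- In terms of inner products with fixed elements of L², linearity and stability under limits
become linearity and continuity of the inner product. -/
theorem isWeakPartial_iff {k : Fin d} {u g : L2 Ω} :
    IsWeakPartial k u g ↔ ∀ φ, IsTestFunction Ω φ →
      ⟪toL2 Ω (partialDeriv k φ), u⟫_ℝ = - ⟪toL2 Ω φ, g⟫_ℝ :=
  forall₂_congr fun φ h => by rw [(h.partialDeriv k).inner_toL2, h.inner_toL2]

theorem IsWeakPartial.add {k : Fin d} {u g v h : L2 Ω} (h1 : IsWeakPartial k u g)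
    (h2 : IsWeakPartial k v h) : IsWeakPartial k (u + v) (g + h) := by
  rw [isWeakPartial_iff] at *
  intro φ hφ
  rw [inner_add_right, inner_add_right, h1 φ hφ, h2 φ hφ]; ring

theorem IsWeakPartial.smul {k : Fin d} {u g : L2 Ω} (c : ℝ) (h1 : IsWeakPartial k u g) :
    IsWeakPartial k (c • u) (c • g) := by
  rw [isWeakPartial_iff] at *
  intro φ hφ
  rw [real_inner_smul_right, real_inner_smul_right, h1 φ hφ]; ring

theorem IsWeakPartial.sub {k : Fin d} {u g v h : L2 Ω} (h1 : IsWeakPartial k u g)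
    (h2 : IsWeakPartial k v h) : IsWeakPartial k (u - v) (g - h) := by
  simpa [sub_eq_add_neg] using h1.add (h2.smul (-1))

theorem IsWeakPartial.of_tendsto {k : Fin d} {u g : ℕ → L2 Ω} {u' g' : L2 Ω}
    (h : ∀ n, IsWeakPartial k (u n) (g n)) (hu : Tendsto u atTop (𝓝 u'))
    (hg : Tendsto g atTop (𝓝 g')) : IsWeakPartial k u' g' := by
  simp only [isWeakPartial_iff] at *
  intro φ hφ
  have h1 : Tendsto (fun n => ⟪toL2 Ω (partialDeriv k φ), u n⟫_ℝ) atTop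
    (𝓝 ⟪toL2 Ω (partialDeriv k φ), u'⟫_ℝ) := tendsto_const_nhds.inner hu
  have h2 : Tendsto (fun n => - ⟪toL2 Ω φ, g n⟫_ℝ) atTop (𝓝 (- ⟪toL2 Ω φ, g'⟫_ℝ)) :=
    (tendsto_const_nhds.inner hg).neg
  exact tendsto_nhds_unique h1 (by simpa only [h _ φ hφ] using h2)

theorem IsWeakPartial.unique (hΩ : IsOpen Ω) {k : Fin d} {u g h : L2 Ω}
    (h1 : IsWeakPartial k u g) (h2 : IsWeakPartial k u h) : g = h := by
  rw [isWeakPartial_iff] at *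
  refine sub_eq_zero.1 (eq_zero_of_forall_inner hΩ fun φ hφ => ?_)
  rw [inner_sub_right]
  linarith [h1 φ hφ, h2 φ hφ]

/-- Uniqueness of weak derivatives turns the chosen value into a computable one; the default value 0
never matters once some derivative is exhibited. -/
theorem IsWeakPartial.weakPartial_eq (hΩ : IsOpen Ω) {k : Fin d} {u g : L2 Ω}
    (h : IsWeakPartial k u g) : weakPartial k u = g := by
  have h' : ∃ g, IsWeakPartial k u g := ⟨g, h⟩
  rw [weakPartial, dif_pos h']
  exact h'.choose_spec.unique hΩ h

theorem IsTestFunction.isWeakPartial {φ : EuclideanSpace ℝ (Fin d) → ℝ} (h : IsTestFunction Ω φ)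
    (k : Fin d) : IsWeakPartial k (toL2 Ω φ) (toL2 Ω (TGV.partialDeriv k φ)) := by
  rw [isWeakPartial_iff]
  intro ψ hψ
  rw [(hψ.partialDeriv k).inner_toL2_toL2 h, hψ.inner_toL2_toL2 (h.partialDeriv k),
    integral_partialDeriv_mul k hψ.univ h]

theorem isWeakDiv_iff {q : L2Vec Ω} {w : L2 Ω} :
    IsWeakDiv q w ↔ ∀ φ, IsTestFunction Ω φ →
      ∑ k, ⟪toL2 Ω (partialDeriv k φ), q k⟫_ℝ = - ⟪toL2 Ω φ, w⟫_ℝ :=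
  forall₂_congr fun φ h => by
    rw [integral_finsetSum _ fun k _ => (h.partialDeriv k).integrable_mul _, h.inner_toL2]
    simp only [(h.partialDeriv _).inner_toL2]

theorem IsWeakDiv.add {q q' : L2Vec Ω} {w w' : L2 Ω} (h1 : IsWeakDiv q w)
    (h2 : IsWeakDiv q' w') : IsWeakDiv (q + q') (w + w') := by
  rw [isWeakDiv_iff] at *
  intro φ hφ
  simp only [PiLp.add_apply, inner_add_right, Finset.sum_add_distrib, h1 φ hφ, h2 φ hφ]; ring

theorem IsWeakDiv.smul {q : L2Vec Ω} {w : L2 Ω} (c : ℝ) (h1 : IsWeakDiv q w) :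
    IsWeakDiv (c • q) (c • w) := by
  rw [isWeakDiv_iff] at *
  intro φ hφ
  simp only [PiLp.smul_apply, real_inner_smul_right, ← Finset.mul_sum, h1 φ hφ]; ring

theorem IsWeakDiv.of_tendsto {q : ℕ → L2Vec Ω} {w : ℕ → L2 Ω} {q' : L2Vec Ω} {w' : L2 Ω}
    (h : ∀ n, IsWeakDiv (q n) (w n)) (hq : Tendsto q atTop (𝓝 q'))
    (hw : Tendsto w atTop (𝓝 w')) : IsWeakDiv q' w' := by
  simp only [isWeakDiv_iff] at *
  intro φ hφ
  have h1 : Tendsto (fun n => ∑ k, ⟪toL2 Ω (partialDeriv k φ), q n k⟫_ℝ) atTop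
      (𝓝 (∑ k, ⟪toL2 Ω (partialDeriv k φ), q' k⟫_ℝ)) :=
    tendsto_finsetSum _ fun k _ => tendsto_const_nhds.inner
      (((PiLp.continuous_apply 2 _ k).tendsto q').comp hq)
  have h2 : Tendsto (fun n => - ⟪toL2 Ω φ, w n⟫_ℝ) atTop (𝓝 (- ⟪toL2 Ω φ, w'⟫_ℝ)) :=
    (tendsto_const_nhds.inner hw).neg
  exact tendsto_nhds_unique h1 (by simpa only [h _ φ hφ] using h2)

theorem IsWeakDiv.unique (hΩ : IsOpen Ω) {q : L2Vec Ω} {w w' : L2 Ω}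
    (h1 : IsWeakDiv q w) (h2 : IsWeakDiv q w') : w = w' := by
  rw [isWeakDiv_iff] at *
  refine sub_eq_zero.1 (eq_zero_of_forall_inner hΩ fun φ hφ => ?_)
  rw [inner_sub_right]
  linarith [h1 φ hφ, h2 φ hφ]

theorem IsWeakDiv.vecDiv_eq (hΩ : IsOpen Ω) {q : L2Vec Ω} {w : L2 Ω}
    (h : IsWeakDiv q w) : vecDiv q = w := by
  have h' : ∃ g, IsWeakDiv q g := ⟨w, h⟩
  rw [vecDiv, dif_pos h']
  exact h'.choose_spec.unique hΩ h

/-- If all the `∂_k q_k` exist, then `div q = ∑ k, ∂_k q_k`. -/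
theorem isWeakDiv_of_isWeakPartial {q : L2Vec Ω} {g : Fin d → L2 Ω}
    (h : ∀ k, IsWeakPartial k (q k) (g k)) : IsWeakDiv q (∑ k, g k) := by
  simp only [isWeakPartial_iff, isWeakDiv_iff] at *
  intro φ hφ
  rw [inner_sum, ← Finset.sum_neg_distrib]
  exact Finset.sum_congr rfl fun k _ => h k φ hφ

end Weak

/-! ### The graph of the iterated divergence -/

section Graph

variable {d : ℕ} {Ω : Set (EuclideanSpace ℝ (Fin d))}

/-- The Hilbert space `L²(Ω, ℝ^{d×d}) × L²(Ω, ℝ^d) × L²(Ω)`. -/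
abbrev L2Triple (Ω : Set (EuclideanSpace ℝ (Fin d))) : Type :=
  WithLp 2 (L2Mat Ω × WithLp 2 (L2Vec Ω × L2 Ω))

/-- The triple `(p, div p, div² p)`. -/
def divTriple (p : L2Mat Ω) : L2Triple Ω :=
  WithLp.toLp 2 (p, WithLp.toLp 2 (matDiv p, matDiv2 p))

theorem norm_divTriple (p : L2Mat Ω) : ‖divTriple p‖ = hDiv2Norm p := by
  rw [hDiv2Norm, WithLp.prod_norm_eq_of_L2, WithLp.prod_norm_sq_eq_of_L2]
  simp [divTriple, add_assoc]

/-- `p` is symmetric, with `div p = q` and `div q = w`. -/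
def IsDivTriple (x : L2Triple Ω) : Prop :=
  IsSymmField x.fst ∧ (∀ i, IsWeakDiv (row x.fst i) (x.snd.fst i)) ∧
    IsWeakDiv x.snd.fst x.snd.snd

theorem row_add (p q : L2Mat Ω) (i : Fin d) : row (p + q) i = row p i + row q i := rfl

theorem row_smul (c : ℝ) (p : L2Mat Ω) (i : Fin d) : row (c • p) i = c • row p i := rfl

theorem continuous_row (i : Fin d) : Continuous fun p : L2Mat Ω => row p i := by
  refine (PiLp.continuous_toLp 2 _).comp (continuous_pi fun j => ?_)
  exact PiLp.continuous_apply 2 _ (i, j)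

theorem IsSymmField.add {p q : L2Mat Ω} (hp : IsSymmField p) (hq : IsSymmField q) :
    IsSymmField (p + q) := fun i j => by
  rw [PiLp.add_apply, PiLp.add_apply, hp i j, hq i j]

theorem IsSymmField.smul {p : L2Mat Ω} (c : ℝ) (hp : IsSymmField p) :
    IsSymmField (c • p) := fun i j => by
  rw [PiLp.smul_apply, PiLp.smul_apply, hp i j]

theorem IsDivTriple.add {x y : L2Triple Ω} (hx : IsDivTriple x) (hy : IsDivTriple y) :
    IsDivTriple (x + y) := by
  have e1 : (x + y).fst = x.fst + y.fst := rfl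
  have e2 : (x + y).snd.fst = x.snd.fst + y.snd.fst := rfl
  have e3 : (x + y).snd.snd = x.snd.snd + y.snd.snd := rfl
  rw [IsDivTriple, e1, e2, e3]
  refine ⟨hx.1.add hy.1, fun i => ?_, hx.2.2.add hy.2.2⟩
  rw [row_add, PiLp.add_apply]
  exact (hx.2.1 i).add (hy.2.1 i)

theorem IsDivTriple.smul {x : L2Triple Ω} (c : ℝ) (hx : IsDivTriple x) :
    IsDivTriple (c • x) := by
  have e1 : (c • x).fst = c • x.fst := rfl
  have e2 : (c • x).snd.fst = c • x.snd.fst := rfl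
  have e3 : (c • x).snd.snd = c • x.snd.snd := rfl
  rw [IsDivTriple, e1, e2, e3]
  refine ⟨hx.1.smul c, fun i => ?_, hx.2.2.smul c⟩
  rw [row_smul, PiLp.smul_apply]
  exact (hx.2.1 i).smul c

theorem continuous_triple_fst : Continuous fun x : L2Triple Ω => x.fst :=
  WithLp.continuous_fst 2 _ _

theorem continuous_triple_snd_fst : Continuous fun x : L2Triple Ω => x.snd.fst :=
  (WithLp.continuous_fst 2 _ _).comp (WithLp.continuous_snd 2 _ _)

theorem continuous_triple_snd_snd : Continuous fun x : L2Triple Ω => x.snd.snd :=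
  (WithLp.continuous_snd 2 _ _).comp (WithLp.continuous_snd 2 _ _)

theorem isClosed_isDivTriple : IsClosed {x : L2Triple Ω | IsDivTriple x} := by
  refine IsSeqClosed.isClosed fun x y hx hxy => ?_
  have h1 := (continuous_triple_fst.tendsto y).comp hxy
  have h2 := (continuous_triple_snd_fst.tendsto y).comp hxy
  have h3 := (continuous_triple_snd_snd.tendsto y).comp hxy
  refine ⟨fun i j => ?_, fun i => ?_, ?_⟩
  · have e1 := ((PiLp.continuous_apply 2 _ (i, j)).tendsto _).comp h1
    have e2 := ((PiLp.continuous_apply 2 _ (j, i)).tendsto _).comp h1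
    refine tendsto_nhds_unique e1 ?_
    convert e2 using 1
    ext1 n
    exact (hx n).1 i j
  · exact IsWeakDiv.of_tendsto (fun n => (hx n).2.1 i)
      (((continuous_row i).tendsto _).comp h1) (((PiLp.continuous_apply 2 _ i).tendsto _).comp h2)
  · exact IsWeakDiv.of_tendsto (fun n => (hx n).2.2) h2 h3

theorem IsDivTriple.matDiv_eq (hΩ : IsOpen Ω) {x : L2Triple Ω} (hx : IsDivTriple x) :
    matDiv x.fst = x.snd.fst := by
  ext1 i
  exact (hx.2.1 i).vecDiv_eq hΩ

/-- The last two components are determined by the first because weak divergences are unique. The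
closed set of such triples is therefore the graph of p ↦ (div p, div² p). -/
theorem IsDivTriple.eq_divTriple (hΩ : IsOpen Ω) {x : L2Triple Ω} (hx : IsDivTriple x) :
    divTriple x.fst = x := by
  have h2 : matDiv2 x.fst = x.snd.snd := by
    rw [matDiv2, hx.matDiv_eq hΩ]
    exact hx.2.2.vecDiv_eq hΩ
  simp only [divTriple, hx.matDiv_eq hΩ, h2]
  rfl

theorem mem_HDiv2_iff (hΩ : IsOpen Ω) {p : L2Mat Ω} :
    p ∈ HDiv2 Ω ↔ IsDivTriple (divTriple p) := by
  constructor
  · rintro ⟨h1, q, w, h2, h3⟩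
    have hx : IsDivTriple (WithLp.toLp 2 (p, WithLp.toLp 2 (q, w)) : L2Triple Ω) := ⟨h1, h2, h3⟩
    have := hx.eq_divTriple hΩ
    change divTriple p = _ at this
    rwa [this]
  · rintro ⟨h1, h2, h3⟩
    exact ⟨h1, _, _, h2, h3⟩

/-- Membership is needed: outside `HDiv2` the divergences take the default value 0 and linearity may
fail. -/
theorem divTriple_add (hΩ : IsOpen Ω) {p q : L2Mat Ω} (hp : p ∈ HDiv2 Ω) (hq : q ∈ HDiv2 Ω) :
    divTriple (p + q) = divTriple p + divTriple q := by
  rw [mem_HDiv2_iff hΩ] at hp hq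
  exact (hp.add hq).eq_divTriple hΩ

theorem divTriple_smul (hΩ : IsOpen Ω) (c : ℝ) {p : L2Mat Ω} (hp : p ∈ HDiv2 Ω) :
    divTriple (c • p) = c • divTriple p := by
  rw [mem_HDiv2_iff hΩ] at hp
  exact (hp.smul c).eq_divTriple hΩ

theorem divTriple_sub (hΩ : IsOpen Ω) {p q : L2Mat Ω} (hp : p ∈ HDiv2 Ω) (hq : q ∈ HDiv2 Ω) :
    divTriple (p - q) = divTriple p - divTriple q := by
  have h := hq
  rw [mem_HDiv2_iff hΩ] at hp hq
  rw [sub_eq_add_neg, sub_eq_add_neg, ← neg_one_smul ℝ q, ← neg_one_smul ℝ (divTriple q)]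
  exact (hp.add (hq.smul (-1))).eq_divTriple hΩ

/-! #### Test fields -/

theorem IsTestClass.add {u v : L2 Ω} (hu : IsTestClass u) (hv : IsTestClass v) :
    IsTestClass (u + v) := by
  obtain ⟨φ, hφ, rfl⟩ := hu.exists_eq
  obtain ⟨ψ, hψ, rfl⟩ := hv.exists_eq
  rw [← toL2_add (hφ.memLp Ω 2) (hψ.memLp Ω 2)]
  exact (hφ.add hψ).isTestClass

theorem IsTestClass.smul {u : L2 Ω} (c : ℝ) (hu : IsTestClass u) : IsTestClass (c • u) := by
  obtain ⟨φ, hφ, rfl⟩ := hu.exists_eq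
  rw [← toL2_const_mul c (hφ.memLp Ω 2)]
  exact (hφ.const_mul c).isTestClass

theorem IsTestClass.zero : IsTestClass (0 : L2 Ω) :=
  ⟨_, IsTestFunction.zero, Lp.coeFn_zero ℝ 2 _⟩

variable (Ω) in
/-- The subspace of test fields. -/
def testFields : Submodule ℝ (L2Mat Ω) where
  carrier := {p | IsTestField p}
  add_mem' {p q} hp hq := ⟨hp.1.add hq.1, fun ij => (hp.2 ij).add (hq.2 ij)⟩
  zero_mem' := ⟨fun i j => rfl, fun ij => IsTestClass.zero⟩
  smul_mem' c p hp := ⟨hp.1.smul c, fun ij => (hp.2 ij).smul c⟩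

theorem IsTestClass.isWeakPartial (hΩ : IsOpen Ω) {u : L2 Ω} (hu : IsTestClass u) (k : Fin d) :
    IsWeakPartial k u (weakPartial k u) ∧ IsTestClass (weakPartial k u) := by
  obtain ⟨φ, hφ, rfl⟩ := hu.exists_eq
  rw [(hφ.isWeakPartial k).weakPartial_eq hΩ]
  exact ⟨hφ.isWeakPartial k, (hφ.partialDeriv k).isTestClass⟩

theorem IsTestClass.sum {ι : Type*} (s : Finset ι) {u : ι → L2 Ω} (h : ∀ i ∈ s, IsTestClass (u i)) :
    IsTestClass (∑ i ∈ s, u i) :=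
  Finset.sum_induction _ IsTestClass (fun _ _ => IsTestClass.add) IsTestClass.zero h

theorem IsTestField.mem_HDiv2 (hΩ : IsOpen Ω) {p : L2Mat Ω} (hp : IsTestField p) :
    p ∈ HDiv2 Ω := by
  refine ⟨hp.1, WithLp.toLp 2 fun i => ∑ j, weakPartial j (p (i, j)),
    ∑ i, weakPartial i (∑ j, weakPartial j (p (i, j))), fun i => ?_, ?_⟩
  · exact isWeakDiv_of_isWeakPartial (q := row p i) fun j => ((hp.2 (i, j)).isWeakPartial hΩ j).1
  · exact isWeakDiv_of_isWeakPartial fun i =>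
      ((IsTestClass.sum _ fun j _ => ((hp.2 (i, j)).isWeakPartial hΩ j).2).isWeakPartial hΩ i).1

/-- The triples `(p, div p, div² p)` of test fields `p`. -/
def testTriples (hΩ : IsOpen Ω) : Submodule ℝ (L2Triple Ω) where
  carrier := {x | ∃ p, IsTestField p ∧ divTriple p = x}
  add_mem' := by
    rintro _ _ ⟨p, hp, rfl⟩ ⟨q, hq, rfl⟩
    exact ⟨p + q, (testFields Ω).add_mem hp hq,
      divTriple_add hΩ (hp.mem_HDiv2 hΩ) (hq.mem_HDiv2 hΩ)⟩
  zero_mem' := ⟨0, (testFields Ω).zero_mem, by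
    have h : IsTestField (0 : L2Mat Ω) := (testFields Ω).zero_mem
    have := divTriple_smul hΩ 0 (h.mem_HDiv2 hΩ)
    rwa [zero_smul, zero_smul] at this⟩
  smul_mem' := by
    rintro c _ ⟨p, hp, rfl⟩
    exact ⟨c • p, (testFields Ω).smul_mem c hp, divTriple_smul hΩ c (hp.mem_HDiv2 hΩ)⟩

theorem isDivTriple_of_mem_closure (hΩ : IsOpen Ω) {x : L2Triple Ω}
    (hx : x ∈ (testTriples hΩ).topologicalClosure) : IsDivTriple x := by
  refine closure_minimal ?_ isClosed_isDivTriple hx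
  rintro _ ⟨p, hp, rfl⟩
  exact (mem_HDiv2_iff hΩ).1 (hp.mem_HDiv2 hΩ)

/-- The norm of H(div²) is the Hilbert norm of the triple, so the ε-δ closure in the definition is a
topological closure in `L2Triple`. Closedness, convexity and completeness are then available for
H₀(div²). -/
theorem mem_H0Div2_iff (hΩ : IsOpen Ω) {p : L2Mat Ω} :
    p ∈ H0Div2 Ω ↔ divTriple p ∈ (testTriples hΩ).topologicalClosure := by
  constructor
  · rintro ⟨hp, h⟩
    refine Metric.mem_closure_iff.2 fun δ hδ => ?_
    obtain ⟨ψ, hψ, hlt⟩ := h δ hδ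
    refine ⟨divTriple ψ, ⟨ψ, hψ, rfl⟩, ?_⟩
    rwa [dist_eq_norm, ← divTriple_sub hΩ hp (hψ.mem_HDiv2 hΩ), norm_divTriple]
  · intro h
    have hp := (mem_HDiv2_iff hΩ).2 (isDivTriple_of_mem_closure hΩ h)
    refine ⟨hp, fun δ hδ => ?_⟩
    obtain ⟨_, ⟨ψ, hψ, rfl⟩, hlt⟩ := Metric.mem_closure_iff.1 h δ hδ
    refine ⟨ψ, hψ, ?_⟩
    rwa [dist_eq_norm, ← divTriple_sub hΩ hp (hψ.mem_HDiv2 hΩ), norm_divTriple] at hlt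

theorem fst_mem_H0Div2 (hΩ : IsOpen Ω) {x : L2Triple Ω}
    (hx : x ∈ (testTriples hΩ).topologicalClosure) :
    x.fst ∈ H0Div2 Ω ∧ divTriple x.fst = x := by
  have := (isDivTriple_of_mem_closure hΩ hx).eq_divTriple hΩ
  exact ⟨(mem_H0Div2_iff hΩ).2 (by rwa [this]), this⟩

theorem IsTestField.mem_H0Div2 (hΩ : IsOpen Ω) {p : L2Mat Ω} (hp : IsTestField p) :
    p ∈ H0Div2 Ω :=
  (mem_H0Div2_iff hΩ).2 (Submodule.le_topologicalClosure _ ⟨p, hp, rfl⟩)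

/-- The subspace `H₀(div²; Ω)`. -/
def h0Div2 (hΩ : IsOpen Ω) : Submodule ℝ (L2Mat Ω) where
  carrier := H0Div2 Ω
  add_mem' {p q} hp hq := by
    rw [mem_H0Div2_iff hΩ, divTriple_add hΩ hp.1 hq.1]
    exact Submodule.add_mem _ ((mem_H0Div2_iff hΩ).1 hp) ((mem_H0Div2_iff hΩ).1 hq)
  zero_mem' := IsTestField.mem_H0Div2 hΩ (testFields Ω).zero_mem
  smul_mem' c p hp := by
    change c • p ∈ H0Div2 Ω
    rw [mem_H0Div2_iff hΩ, divTriple_smul hΩ c hp.1]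
    exact Submodule.smul_mem _ c ((mem_H0Div2_iff hΩ).1 hp)

theorem matDiv2_eq_snd (p : L2Mat Ω) : matDiv2 p = (divTriple p).snd.snd := rfl

theorem matDiv_eq_snd (p : L2Mat Ω) : matDiv p = (divTriple p).snd.fst := rfl

end Graph

end TGV

end

noncomputable section

namespace TGV

/-! ### The space `H₀²` -/

section H02

variable {d : ℕ} {Ω : Set (EuclideanSpace ℝ (Fin d))}

theorem IsTestClass.inner_weakPartial (hΩ : IsOpen Ω) {u v : L2 Ω} (hu : IsTestClass u)
    (hv : IsTestClass v) (k : Fin d) : ⟪weakPartial k u, v⟫_ℝ = - ⟪u, weakPartial k v⟫_ℝ := by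
  obtain ⟨φ, hφ, rfl⟩ := hu.exists_eq
  rw [(hφ.isWeakPartial k).weakPartial_eq hΩ]
  exact isWeakPartial_iff.1 (hv.isWeakPartial hΩ k).1 φ hφ

theorem IsTestClass.weakPartial_comm (hΩ : IsOpen Ω) {u : L2 Ω} (hu : IsTestClass u)
    (k l : Fin d) : weakPartial k (weakPartial l u) = weakPartial l (weakPartial k u) := by
  obtain ⟨φ, hφ, rfl⟩ := hu.exists_eq
  rw [(hφ.isWeakPartial k).weakPartial_eq hΩ, (hφ.isWeakPartial l).weakPartial_eq hΩ,
    ((hφ.partialDeriv k).isWeakPartial l).weakPartial_eq hΩ,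
    ((hφ.partialDeriv l).isWeakPartial k).weakPartial_eq hΩ, partialDeriv_comm k l hφ.1]

/-- The weak Laplacian of a scalar function. -/
def lap (u : L2 Ω) : L2 Ω := ∑ k, weakPartial k (weakPartial k u)

/-- Integrating by parts twice moves ⟨∂ₗ∂ₖu, ∂ₗ∂ₖu⟩ to ⟨∂ₖ∂ₖu, ∂ₗ∂ₗu⟩; compact support removes
boundary terms, and third derivatives commute. -/
theorem IsTestClass.sum_norm_sq_hessian (hΩ : IsOpen Ω) {u : L2 Ω} (hu : IsTestClass u) :
    ∑ k, ∑ l, ‖weakPartial l (weakPartial k u)‖ ^ 2 = ‖lap u‖ ^ 2 := by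
  rw [← real_inner_self_eq_norm_sq (lap u), lap, sum_inner]
  refine Finset.sum_congr rfl fun k _ => ?_
  rw [inner_sum]
  refine Finset.sum_congr rfl fun l _ => ?_
  have hk := (hu.isWeakPartial hΩ k).2
  have hl := (hu.isWeakPartial hΩ l).2
  have hlk := (hk.isWeakPartial hΩ l).2
  have hll := (hl.isWeakPartial hΩ l).2
  rw [← real_inner_self_eq_norm_sq, hk.inner_weakPartial hΩ hlk, hk.inner_weakPartial hΩ hll,
    hu.weakPartial_comm hΩ l k, hl.weakPartial_comm hΩ l k]

theorem IsTestClass.norm_hessian_le (hΩ : IsOpen Ω) {u : L2 Ω} (hu : IsTestClass u)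
    (k l : Fin d) : ‖weakPartial l (weakPartial k u)‖ ≤ ‖lap u‖ := by
  refine le_of_sq_le_sq ?_ (norm_nonneg _)
  rw [← hu.sum_norm_sq_hessian hΩ]
  calc ‖weakPartial l (weakPartial k u)‖ ^ 2
      ≤ ∑ l, ‖weakPartial l (weakPartial k u)‖ ^ 2 :=
        Finset.single_le_sum (f := fun l => ‖weakPartial l (weakPartial k u)‖ ^ 2)
          (fun _ _ => sq_nonneg _) (Finset.mem_univ l)
    _ ≤ _ := Finset.single_le_sum
          (f := fun k => ∑ l, ‖weakPartial l (weakPartial k u)‖ ^ 2)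
          (fun _ _ => Finset.sum_nonneg fun _ _ => sq_nonneg _) (Finset.mem_univ k)

/-- Interpolation: Σ‖∂ₖu‖² = -⟨u, Δu⟩ ≤ ‖u‖ ‖Δu‖ ≤ (‖u‖ + ‖Δu‖)². -/
theorem IsTestClass.norm_weakPartial_le (hΩ : IsOpen Ω) {u : L2 Ω} (hu : IsTestClass u)
    (k : Fin d) : ‖weakPartial k u‖ ≤ ‖u‖ + ‖lap u‖ := by
  refine le_of_sq_le_sq ?_ (by positivity)
  have h1 : ∑ k, ‖weakPartial k u‖ ^ 2 = - ⟪u, lap u⟫_ℝ := by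
    rw [lap, inner_sum, ← Finset.sum_neg_distrib]
    refine Finset.sum_congr rfl fun k _ => ?_
    rw [← real_inner_self_eq_norm_sq, hu.inner_weakPartial hΩ (hu.isWeakPartial hΩ k).2]
  have h2 : ‖weakPartial k u‖ ^ 2 ≤ ∑ k, ‖weakPartial k u‖ ^ 2 :=
    Finset.single_le_sum (f := fun k => ‖weakPartial k u‖ ^ 2)
      (fun _ _ => sq_nonneg _) (Finset.mem_univ k)
  have h3 := abs_real_inner_le_norm u (lap u)
  nlinarith [neg_abs_le ⟪u, lap u⟫_ℝ, norm_nonneg u, norm_nonneg (lap u)]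

theorem norm_le_h2Norm (u : L2 Ω) : ‖u‖ ≤ h2Norm u :=
  Real.le_sqrt_of_sq_le (by
    have h1 : 0 ≤ ∑ k, ‖weakPartial k u‖ ^ 2 := Finset.sum_nonneg fun _ _ => sq_nonneg _
    have h2 : 0 ≤ ∑ k, ∑ l, ‖weakPartial l (weakPartial k u)‖ ^ 2 :=
      Finset.sum_nonneg fun _ _ => Finset.sum_nonneg fun _ _ => sq_nonneg _
    linarith)

theorem norm_hessian_le_h2Norm (u : L2 Ω) (k l : Fin d) :
    ‖weakPartial l (weakPartial k u)‖ ≤ h2Norm u :=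
  Real.le_sqrt_of_sq_le (by
    have h1 : 0 ≤ ∑ k, ‖weakPartial k u‖ ^ 2 := Finset.sum_nonneg fun _ _ => sq_nonneg _
    have h2 : ‖weakPartial l (weakPartial k u)‖ ^ 2
        ≤ ∑ l, ‖weakPartial l (weakPartial k u)‖ ^ 2 :=
      Finset.single_le_sum (f := fun l => ‖weakPartial l (weakPartial k u)‖ ^ 2)
        (fun _ _ => sq_nonneg _) (Finset.mem_univ l)
    have h3 : ∑ l, ‖weakPartial l (weakPartial k u)‖ ^ 2
        ≤ ∑ k, ∑ l, ‖weakPartial l (weakPartial k u)‖ ^ 2 :=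
      Finset.single_le_sum (f := fun k => ∑ l, ‖weakPartial l (weakPartial k u)‖ ^ 2)
        (fun _ _ => Finset.sum_nonneg fun _ _ => sq_nonneg _) (Finset.mem_univ k)
    nlinarith [norm_nonneg u])

theorem H2_isWeakPartial (hΩ : IsOpen Ω) {u : L2 Ω} (hu : u ∈ H2 Ω) :
    (∀ k, IsWeakPartial k u (weakPartial k u)) ∧
      ∀ k l, IsWeakPartial l (weakPartial k u) (weakPartial l (weakPartial k u)) := by
  obtain ⟨g, h, h1, h2⟩ := hu
  have e1 : ∀ k, weakPartial k u = g k := fun k => (h1 k).weakPartial_eq hΩ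
  have e2 : ∀ k l, weakPartial l (g k) = h k l := fun k l => (h2 k l).weakPartial_eq hΩ
  simp only [e1, e2]
  exact ⟨h1, h2⟩

theorem tendsto_of_norm_sub_lt {F : Type*} [NormedAddCommGroup F] {u : F} {v : ℕ → F}
    (h : ∀ n : ℕ, ‖u - v n‖ ≤ 1 / ((n : ℝ) + 1)) : Tendsto v atTop (𝓝 u) := by
  rw [tendsto_iff_norm_sub_tendsto_zero]
  refine squeeze_zero (fun n => norm_nonneg _) (fun n => ?_) tendsto_one_div_add_atTop_nhds_zero_nat
  rw [norm_sub_rev]; exact h n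

theorem exists_seq_of_mem_H02 (hΩ : IsOpen Ω) {u : L2 Ω} (hu : u ∈ H02 Ω) :
    ∃ v : ℕ → L2 Ω, (∀ n, IsTestClass (v n)) ∧ Tendsto v atTop (𝓝 u) ∧
      ∀ k l, Tendsto (fun n => weakPartial l (weakPartial k (v n))) atTop
        (𝓝 (weakPartial l (weakPartial k u))) := by
  choose v hv hlt using fun n : ℕ => hu.2 (1 / ((n : ℝ) + 1)) (by positivity)
  obtain ⟨h1, h2⟩ := H2_isWeakPartial hΩ hu.1
  refine ⟨v, hv, tendsto_of_norm_sub_lt fun n => ((norm_le_h2Norm _).trans (hlt n).le),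
    fun k l => tendsto_of_norm_sub_lt fun n => ?_⟩
  have hk := (hv n).isWeakPartial hΩ k
  have e1 : weakPartial k (u - v n) = weakPartial k u - weakPartial k (v n) :=
    ((h1 k).sub hk.1).weakPartial_eq hΩ
  have e2 : weakPartial l (weakPartial k (u - v n))
      = weakPartial l (weakPartial k u) - weakPartial l (weakPartial k (v n)) := by
    rw [e1]
    exact ((h2 k l).sub (hk.2.isWeakPartial hΩ l).1).weakPartial_eq hΩ
  rw [← e2]
  exact (norm_hessian_le_h2Norm _ k l).trans (hlt n).le

/-- Weak derivatives are closed operators, so the limits of the derivatives are the derivatives of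
the limit; the H² distance from `v n` to `u` is then a finite sum of vanishing terms. -/
theorem mem_H02_of_tendsto (hΩ : IsOpen Ω) {v : ℕ → L2 Ω} (hv : ∀ n, IsTestClass (v n))
    {u : L2 Ω} {g : Fin d → L2 Ω} {h : Fin d → Fin d → L2 Ω} (hu : Tendsto v atTop (𝓝 u))
    (hg : ∀ k, Tendsto (fun n => weakPartial k (v n)) atTop (𝓝 (g k)))
    (hh : ∀ k l, Tendsto (fun n => weakPartial l (weakPartial k (v n))) atTop (𝓝 (h k l))) :
    u ∈ H02 Ω ∧ ∀ k l, weakPartial l (weakPartial k u) = h k l := by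
  have h1 : ∀ k, IsWeakPartial k u (g k) := fun k =>
    IsWeakPartial.of_tendsto (fun n => ((hv n).isWeakPartial hΩ k).1) hu (hg k)
  have h2 : ∀ k l, IsWeakPartial l (g k) (h k l) := fun k l =>
    IsWeakPartial.of_tendsto
      (fun n => (((hv n).isWeakPartial hΩ k).2.isWeakPartial hΩ l).1) (hg k) (hh k l)
  have e1 : ∀ k, weakPartial k u = g k := fun k => (h1 k).weakPartial_eq hΩ
  have e2 : ∀ k l, weakPartial l (g k) = h k l := fun k l => (h2 k l).weakPartial_eq hΩ
  refine ⟨⟨⟨g, h, h1, h2⟩, fun δ hδ => ?_⟩, fun k l => by rw [e1, e2]⟩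
  have key : ∀ n, h2Norm (u - v n) = Real.sqrt (‖u - v n‖ ^ 2 +
      ∑ k, ‖g k - weakPartial k (v n)‖ ^ 2 +
      ∑ k, ∑ l, ‖h k l - weakPartial l (weakPartial k (v n))‖ ^ 2) := fun n => by
    have f1 : ∀ k, weakPartial k (u - v n) = g k - weakPartial k (v n) := fun k =>
      ((h1 k).sub ((hv n).isWeakPartial hΩ k).1).weakPartial_eq hΩ
    have f2 : ∀ k l, weakPartial l (g k - weakPartial k (v n))
        = h k l - weakPartial l (weakPartial k (v n)) := fun k l =>
      ((h2 k l).sub (((hv n).isWeakPartial hΩ k).2.isWeakPartial hΩ l).1).weakPartial_eq hΩ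
    simp only [h2Norm, f1, f2]
  have hlim : Tendsto (fun n => h2Norm (u - v n)) atTop (𝓝 0) := by
    simp only [key]
    have a1 : Tendsto (fun n => ‖u - v n‖ ^ 2) atTop (𝓝 (‖u - u‖ ^ 2)) :=
      ((tendsto_const_nhds.sub hu).norm).pow 2
    have a2 : Tendsto (fun n => ∑ k, ‖g k - weakPartial k (v n)‖ ^ 2) atTop
        (𝓝 (∑ k, ‖g k - g k‖ ^ 2)) :=
      tendsto_finsetSum _ fun k _ => ((tendsto_const_nhds.sub (hg k)).norm).pow 2
    have a3 : Tendsto (fun n => ∑ k, ∑ l, ‖h k l - weakPartial l (weakPartial k (v n))‖ ^ 2) atTop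
        (𝓝 (∑ k, ∑ l, ‖h k l - h k l‖ ^ 2)) :=
      tendsto_finsetSum _ fun k _ => tendsto_finsetSum _ fun l _ =>
        ((tendsto_const_nhds.sub (hh k l)).norm).pow 2
    have := (Real.continuous_sqrt.tendsto _).comp ((a1.add a2).add a3)
    simpa [Function.comp_def] using this
  obtain ⟨n, hn⟩ := (hlim.eventually_lt_const hδ).exists
  exact ⟨v n, hv n, hn⟩

end H02

/-! ### The graph of the Laplacian on `H₀²(Ω, S^{d×d})` -/

section LapGraph

variable {d : ℕ} {Ω : Set (EuclideanSpace ℝ (Fin d))}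

/-- The Hilbert space `L²(Ω, ℝ^{d×d}) × L²(Ω, ℝ^{d×d})`. -/
abbrev L2MatPair (Ω : Set (EuclideanSpace ℝ (Fin d))) : Type :=
  WithLp 2 (L2Mat Ω × L2Mat Ω)

/-- The pair `(p, Δ p)`. -/
def lapPair (p : L2Mat Ω) : L2MatPair Ω := WithLp.toLp 2 (p, laplacian p)

theorem IsTestClass.lap_add (hΩ : IsOpen Ω) {u v : L2 Ω} (hu : IsTestClass u)
    (hv : IsTestClass v) : lap (u + v) = lap u + lap v := by
  simp only [lap, ← Finset.sum_add_distrib]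
  refine Finset.sum_congr rfl fun k _ => ?_
  have h1 := hu.isWeakPartial hΩ k
  have h2 := hv.isWeakPartial hΩ k
  rw [(h1.1.add h2.1).weakPartial_eq hΩ]
  exact ((h1.2.isWeakPartial hΩ k).1.add (h2.2.isWeakPartial hΩ k).1).weakPartial_eq hΩ

theorem IsTestClass.lap_smul (hΩ : IsOpen Ω) (c : ℝ) {u : L2 Ω} (hu : IsTestClass u) :
    lap (c • u) = c • lap u := by
  simp only [lap, Finset.smul_sum]
  refine Finset.sum_congr rfl fun k _ => ?_
  have h1 := hu.isWeakPartial hΩ k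
  rw [(h1.1.smul c).weakPartial_eq hΩ]
  exact ((h1.2.isWeakPartial hΩ k).1.smul c).weakPartial_eq hΩ

theorem IsTestField.lapPair_add (hΩ : IsOpen Ω) {p q : L2Mat Ω} (hp : IsTestField p)
    (hq : IsTestField q) : lapPair (p + q) = lapPair p + lapPair q := by
  have : laplacian (p + q) = laplacian p + laplacian q := by
    ext1 ij
    exact (hp.2 ij).lap_add hΩ (hq.2 ij)
  rw [lapPair, this]; rfl

theorem IsTestField.lapPair_smul (hΩ : IsOpen Ω) (c : ℝ) {p : L2Mat Ω} (hp : IsTestField p) :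
    lapPair (c • p) = c • lapPair p := by
  have : laplacian (c • p) = c • laplacian p := by
    ext1 ij
    exact (hp.2 ij).lap_smul hΩ c
  rw [lapPair, this]; rfl

/-- The pairs `(p, Δ p)` of test fields `p`. -/
def testLapPairs (hΩ : IsOpen Ω) : Submodule ℝ (L2MatPair Ω) where
  carrier := {x | ∃ p, IsTestField p ∧ lapPair p = x}
  add_mem' := by
    rintro _ _ ⟨p, hp, rfl⟩ ⟨q, hq, rfl⟩
    exact ⟨p + q, (testFields Ω).add_mem hp hq, hp.lapPair_add hΩ hq⟩
  zero_mem' := ⟨0, (testFields Ω).zero_mem, by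
    have h : IsTestField (0 : L2Mat Ω) := (testFields Ω).zero_mem
    have := h.lapPair_smul hΩ 0
    rwa [zero_smul, zero_smul] at this⟩
  smul_mem' := by
    rintro c _ ⟨p, hp, rfl⟩
    exact ⟨c • p, (testFields Ω).smul_mem c hp, hp.lapPair_smul hΩ c⟩

theorem norm_piLp_le_sum {ι : Type*} [Fintype ι] {F : ι → Type*} [∀ i, NormedAddCommGroup (F i)]
    (x : PiLp 2 F) : ‖x‖ ≤ ∑ i, ‖x i‖ := by
  refine le_of_sq_le_sq ?_ (by positivity)
  rw [PiLp.norm_sq_eq_of_L2]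
  exact Finset.sum_sq_le_sq_sum_of_nonneg fun i _ => norm_nonneg _

theorem IsTestField.matDiv_apply (hΩ : IsOpen Ω) {p : L2Mat Ω} (hp : IsTestField p) (i : Fin d) :
    matDiv p i = ∑ j, weakPartial j (p (i, j)) :=
  (isWeakDiv_of_isWeakPartial (q := row p i)
    fun j => ((hp.2 (i, j)).isWeakPartial hΩ j).1).vecDiv_eq hΩ

theorem IsTestField.isTestClass_matDiv (hΩ : IsOpen Ω) {p : L2Mat Ω} (hp : IsTestField p)
    (i : Fin d) : IsTestClass (matDiv p i) := by
  rw [hp.matDiv_apply hΩ]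
  exact IsTestClass.sum _ fun j _ => ((hp.2 (i, j)).isWeakPartial hΩ j).2

theorem IsTestField.matDiv2_eq (hΩ : IsOpen Ω) {p : L2Mat Ω} (hp : IsTestField p) :
    matDiv2 p = ∑ i, weakPartial i (matDiv p i) :=
  (isWeakDiv_of_isWeakPartial fun i =>
    ((hp.isTestClass_matDiv hΩ i).isWeakPartial hΩ i).1).vecDiv_eq hΩ

/-- With R the norm of (p, Δp), first derivatives of entries are at most 2R and second ones at most
R. Each of the two divergences involves d² of them, whence 1 + 2d² + d². -/
theorem IsTestField.norm_divTriple_le (hΩ : IsOpen Ω) {p : L2Mat Ω} (hp : IsTestField p) :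
    ‖divTriple p‖ ≤ (1 + 3 * (d : ℝ) ^ 2) * ‖lapPair p‖ := by
  set R := ‖lapPair p‖
  have hp1 : ‖p‖ ≤ R := WithLp.norm_fst_le _ (lapPair p)
  have hp2 : ‖laplacian p‖ ≤ R := WithLp.norm_snd_le _ (lapPair p)
  have hc1 : ∀ ij, ‖p ij‖ ≤ R := fun ij => (PiLp.norm_apply_le p ij).trans hp1
  have hc2 : ∀ ij, ‖lap (p ij)‖ ≤ R := fun ij => (PiLp.norm_apply_le (laplacian p) ij).trans hp2
  have hg : ∀ ij k, ‖weakPartial k (p ij)‖ ≤ 2 * R := fun ij k => by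
    linarith [(hp.2 ij).norm_weakPartial_le hΩ k, hc1 ij, hc2 ij]
  have hh : ∀ ij k l, ‖weakPartial l (weakPartial k (p ij))‖ ≤ R := fun ij k l =>
    ((hp.2 ij).norm_hessian_le hΩ k l).trans (hc2 ij)
  have hq : ∀ i, matDiv p i = ∑ j, weakPartial j (p (i, j)) := hp.matDiv_apply hΩ
  have hw : matDiv2 p = ∑ i, ∑ j, weakPartial i (weakPartial j (p (i, j))) := by
    rw [hp.matDiv2_eq hΩ]
    refine Finset.sum_congr rfl fun i _ => IsWeakPartial.weakPartial_eq hΩ ?_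
    rw [hq, isWeakPartial_iff]
    intro φ hφ
    rw [inner_sum, inner_sum, ← Finset.sum_neg_distrib]
    exact Finset.sum_congr rfl fun j _ => isWeakPartial_iff.1
      (((hp.2 (i, j)).isWeakPartial hΩ j).2.isWeakPartial hΩ i).1 φ hφ
  have hb1 : ‖matDiv p‖ ≤ 2 * d ^ 2 * R := by
    calc ‖matDiv p‖ ≤ ∑ i, ‖matDiv p i‖ := norm_piLp_le_sum _
      _ ≤ ∑ _i : Fin d, ∑ _j : Fin d, 2 * R := Finset.sum_le_sum fun i _ => by
          rw [hq]
          exact (norm_sum_le _ _).trans (Finset.sum_le_sum fun j _ => hg _ _)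
      _ = 2 * d ^ 2 * R := by simp; ring
  have hb2 : ‖matDiv2 p‖ ≤ d ^ 2 * R := by
    rw [hw]
    calc _ ≤ ∑ _i : Fin d, ∑ _j : Fin d, R := (norm_sum_le _ _).trans
          (Finset.sum_le_sum fun i _ => (norm_sum_le _ _).trans
            (Finset.sum_le_sum fun j _ => hh _ _ _))
      _ = d ^ 2 * R := by simp; ring
  have hR0 : 0 ≤ R := norm_nonneg _
  rw [norm_divTriple, hDiv2Norm]
  refine Real.sqrt_le_iff.2 ⟨by positivity, ?_⟩
  have : ‖p‖ ^ 2 + ‖matDiv p‖ ^ 2 + ‖matDiv2 p‖ ^ 2 ≤ (‖p‖ + ‖matDiv p‖ + ‖matDiv2 p‖) ^ 2 := by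
    nlinarith [mul_nonneg (norm_nonneg p) (norm_nonneg (matDiv p)),
      mul_nonneg (norm_nonneg p) (norm_nonneg (matDiv2 p)),
      mul_nonneg (norm_nonneg (matDiv p)) (norm_nonneg (matDiv2 p))]
  refine this.trans (pow_le_pow_left₀ (by positivity) ?_ 2)
  linarith

/-- A limit of pairs `(pₙ, Δ pₙ)` with test fields `pₙ` is the pair `(p, Δ p)` of some
`p ∈ H₀²`, and `p ∈ H₀(div²)` with a bound. -/
theorem fst_mem_H02Sym (hΩ : IsOpen Ω) {x : L2MatPair Ω}
    (hx : x ∈ (testLapPairs hΩ).topologicalClosure) :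
    x.fst ∈ H02Sym Ω ∧ lapPair x.fst = x ∧ x.fst ∈ H0Div2 Ω ∧
      ‖divTriple x.fst‖ ≤ (1 + 3 * (d : ℝ) ^ 2) * ‖x‖ := by
  obtain ⟨y, hy, hlim⟩ := mem_closure_iff_seq_limit.1 hx
  choose p hp hpy using hy
  have hsub : ∀ m n, IsTestField (p m - p n) := fun m n => (testFields Ω).sub_mem (hp m) (hp n)
  have hlsub : ∀ m n, lapPair (p m - p n) = y m - y n := fun m n => by
    have h1 : IsTestField ((-1 : ℝ) • p n) := (testFields Ω).smul_mem _ (hp n)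
    rw [sub_eq_add_neg, ← neg_one_smul ℝ (p n), (hp m).lapPair_add hΩ h1,
      (hp n).lapPair_smul hΩ, hpy, hpy, neg_one_smul, ← sub_eq_add_neg]
  have hcauchy : CauchySeq y := hlim.cauchySeq
  have hp1 : Tendsto p atTop (𝓝 x.fst) := by
    have := ((WithLp.continuous_fst 2 _ _).tendsto x).comp hlim
    convert this using 1
    ext1 n
    rw [Function.comp_apply, ← hpy]; rfl
  have hp2 : Tendsto (fun n => laplacian (p n)) atTop (𝓝 x.snd) := by
    have := ((WithLp.continuous_snd 2 _ _).tendsto x).comp hlim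
    convert this using 1
    ext1 n
    rw [Function.comp_apply, ← hpy]; rfl
  -- sequences controlled by `y` converge
  have hconv : ∀ {F : Type} [NormedAddCommGroup F] [CompleteSpace F] (z : ℕ → F) (C : ℝ),
      (∀ m n, ‖z m - z n‖ ≤ C * ‖y m - y n‖) → ∃ z', Tendsto z atTop (𝓝 z') := by
    intro F _ _ z C hz
    refine cauchySeq_tendsto_of_complete (Metric.cauchySeq_iff'.2 fun δ hδ => ?_)
    obtain ⟨n0, hn0⟩ := Metric.cauchySeq_iff'.1 hcauchy (δ / (|C| + 1)) (by positivity)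
    refine ⟨n0, fun n hn => ?_⟩
    have h1 := hn0 n hn
    rw [dist_eq_norm] at h1 ⊢
    rw [lt_div_iff₀ (by positivity)] at h1
    calc ‖z n - z n0‖ ≤ C * ‖y n - y n0‖ := hz _ _
      _ ≤ (|C| + 1) * ‖y n - y n0‖ := by
        gcongr; linarith [le_abs_self C]
      _ < δ := by linarith
  have hcomp : ∀ m n ij, ‖(p m - p n) ij‖ ≤ ‖y m - y n‖ ∧ ‖lap ((p m - p n) ij)‖ ≤ ‖y m - y n‖ := by
    intro m n ij
    rw [← hlsub]
    exact ⟨(PiLp.norm_apply_le _ ij).trans (WithLp.norm_fst_le _ (lapPair (p m - p n))),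
      (PiLp.norm_apply_le (laplacian (p m - p n)) ij).trans
        (WithLp.norm_snd_le _ (lapPair (p m - p n)))⟩
  have hder : ∀ m n ij k, weakPartial k ((p m - p n) ij)
      = weakPartial k (p m ij) - weakPartial k (p n ij) := fun m n ij k =>
    (((((hp m).2 ij).isWeakPartial hΩ k).1).sub
      ((((hp n).2 ij).isWeakPartial hΩ k).1)).weakPartial_eq hΩ
  have hder2 : ∀ m n ij k l, weakPartial l (weakPartial k ((p m - p n) ij))
      = weakPartial l (weakPartial k (p m ij)) - weakPartial l (weakPartial k (p n ij)) :=
    fun m n ij k l => by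
      rw [hder]
      exact ((((((hp m).2 ij).isWeakPartial hΩ k).2).isWeakPartial hΩ l).1.sub
        (((((hp n).2 ij).isWeakPartial hΩ k).2).isWeakPartial hΩ l).1).weakPartial_eq hΩ
  have hg : ∀ ij k, ∃ g, Tendsto (fun n => weakPartial k (p n ij)) atTop (𝓝 g) := fun ij k =>
    hconv _ 2 fun m n => by
      rw [← hder]
      have := ((hsub m n).2 ij).norm_weakPartial_le hΩ k
      linarith [(hcomp m n ij).1, (hcomp m n ij).2]
  have hh : ∀ ij k l, ∃ g, Tendsto (fun n => weakPartial l (weakPartial k (p n ij))) atTop (𝓝 g) :=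
    fun ij k l => hconv _ 1 fun m n => by
      rw [← hder2, one_mul]
      exact (((hsub m n).2 ij).norm_hessian_le hΩ k l).trans (hcomp m n ij).2
  choose g hg using hg
  choose h hh using hh
  have hH : ∀ ij, x.fst ij ∈ H02 Ω ∧
      ∀ k l, weakPartial l (weakPartial k (x.fst ij)) = h ij k l := fun ij =>
    mem_H02_of_tendsto hΩ (fun n => (hp n).2 ij)
      (((PiLp.continuous_apply 2 _ ij).tendsto _).comp hp1) (hg ij) (hh ij)
  have hlap : laplacian x.fst = x.snd := by
    refine tendsto_nhds_unique ?_ hp2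
    have hc : Tendsto (fun n => WithLp.toLp 2 (fun ij => lap (p n ij)) : ℕ → L2Mat Ω) atTop
        (𝓝 (WithLp.toLp 2 fun ij => lap (x.fst ij))) := by
      refine ((PiLp.continuous_toLp 2 _).tendsto _).comp (tendsto_pi_nhds.2 fun ij => ?_)
      simp only [lap, (hH ij).2]
      exact tendsto_finsetSum _ fun k _ => hh ij k k
    exact hc
  -- The linear estimate for differences makes the triples Cauchy as well. Their limit lies in the
  -- closure of the test triples and has the same first component, so it is the triple of `x.fst`.
  obtain ⟨y', hy'⟩ := hconv (fun n => divTriple (p n)) (1 + 3 * (d : ℝ) ^ 2) fun m n => by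
    rw [← divTriple_sub hΩ ((hp m).mem_HDiv2 hΩ) ((hp n).mem_HDiv2 hΩ), ← hlsub]
    exact (hsub m n).norm_divTriple_le hΩ
  have hy'mem : y' ∈ (testTriples hΩ).topologicalClosure :=
    mem_closure_iff_seq_limit.2 ⟨_, fun n => ⟨p n, hp n, rfl⟩, hy'⟩
  have hfst : y'.fst = x.fst :=
    tendsto_nhds_unique ((continuous_triple_fst.tendsto y').comp hy') hp1
  obtain ⟨hm, he⟩ := fst_mem_H0Div2 hΩ hy'mem
  rw [hfst] at hm he
  refine ⟨⟨fun i j => ?_, fun ij => (hH ij).1⟩, ?_, hm, ?_⟩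
  · exact hm.1.1 i j
  · rw [lapPair, hlap]; rfl
  · rw [he]
    refine le_of_tendsto_of_tendsto' hy'.norm (hlim.norm.const_mul _) fun n => ?_
    rw [← hpy]
    exact (hp n).norm_divTriple_le hΩ

/-- Approximating the entries independently could destroy symmetry, so the approximants of the upper
triangle are reused below the diagonal through the index map `o`. -/
theorem lapPair_mem_closure (hΩ : IsOpen Ω) {p : L2Mat Ω} (hp : p ∈ H02Sym Ω) :
    lapPair p ∈ (testLapPairs hΩ).topologicalClosure := by
  choose v hv hv1 hv2 using fun ij => exists_seq_of_mem_H02 hΩ (hp.2 ij)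
  let o : Fin d × Fin d → Fin d × Fin d := fun ij => if ij.1 ≤ ij.2 then ij else (ij.2, ij.1)
  have ho : ∀ ij, p (o ij) = p ij := fun ij => by
    by_cases h : ij.1 ≤ ij.2
    · simp only [o, if_pos h]
    · simp only [o, if_neg h]; exact hp.1 _ _
  have hoswap : ∀ i j, o (i, j) = o (j, i) := fun i j => by
    rcases lt_trichotomy i j with h | h | h
    · simp [o, h.le, not_le.2 h]
    · rw [h]
    · simp [o, h.le, not_le.2 h]
  let ψ : ℕ → L2Mat Ω := fun n => WithLp.toLp 2 fun ij => v (o ij) n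
  have hψ : ∀ n, IsTestField (ψ n) := fun n =>
    ⟨fun i j => by change v (o (i, j)) n = v (o (j, i)) n; rw [hoswap], fun ij => hv (o ij) n⟩
  refine mem_closure_iff_seq_limit.2 ⟨fun n => lapPair (ψ n), fun n => ⟨ψ n, hψ n, rfl⟩, ?_⟩
  have h1 : Tendsto ψ atTop (𝓝 p) := by
    have : Tendsto ψ atTop (𝓝 (WithLp.toLp 2 fun ij => p ij)) := by
      refine ((PiLp.continuous_toLp 2 _).tendsto _).comp (tendsto_pi_nhds.2 fun ij => ?_)
      rw [← ho ij]
      exact hv1 (o ij)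
    exact this
  have h2 : Tendsto (fun n => laplacian (ψ n)) atTop (𝓝 (laplacian p)) := by
    refine ((PiLp.continuous_toLp 2 _).tendsto _).comp (tendsto_pi_nhds.2 fun ij => ?_)
    change Tendsto (fun n => lap (v (o ij) n)) atTop (𝓝 (lap (p ij)))
    rw [← ho ij]
    exact tendsto_finsetSum _ fun k _ => hv2 (o ij) k k
  exact ((WithLp.prod_continuous_toLp 2 _ _).tendsto (p, laplacian p)).comp (h1.prodMk_nhds h2)

theorem IsTestField.mem_H02Sym (hΩ : IsOpen Ω) {p : L2Mat Ω} (hp : IsTestField p) :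
    p ∈ H02Sym Ω :=
  (fst_mem_H02Sym hΩ (x := lapPair p) (Submodule.le_topologicalClosure _ ⟨p, hp, rfl⟩)).1

theorem H02Sym_subset_H0Div2 (hΩ : IsOpen Ω) : H02Sym Ω ⊆ H0Div2 Ω := fun _ hp =>
  (fst_mem_H02Sym hΩ (lapPair_mem_closure hΩ hp)).2.2.1

end LapGraph

end TGV

end

noncomputable section

namespace TGV

/-! ### Convex minimization in Hilbert spaces -/

section Hilbert

theorem cauchySeq_of_norm_sub_sq_le {X : Type*} [NormedAddCommGroup X] {x : ℕ → X} {b : ℕ → ℝ} (hb : Tendsto b atTop (𝓝 0))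
    (h : ∀ n m, n ≤ m → ‖x n - x m‖ ^ 2 ≤ b n) : CauchySeq x := by
  refine Metric.cauchySeq_iff'.2 fun δ hδ => ?_
  obtain ⟨n, hn⟩ := (hb.eventually_lt_const (show (0 : ℝ) < δ ^ 2 by positivity)).exists
  refine ⟨n, fun m hm => ?_⟩
  rw [dist_comm, dist_eq_norm]
  exact lt_of_pow_lt_pow_left₀ 2 hδ.le ((h n m hm).trans_lt hn)

variable {X : Type*} [NormedAddCommGroup X] [InnerProductSpace ℝ X]

theorem norm_midpoint_sq (x y : X) :
    ‖(1 / 2 : ℝ) • x + (1 / 2 : ℝ) • y‖ ^ 2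
      = 1 / 2 * ‖x‖ ^ 2 + 1 / 2 * ‖y‖ ^ 2 - 1 / 4 * ‖x - y‖ ^ 2 := by
  rw [← smul_add, norm_smul, mul_pow, Real.norm_of_nonneg (by norm_num : (0 : ℝ) ≤ 1 / 2)]
  have := parallelogram_law_with_norm ℝ x y
  nlinarith

variable [CompleteSpace X]

/-- A quadratically regularized midpoint-convex function has exactly one minimizer. -/
theorem existsUnique_minimizer {K : Set X} (hK : IsClosed K) (hne : K.Nonempty)
    (hmid : ∀ x ∈ K, ∀ y ∈ K, (1 / 2 : ℝ) • x + (1 / 2 : ℝ) • y ∈ K) {G : X → ℝ}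
    (hG : ContinuousOn G K) (hG0 : ∀ x ∈ K, 0 ≤ G x)
    (hGc : ∀ x ∈ K, ∀ y ∈ K,
      G ((1 / 2 : ℝ) • x + (1 / 2 : ℝ) • y) ≤ 1 / 2 * G x + 1 / 2 * G y)
    {c : ℝ} (hc : 0 < c) :
    ∃! x, x ∈ K ∧ ∀ y ∈ K, c * ‖x‖ ^ 2 + G x ≤ c * ‖y‖ ^ 2 + G y := by
  set J : X → ℝ := fun x => c * ‖x‖ ^ 2 + G x with hJ
  have hJ0 : ∀ x ∈ K, 0 ≤ J x := fun x hx => by have := hG0 x hx; positivity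
  -- The quadratic term makes `J` uniformly midpoint-convex. Two points whose values are close to
  -- `m` are then close to each other, which gives both the Cauchy property and uniqueness.
  have hJc : ∀ x ∈ K, ∀ y ∈ K, J ((1 / 2 : ℝ) • x + (1 / 2 : ℝ) • y)
      ≤ 1 / 2 * J x + 1 / 2 * J y - c / 4 * ‖x - y‖ ^ 2 := fun x hx y hy => by
    have := hGc x hx y hy
    simp only [hJ, norm_midpoint_sq]
    linarith
  have hbdd : BddBelow (J '' K) := ⟨0, by rintro _ ⟨x, hx, rfl⟩; exact hJ0 x hx⟩
  set m := sInf (J '' K)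
  have hm : ∀ x ∈ K, m ≤ J x := fun x hx => csInf_le hbdd ⟨x, hx, rfl⟩
  have hex : ∀ n : ℕ, ∃ x ∈ K, J x < m + 1 / ((n : ℝ) + 1) := fun n => by
    obtain ⟨_, ⟨x, hx, rfl⟩, hlt⟩ := exists_lt_of_csInf_lt (hne.image J)
      (show m < m + 1 / ((n : ℝ) + 1) by have : 0 < 1 / ((n : ℝ) + 1) := by positivity
                                         linarith)
    exact ⟨x, hx, hlt⟩
  choose x hxK hx using hex
  have hcauchy : CauchySeq x := by
    refine cauchySeq_of_norm_sub_sq_le (b := fun n => 4 / c * (1 / ((n : ℝ) + 1)))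
      (by simpa using tendsto_one_div_add_atTop_nhds_zero_nat.const_mul (4 / c)) fun n k hnk => ?_
    have h1 := hJc _ (hxK n) _ (hxK k)
    have h2 := hm _ (hmid _ (hxK n) _ (hxK k))
    have h3 : 1 / ((k : ℝ) + 1) ≤ 1 / ((n : ℝ) + 1) := by gcongr
    have h4 : c / 4 * ‖x n - x k‖ ^ 2 ≤ 1 / ((n : ℝ) + 1) := by linarith [hx n, hx k]
    calc ‖x n - x k‖ ^ 2 = 4 / c * (c / 4 * ‖x n - x k‖ ^ 2) := by field_simp
      _ ≤ _ := by gcongr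
  obtain ⟨y, hy⟩ := cauchySeq_tendsto_of_complete hcauchy
  have hyK : y ∈ K := hK.mem_of_tendsto hy (.of_forall hxK)
  have hJx : Tendsto (fun n => J (x n)) atTop (𝓝 (J y)) := by
    refine ((hy.norm.pow 2).const_mul c).add ?_
    exact (hG y hyK).tendsto.comp (tendsto_nhdsWithin_iff.2 ⟨hy, .of_forall hxK⟩)
  have hJy : J y ≤ m := by
    refine le_of_tendsto_of_tendsto' hJx ?_ fun n => (hx n).le
    simpa using tendsto_one_div_add_atTop_nhds_zero_nat.const_add m
  refine ⟨y, ⟨hyK, fun z hz => hJy.trans (hm z hz)⟩, ?_⟩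
  rintro z ⟨hzK, hz⟩
  have h1 := hJc _ hzK _ hyK
  have h2 := hm _ (hmid _ hzK _ hyK)
  have h3 : J z ≤ J y := hz y hyK
  have h4 : c / 4 * ‖z - y‖ ^ 2 ≤ 0 := by linarith
  have h5 : ‖z - y‖ ^ 2 ≤ 0 := by
    by_contra h
    push Not at h
    have : 0 < c / 4 * ‖z - y‖ ^ 2 := by positivity
    linarith
  have h6 : ‖z - y‖ = 0 := pow_eq_zero_iff (two_ne_zero) |>.1 (le_antisymm h5 (by positivity))
  exact sub_eq_zero.1 (norm_eq_zero.1 h6)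

/-- A decreasing sequence of closed convex sets that all meet a fixed ball has a common point. -/
theorem exists_mem_iInter_of_antitone {D : ℕ → Set X} (hanti : Antitone D)
    (hcl : ∀ n, IsClosed (D n)) (hconv : ∀ n, Convex ℝ (D n)) {R : ℝ}
    (hR : ∀ n, ∃ x ∈ D n, ‖x‖ ≤ R) : ∃ x, ∀ n, x ∈ D n := by
  -- The points of least norm converge strongly, so no weak compactness is needed.
  have hmin : ∀ n, ∃ x ∈ D n, ∀ y ∈ D n, ‖x‖ ≤ ‖y‖ := fun n => by
    obtain ⟨y, hy, -⟩ := hR n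
    obtain ⟨x, hx, he⟩ := exists_norm_eq_iInf_of_complete_convex ⟨y, hy⟩ (hcl n).isComplete
      (hconv n) 0
    refine ⟨x, hx, fun z hz => ?_⟩
    rw [zero_sub, norm_neg] at he
    rw [he]
    have := ciInf_le (f := fun w : D n => ‖(0 : X) - w‖)
      ⟨0, by rintro _ ⟨w, rfl⟩; exact norm_nonneg _⟩ ⟨z, hz⟩
    simpa using this
  choose x hxD hx using hmin
  have hmono : Monotone fun n => ‖x n‖ ^ 2 := fun n m hnm => by
    have := hx n _ (hanti hnm (hxD m))
    dsimp only
    gcongr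
  have hbdd : BddAbove (Set.range fun n => ‖x n‖ ^ 2) := ⟨R ^ 2, by
    rintro _ ⟨n, rfl⟩
    obtain ⟨y, hy, hyR⟩ := hR n
    have := (hx n y hy).trans hyR
    dsimp only
    gcongr⟩
  have hlim := tendsto_atTop_ciSup hmono hbdd
  have hle : ∀ n, ‖x n‖ ^ 2 ≤ ⨆ n, ‖x n‖ ^ 2 := fun n => le_ciSup hbdd n
  -- For m ≥ n the midpoint of `x n` and `x m` lies in `D n` and so has norm at least ‖x n‖. The
  -- parallelogram law gives ‖x n - x m‖² ≤ 2(‖x m‖² - ‖x n‖²), and ‖x m‖² is at most the supremum.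
  have hcauchy : CauchySeq x := by
    refine cauchySeq_of_norm_sub_sq_le (b := fun n => 2 * ((⨆ n, ‖x n‖ ^ 2) - ‖x n‖ ^ 2))
      (by
        have h := (hlim.const_sub (⨆ n, ‖x n‖ ^ 2)).const_mul 2
        rwa [sub_self, mul_zero] at h) fun n m hnm => ?_
    have h1 : (1 / 2 : ℝ) • x n + (1 / 2 : ℝ) • x m ∈ D n :=
      hconv n (hxD n) (hanti hnm (hxD m)) (by norm_num) (by norm_num) (by norm_num)
    have h2 : ‖x n‖ ^ 2 ≤ ‖(1 / 2 : ℝ) • x n + (1 / 2 : ℝ) • x m‖ ^ 2 := by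
      have := hx n _ h1
      gcongr
    rw [norm_midpoint_sq] at h2
    linarith [hle m]
  obtain ⟨y, hy⟩ := cauchySeq_tendsto_of_complete hcauchy
  exact ⟨y, fun n => (hcl n).mem_of_tendsto hy
    ((eventually_ge_atTop n).mono fun m hm => hanti hm (hxD m))⟩

end Hilbert

/-! ### The fidelity term -/

section Fidelity

variable {d : ℕ} {Ω : Set (EuclideanSpace ℝ (Fin d))}

/-- `T B⁻¹`, for which `‖v‖_B = ‖T B⁻¹ v‖`. -/
def fidelityOp (T : L2 Ω →L[ℝ] L2 Ω) : L2 Ω →L[ℝ] L2 Ω := T * Ring.inverse (opB T)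

theorem adjoint_fidelityOp {T : L2 Ω →L[ℝ] L2 Ω} (hT : IsUnit (opB T)) (v : L2 Ω) :
    ContinuousLinearMap.adjoint T (fidelityOp T v) = v := by
  have h : (opB T * Ring.inverse (opB T)) v = v := by rw [Ring.mul_inverse_cancel _ hT]; rfl
  exact h

/-- Write v = T*(T B⁻¹ v) in one slot of ⟨v, B⁻¹ v⟩ and move T* across. -/
theorem bNormSq_eq {T : L2 Ω →L[ℝ] L2 Ω} (hT : IsUnit (opB T)) (v : L2 Ω) :
    bNormSq T v = ‖fidelityOp T v‖ ^ 2 := by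
  have h1 : bNormSq T v = ⟪v, Ring.inverse (opB T) v⟫_ℝ := (inner_L2 _ _).symm
  rw [h1]
  nth_rewrite 1 [← adjoint_fidelityOp hT v]
  rw [ContinuousLinearMap.adjoint_inner_left, ← real_inner_self_eq_norm_sq]
  rfl

/-- The B-norm dominates the L² norm: this bounds div² of the regularized solutions and turns
convergence of the fidelity into convergence in L². -/
theorem norm_le_fidelityOp {T : L2 Ω →L[ℝ] L2 Ω} (hT : IsUnit (opB T)) (v : L2 Ω) :
    ‖v‖ ≤ ‖ContinuousLinearMap.adjoint T‖ * ‖fidelityOp T v‖ := by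
  nth_rewrite 1 [← adjoint_fidelityOp hT v]
  exact ContinuousLinearMap.le_opNorm _ _

/-- The fidelity term `½ ‖T* f - w‖_B²` as a function of `w`. -/
def fidelity (T : L2 Ω →L[ℝ] L2 Ω) (f w : L2 Ω) : ℝ :=
  1 / 2 * ‖fidelityOp T (ContinuousLinearMap.adjoint T f - w)‖ ^ 2

theorem fidelity_nonneg (T : L2 Ω →L[ℝ] L2 Ω) (f w : L2 Ω) : 0 ≤ fidelity T f w := by
  unfold fidelity; positivity

theorem continuous_fidelity (T : L2 Ω →L[ℝ] L2 Ω) (f : L2 Ω) : Continuous (fidelity T f) := by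
  unfold fidelity; fun_prop

/-- An identity, not merely convexity: the quadratic remainder is what yields strong convergence at
the end. -/
theorem fidelity_midpoint (T : L2 Ω →L[ℝ] L2 Ω) (f v w : L2 Ω) :
    fidelity T f ((1 / 2 : ℝ) • v + (1 / 2 : ℝ) • w)
      = 1 / 2 * fidelity T f v + 1 / 2 * fidelity T f w - 1 / 8 * ‖fidelityOp T (v - w)‖ ^ 2 := by
  have h1 : ContinuousLinearMap.adjoint T f - ((1 / 2 : ℝ) • v + (1 / 2 : ℝ) • w)
      = (1 / 2 : ℝ) • (ContinuousLinearMap.adjoint T f - v)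
        + (1 / 2 : ℝ) • (ContinuousLinearMap.adjoint T f - w) := by module
  have h2 : ‖fidelityOp T (v - w)‖ = ‖fidelityOp T (ContinuousLinearMap.adjoint T f - v)
      - fidelityOp T (ContinuousLinearMap.adjoint T f - w)‖ := by
    rw [← map_sub, ← norm_neg, ← map_neg]; congr 2; abel
  rw [fidelity, h1, map_add, map_smul, map_smul, norm_midpoint_sq, h2, fidelity, fidelity]
  ring

theorem convexOn_fidelity (T : L2 Ω →L[ℝ] L2 Ω) (f : L2 Ω) :
    ConvexOn ℝ Set.univ (fidelity T f) := by
  have h : ConvexOn ℝ Set.univ fun v : L2 Ω => ‖v‖ ^ 2 :=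
    (convexOn_norm convex_univ).pow (fun _ _ => norm_nonneg _) 2
  have h2 := (h.smul (show (0 : ℝ) ≤ 1 / 2 by norm_num)).comp_affineMap
    ((fidelityOp T).toLinearMap.toAffineMap.comp
      (AffineMap.const ℝ (L2 Ω) (ContinuousLinearMap.adjoint T f) - AffineMap.id ℝ (L2 Ω)))
  exact h2

end Fidelity

/-! ### Existence of regularized solutions -/

section Regularized

variable {d : ℕ} {Ω : Set (EuclideanSpace ℝ (Fin d))} {r : ℝ≥0∞} [Fact (1 ≤ r)]
  {N : Matrix (Fin d) (Fin d) ℝ → ℝ} {α₀ α₁ : EuclideanSpace ℝ (Fin d) → ℝ}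
  {T : L2 Ω →L[ℝ] L2 Ω} {f : L2 Ω} {M : L2Mat Ω → ℝ}

theorem IsPenalty.continuousOn_fst (hΩ : IsOpen Ω) (hM : IsPenalty r N α₀ α₁ M) :
    ContinuousOn (fun x : L2Triple Ω => M x.fst) (testTriples hΩ).topologicalClosure := by
  intro x hx
  refine Metric.continuousWithinAt_iff.2 fun η hη => ?_
  obtain ⟨hx1, hx2⟩ := fst_mem_H0Div2 hΩ hx
  obtain ⟨δ, hδ, h⟩ := hM.continuous _ hx1 η hη
  refine ⟨δ, hδ, fun {y} hy hlt => ?_⟩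
  obtain ⟨hy1, hy2⟩ := fst_mem_H0Div2 hΩ hy
  refine h _ hy1 ?_
  rwa [← norm_divTriple, divTriple_sub hΩ hy1.1 hx1.1, hx2, hy2, ← dist_eq_norm]

theorem IsPenalty.midpoint (hM : IsPenalty r N α₀ α₁ M) {p q : L2Mat Ω} (hp : p ∈ H0Div2 Ω)
    (hq : q ∈ H0Div2 Ω) :
    M ((1 / 2 : ℝ) • p + (1 / 2 : ℝ) • q) ≤ 1 / 2 * M p + 1 / 2 * M q := by
  have h := hM.convex p hp q hq (1 / 2) (by norm_num) (by norm_num)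
  have e : (1 : ℝ) - 1 / 2 = 1 / 2 := by norm_num
  rwa [e] at h

theorem matDiv2_comb (hΩ : IsOpen Ω) {p q : L2Mat Ω} (hp : p ∈ H0Div2 Ω) (hq : q ∈ H0Div2 Ω)
    (a b : ℝ) : matDiv2 (a • p + b • q) = a • matDiv2 p + b • matDiv2 q := by
  have h1 : a • p ∈ H0Div2 Ω := (h0Div2 hΩ).smul_mem a hp
  have h2 : b • q ∈ H0Div2 Ω := (h0Div2 hΩ).smul_mem b hq
  rw [matDiv2_eq_snd, divTriple_add hΩ h1.1 h2.1, divTriple_smul hΩ a hp.1,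
    divTriple_smul hΩ b hq.1]
  rfl

/-- The two ε-terms merge into the squared norm of (p, Δp), which puts the objective into the form
treated by `existsUnique_minimizer`. -/
theorem regObjective_eq (hT : IsUnit (opB T)) (ε : ℝ) (p : L2Mat Ω) :
    regObjective T f M ε p
      = ε / 2 * ‖lapPair p‖ ^ 2 + (fidelity T f (matDiv2 p) + 1 / ε * M p) := by
  rw [regObjective, bNormSq_eq hT, WithLp.prod_norm_sq_eq_of_L2]
  change _ = ε / 2 * (‖p‖ ^ 2 + ‖laplacian p‖ ^ 2) + (fidelity T f (matDiv2 p) + 1 / ε * M p)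
  rw [fidelity]
  ring

/-- A linear map with a norm bound, the bound being applied to the difference of two points of the
closed subspace. -/
theorem continuousOn_divTriple_fst (hΩ : IsOpen Ω) :
    ContinuousOn (fun x : L2MatPair Ω => divTriple x.fst)
      (testLapPairs hΩ).topologicalClosure := by
  intro x hx
  refine Metric.continuousWithinAt_iff.2 fun η hη => ?_
  refine ⟨η / (1 + 3 * (d : ℝ) ^ 2), by positivity, fun {y} hy hlt => ?_⟩
  rw [lt_div_iff₀ (by positivity), dist_eq_norm] at hlt
  have h1 := (fst_mem_H02Sym hΩ (Submodule.sub_mem _ hy hx)).2.2.2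
  rw [dist_eq_norm, ← divTriple_sub hΩ (fst_mem_H02Sym hΩ hy).2.2.1.1
    (fst_mem_H02Sym hΩ hx).2.2.1.1]
  refine h1.trans_lt ?_
  rwa [mul_comm]

/-- The convex part of the objective of the regularized problem. -/
def regConvexPart (T : L2 Ω →L[ℝ] L2 Ω) (f : L2 Ω) (M : L2Mat Ω → ℝ) (ε : ℝ) (p : L2Mat Ω) : ℝ :=
  fidelity T f (matDiv2 p) + 1 / ε * M p

theorem continuousOn_regConvexPart (hΩ : IsOpen Ω) (hM : IsPenalty r N α₀ α₁ M) (ε : ℝ) :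
    ContinuousOn (fun x : L2MatPair Ω => regConvexPart T f M ε x.fst)
      (testLapPairs hΩ).topologicalClosure := by
  have hcd := continuousOn_divTriple_fst hΩ
  have hmaps : Set.MapsTo (fun x : L2MatPair Ω => divTriple x.fst)
      (testLapPairs hΩ).topologicalClosure (testTriples hΩ).topologicalClosure := fun x hx =>
    (mem_H0Div2_iff hΩ).1 (fst_mem_H02Sym hΩ hx).2.2.1
  have hcF : Continuous (fun y : L2Triple Ω => fidelity T f y.snd.snd) :=
    (continuous_fidelity T f).comp continuous_triple_snd_snd
  have h := (hcF.continuousOn.add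
    (continuousOn_const (c := 1 / ε) |>.mul (hM.continuousOn_fst hΩ))).comp hcd hmaps
  refine h.congr fun x _ => ?_
  rfl

theorem regConvexPart_midpoint (hΩ : IsOpen Ω) (hM : IsPenalty r N α₀ α₁ M) {ε : ℝ} (hε : 0 < ε)
    {p q : L2Mat Ω} (hp : p ∈ H0Div2 Ω) (hq : q ∈ H0Div2 Ω) :
    regConvexPart T f M ε ((1 / 2 : ℝ) • p + (1 / 2 : ℝ) • q)
      ≤ 1 / 2 * regConvexPart T f M ε p + 1 / 2 * regConvexPart T f M ε q := by
  have h1 := hM.midpoint hp hq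
  have h3 := fidelity_midpoint T f (matDiv2 p) (matDiv2 q)
  unfold regConvexPart
  rw [matDiv2_comb hΩ hp hq, h3]
  have h4 := mul_le_mul_of_nonneg_left h1 (show 0 ≤ 1 / ε by positivity)
  have h5 : 0 ≤ ‖fidelityOp T (matDiv2 p - matDiv2 q)‖ ^ 2 := by positivity
  linarith

/-- The problem is transferred to the closure of the pairs (p, Δp) of test fields. Taking first
components maps this closure onto H₀² with inverse `lapPair`, so minimizers correspond one to one.
-/
theorem existsUnique_solvesRegularized (hΩ : IsOpen Ω) (hT : IsUnit (opB T))
    (hM : IsPenalty r N α₀ α₁ M) {ε : ℝ} (hε : 0 < ε) :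
    ∃! p : L2Mat Ω, SolvesRegularized T f M ε p := by
  have hW : ∀ x ∈ (testLapPairs hΩ).topologicalClosure, x.fst ∈ H02Sym Ω ∧ lapPair x.fst = x ∧
      x.fst ∈ H0Div2 Ω := fun x hx =>
    ⟨(fst_mem_H02Sym hΩ hx).1, (fst_mem_H02Sym hΩ hx).2.1, (fst_mem_H02Sym hΩ hx).2.2.1⟩
  have hobj : ∀ p : L2Mat Ω, regObjective T f M ε p
      = ε / 2 * ‖lapPair p‖ ^ 2 + regConvexPart T f M ε p := regObjective_eq hT ε
  have hmain := existsUnique_minimizer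
    (K := ((testLapPairs hΩ).topologicalClosure : Set (L2MatPair Ω)))
    (G := fun x => regConvexPart T f M ε x.fst) (c := ε / 2)
    (Submodule.isClosed_topologicalClosure _) ⟨0, Submodule.zero_mem _⟩
    (fun x hx y hy => Submodule.add_mem _ (Submodule.smul_mem _ _ hx) (Submodule.smul_mem _ _ hy))
    (continuousOn_regConvexPart hΩ hM ε)
    (fun x hx => by
      have h1 := fidelity_nonneg T f (matDiv2 x.fst)
      have h2 := hM.nonneg _ (hW x hx).2.2
      unfold regConvexPart
      positivity)
    (fun x hx y hy => regConvexPart_midpoint hΩ hM hε (hW x hx).2.2 (hW y hy).2.2) (by positivity)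
  obtain ⟨x, ⟨hxW, hx⟩, huniq⟩ := hmain
  refine ⟨x.fst, ⟨(hW x hxW).1, fun q hq => ?_⟩, ?_⟩
  · have h1 := hx _ (lapPair_mem_closure hΩ hq)
    change regObjective T f M ε x.fst ≤ regObjective T f M ε q
    rw [hobj, hobj, (hW x hxW).2.1]
    exact h1
  · rintro q ⟨hq, hqmin⟩
    have hqW := lapPair_mem_closure hΩ hq
    have := huniq (lapPair q) ⟨hqW, fun y hy => ?_⟩
    · rw [← this]; rfl
    · have h1 : regObjective T f M ε q ≤ regObjective T f M ε y.fst := hqmin (hW y hy).1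
      rw [hobj, hobj, (hW y hy).2.1] at h1
      exact h1

end Regularized

end TGV

end

noncomputable section

namespace TGV

/-! ### Convergence of regularized solutions -/

section Convergence

variable {d : ℕ} {Ω : Set (EuclideanSpace ℝ (Fin d))} {r : ℝ≥0∞} [Fact (1 ≤ r)]
  {N : Matrix (Fin d) (Fin d) ℝ → ℝ} {α₀ α₁ : EuclideanSpace ℝ (Fin d) → ℝ}
  {T : L2 Ω →L[ℝ] L2 Ω} {f : L2 Ω} {M : L2Mat Ω → ℝ}

theorem isClosed_sublevel_of_continuousOn {X : Type*} [TopologicalSpace X] {s : Set X}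
    (hs : IsClosed s) {g : X → ℝ} (hg : ContinuousOn g s) (c : ℝ) :
    IsClosed {x | x ∈ s ∧ g x ≤ c} :=
  hg.preimage_isClosed_of_isClosed hs isClosed_Iic

/-- Weak lower semicontinuity of the fidelity along asymptotically feasible bounded families. -/
theorem IsPenalty.exists_feasible (hΩ : IsOpen Ω) (hM : IsPenalty r N α₀ α₁ M) {R c : ℝ}
    (h : ∀ η : ℝ, 0 < η → ∃ z ∈ H0Div2 Ω, hDiv2Norm z ≤ R ∧ M z ≤ η ∧
      fidelity T f (matDiv2 z) ≤ c + η) :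
    ∃ p ∈ feasibleSet Ω r N α₀ α₁, fidelity T f (matDiv2 p) ≤ c := by
  let H : Set (L2Triple Ω) := (testTriples hΩ).topologicalClosure
  let e : ℕ → ℝ := fun n => 1 / ((n : ℝ) + 1)
  have he : ∀ n, 0 < e n := fun n => by positivity
  have helim : Tendsto e atTop (𝓝 0) := tendsto_one_div_add_atTop_nhds_zero_nat
  have heanti : Antitone e := fun n m hnm => by
    have : (n : ℝ) ≤ m := by exact_mod_cast hnm
    simp only [e]; gcongr
  have hH : IsClosed H := Submodule.isClosed_topologicalClosure _
  have hHc : Convex ℝ H := Submodule.convex _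
  -- These sublevel sets, one for the penalty and one for the fidelity, are closed, convex and
  -- decreasing, and by hypothesis their intersections all meet the ball of radius `R`. A common
  -- point has zero penalty and fidelity at most `c`.
  let D1 : ℕ → Set (L2Triple Ω) := fun n => {x | x ∈ H ∧ M x.fst ≤ e n}
  let D2 : ℕ → Set (L2Triple Ω) := fun n => {x | fidelity T f x.snd.snd ≤ c + e n}
  have hF : Continuous (fun y : L2Triple Ω => fidelity T f y.snd.snd) :=
    (continuous_fidelity T f).comp continuous_triple_snd_snd
  have h1cl : ∀ n, IsClosed (D1 n) := fun n =>
    isClosed_sublevel_of_continuousOn hH (hM.continuousOn_fst hΩ) _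
  have h2cl : ∀ n, IsClosed (D2 n) := fun n => isClosed_le hF continuous_const
  have h1c : ∀ n, Convex ℝ (D1 n) := by
    rintro n x ⟨hx, hx'⟩ y ⟨hy, hy'⟩ a b ha hb hab
    refine ⟨hHc hx hy ha hb hab, ?_⟩
    have hxm := (fst_mem_H0Div2 hΩ hx).1
    have hym := (fst_mem_H0Div2 hΩ hy).1
    have h1 := hM.convex _ hxm _ hym b hb (by linarith)
    have ha' : 1 - b = a := by linarith
    rw [ha'] at h1
    change M (a • x.fst + b • y.fst) ≤ e n
    calc _ ≤ a * e n + b * e n := h1.trans (by gcongr)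
      _ = e n := by rw [← add_mul, hab, one_mul]
  have h2c : ∀ n, Convex ℝ (D2 n) := by
    intro n x hx y hy a b ha hb hab
    have h1 := (convexOn_fidelity T f).2 (Set.mem_univ x.snd.snd) (Set.mem_univ y.snd.snd) ha hb hab
    simp only [smul_eq_mul] at h1
    change fidelity T f (a • x.snd.snd + b • y.snd.snd) ≤ c + e n
    have h2 : fidelity T f x.snd.snd ≤ c + e n := hx
    have h3 : fidelity T f y.snd.snd ≤ c + e n := hy
    calc _ ≤ a * (c + e n) + b * (c + e n) := h1.trans (by gcongr)
      _ = c + e n := by rw [← add_mul, hab, one_mul]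
  obtain ⟨x, hx⟩ := exists_mem_iInter_of_antitone (D := fun n => D1 n ∩ D2 n) (R := R)
    (fun n m hnm x hx => ⟨⟨hx.1.1, hx.1.2.trans (heanti hnm)⟩,
      le_trans (show fidelity T f x.snd.snd ≤ c + e m from hx.2) (by linarith [heanti hnm])⟩)
    (fun n => (h1cl n).inter (h2cl n)) (fun n => (h1c n).inter (h2c n)) (fun n => by
      obtain ⟨z, hz, h1, h2, h3⟩ := h (e n) (he n)
      refine ⟨divTriple z, ⟨⟨(mem_H0Div2_iff hΩ).1 hz, h2⟩, h3⟩, ?_⟩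
      rwa [norm_divTriple])
  obtain ⟨hxm, hxe⟩ := fst_mem_H0Div2 hΩ (hx 0).1.1
  have hM0 : M x.fst ≤ 0 := ge_of_tendsto' helim fun n => (hx n).1.2
  refine ⟨x.fst, ⟨hxm, (hM.eq_zero_iff _ hxm).1 (le_antisymm hM0 (hM.nonneg _ hxm))⟩, ?_⟩
  rw [matDiv2_eq_snd, hxe]
  have hlim : Tendsto (fun n => c + e n) atTop (𝓝 c) := by simpa using helim.const_add c
  exact ge_of_tendsto' hlim fun n => (hx n).2

/-- If the norms were unbounded, one could choose for each k an index `s k` whose norm exceeds k,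
and coercivity would contradict the bound on `M`. The indices need not increase, since coercivity
applies to every sequence. -/
theorem IsPenalty.exists_bound (hM : IsPenalty r N α₀ α₁ M) {p : ℕ → L2Mat Ω}
    (hp : ∀ n, p n ∈ H0Div2 Ω) {C : ℝ} (hC : ∀ n, M (p n) ≤ C) :
    ∃ R, ∀ n, max ‖p n‖ ‖matDiv (p n)‖ ≤ R := by
  by_contra! hcon
  choose s hs using fun k : ℕ => hcon k
  have h1 : Tendsto (fun k => max ‖p (s k)‖ ‖matDiv (p (s k))‖) atTop atTop :=
    tendsto_atTop_mono (fun k => (hs k).le) tendsto_natCast_atTop_atTop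
  have h2 := hM.coercive (fun k => p (s k)) (fun k => hp _) h1
  obtain ⟨k, hk⟩ := (h2.eventually_gt_atTop C).exists
  linarith [hC (s k)]

theorem predualObjective_eq (hT : IsUnit (opB T)) (p : L2Mat Ω) :
    predualObjective T f p = fidelity T f (matDiv2 p) - 1 / 2 * ‖f‖ ^ 2 := by
  rw [predualObjective, bNormSq_eq hT, fidelity]

theorem hDiv2Norm_le_sum (p : L2Mat Ω) : hDiv2Norm p ≤ ‖p‖ + ‖matDiv p‖ + ‖matDiv2 p‖ := by
  refine Real.sqrt_le_iff.2 ⟨by positivity, ?_⟩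
  nlinarith [mul_nonneg (norm_nonneg p) (norm_nonneg (matDiv p)),
    mul_nonneg (norm_nonneg p) (norm_nonneg (matDiv2 p)),
    mul_nonneg (norm_nonneg (matDiv p)) (norm_nonneg (matDiv2 p))]

/-- If the smooth feasible fields are dense in the feasible set, then the regularized solutions
converge. -/
theorem tendsto_matDiv2_of_dense (hΩ : IsOpen Ω) (hT : IsUnit (opB T))
    (hM : IsPenalty r N α₀ α₁ M) (h0 : SatisfiesBounds r N α₀ α₁ (0 : L2Mat Ω))
    (hdense : ∀ q ∈ feasibleSet Ω r N α₀ α₁, ∀ δ : ℝ, 0 < δ →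
      ∃ ψ ∈ H02Sym Ω, ψ ∈ feasibleSet Ω r N α₀ α₁ ∧ ‖matDiv2 ψ - matDiv2 q‖ < δ)
    {ε : ℕ → ℝ} {p : ℕ → L2Mat Ω} (hε : ∀ n, 0 < ε n) (hε0 : Tendsto ε atTop (𝓝 0))
    (hp : ∀ n, SolvesRegularized T f M (ε n) (p n)) :
    ∃ q, SolvesPredual r N α₀ α₁ T f q ∧
      Tendsto (fun n => matDiv2 (p n)) atTop (𝓝 (matDiv2 q)) := by
  set K := feasibleSet Ω r N α₀ α₁
  set F : L2 Ω → ℝ := fidelity T f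
  have hpH : ∀ n, p n ∈ H0Div2 Ω := fun n => H02Sym_subset_H0Div2 hΩ (hp n).1
  have hKM : ∀ q ∈ K, M q = 0 := fun q hq => (hM.eq_zero_iff q hq.1).2 hq.2
  have h0test : IsTestField (0 : L2Mat Ω) := (testFields Ω).zero_mem
  have h0K : (0 : L2Mat Ω) ∈ K := ⟨h0test.mem_H0Div2 hΩ, h0⟩
  -- For a feasible competitor the penalty vanishes, so its right-hand side contains no factor 1/ε.
  have hcmp : ∀ n, ∀ ψ ∈ H02Sym Ω, ψ ∈ K →
      F (matDiv2 (p n)) + 1 / ε n * M (p n) ≤ ε n / 2 * ‖lapPair ψ‖ ^ 2 + F (matDiv2 ψ) :=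
    fun n ψ hψ hψK => by
      have h1 : regObjective T f M (ε n) (p n) ≤ regObjective T f M (ε n) ψ := (hp n).2 hψ
      rw [regObjective_eq hT, regObjective_eq hT, hKM ψ hψK, mul_zero, add_zero] at h1
      have h2 : 0 ≤ ε n / 2 * ‖lapPair (p n)‖ ^ 2 := by have := hε n; positivity
      linarith
  have hFle : ∀ n, ∀ ψ ∈ H02Sym Ω, ψ ∈ K →
      F (matDiv2 (p n)) ≤ ε n / 2 * ‖lapPair ψ‖ ^ 2 + F (matDiv2 ψ) := fun n ψ hψ hψK => by
    have h1 := hcmp n ψ hψ hψK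
    have h2 : 0 ≤ 1 / ε n * M (p n) :=
      mul_nonneg (by have := hε n; positivity) (hM.nonneg _ (hpH n))
    linarith
  -- upper bound for the fidelity
  have hup : ∀ q ∈ K, ∀ η : ℝ, 0 < η → ∀ᶠ n in atTop, F (matDiv2 (p n)) ≤ F (matDiv2 q) + η := by
    intro q hq η hη
    obtain ⟨δ, hδ, hδF⟩ := Metric.continuousAt_iff.1
      ((continuous_fidelity T f).continuousAt (x := matDiv2 q)) (η / 2) (by positivity)
    obtain ⟨ψ, hψ, hψK, hlt⟩ := hdense q hq δ hδ
    have h1 := @hδF (matDiv2 ψ) (by rwa [dist_eq_norm])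
    rw [Real.dist_eq] at h1
    have h2 : Tendsto (fun n => ε n / 2 * ‖lapPair ψ‖ ^ 2) atTop (𝓝 0) := by
      simpa using (hε0.div_const 2).mul_const (‖lapPair ψ‖ ^ 2)
    filter_upwards [h2.eventually_lt_const (show 0 < η / 2 by positivity)] with n hn
    have h3 := hFle n ψ hψ hψK
    have h4 := (abs_lt.1 h1).2
    change fidelity T f (matDiv2 ψ) - F (matDiv2 q) < _ at h4
    have h5 : F (matDiv2 ψ) - F (matDiv2 q) < η / 2 := h4
    linarith
  -- the penalty tends to zero
  have h02 : (0 : L2Mat Ω) ∈ H02Sym Ω := h0test.mem_H02Sym hΩ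
  set C0 := F (matDiv2 (0 : L2Mat Ω))
  have hlap0 : lapPair (0 : L2Mat Ω) = 0 := by
    have := h0test.lapPair_smul hΩ 0
    rwa [zero_smul, zero_smul] at this
  have hC0 : 0 ≤ C0 := fidelity_nonneg _ _ _
  have hbd0 : ∀ n, F (matDiv2 (p n)) + 1 / ε n * M (p n) ≤ C0 := fun n => by
    have := hcmp n 0 h02 h0K
    rw [hlap0] at this
    simpa using this
  -- The competitor 0 gives M(pₙ)/εₙ ≤ C0. The penalty therefore tends to zero and, since εₙ is
  -- bounded, is bounded as well, as coercivity requires.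
  have hMle : ∀ n, M (p n) ≤ ε n * C0 := fun n => by
    have h1 := hbd0 n
    have h2 : 0 ≤ F (matDiv2 (p n)) := fidelity_nonneg _ _ _
    have h3 : 1 / ε n * M (p n) ≤ C0 := by linarith
    rwa [one_div, inv_mul_le_iff₀ (hε n)] at h3
  have hMlim : Tendsto (fun n => M (p n)) atTop (𝓝 0) :=
    squeeze_zero (fun n => hM.nonneg _ (hpH n)) hMle (by simpa using hε0.mul_const C0)
  -- bounds
  obtain ⟨E, hE⟩ := hε0.bddAbove_range
  have hE' : ∀ n, ε n ≤ E := fun n => hE ⟨n, rfl⟩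
  obtain ⟨R, hR⟩ := hM.exists_bound hpH (C := E * C0) fun n =>
    (hMle n).trans (mul_le_mul_of_nonneg_right (hE' n) hC0)
  set A := ‖ContinuousLinearMap.adjoint T‖
  have hw : ∀ n, ‖matDiv2 (p n)‖ ≤ ‖ContinuousLinearMap.adjoint T f‖ + A * (1 + 2 * C0) := fun n => by
    have h1 := norm_le_fidelityOp hT (ContinuousLinearMap.adjoint T f - matDiv2 (p n))
    have h2 : F (matDiv2 (p n)) ≤ C0 := by
      have := hFle n 0 h02 h0K
      rw [hlap0] at this
      simpa using this
    have h3 : ‖fidelityOp T (ContinuousLinearMap.adjoint T f - matDiv2 (p n))‖ ^ 2 ≤ 2 * C0 := by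
      simp only [F, fidelity] at h2
      linarith
    -- The elementary a ≤ 1 + a² avoids a square root.
    have h4 : ‖fidelityOp T (ContinuousLinearMap.adjoint T f - matDiv2 (p n))‖ ≤ 1 + 2 * C0 := by
      nlinarith [sq_nonneg (‖fidelityOp T (ContinuousLinearMap.adjoint T f - matDiv2 (p n))‖ - 1)]
    have h5 : matDiv2 (p n) = ContinuousLinearMap.adjoint T f
        - (ContinuousLinearMap.adjoint T f - matDiv2 (p n)) := by abel
    rw [h5]
    refine (norm_sub_le _ _).trans ?_
    gcongr
    exact h1.trans (mul_le_mul_of_nonneg_left h4 (norm_nonneg _))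
  obtain ⟨R', hR'⟩ : ∃ R', ∀ n, hDiv2Norm (p n) ≤ R' :=
    ⟨R + R + _, fun n => (hDiv2Norm_le_sum _).trans
      (add_le_add (add_le_add ((le_max_left _ _).trans (hR n)) ((le_max_right _ _).trans (hR n)))
        (hw n))⟩
  -- the minimal value and a minimizer
  have hbdd : BddBelow ((fun q => F (matDiv2 q)) '' K) :=
    ⟨0, by rintro _ ⟨q, -, rfl⟩; exact fidelity_nonneg _ _ _⟩
  set m := sInf ((fun q => F (matDiv2 q)) '' K)
  have hm : ∀ q ∈ K, m ≤ F (matDiv2 q) := fun q hq => csInf_le hbdd ⟨q, hq, rfl⟩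
  have hupm : ∀ η : ℝ, 0 < η → ∀ᶠ n in atTop, F (matDiv2 (p n)) ≤ m + η := fun η hη => by
    obtain ⟨_, ⟨q, hq, rfl⟩, hlt⟩ := exists_lt_of_csInf_lt
      (Set.Nonempty.image (fun q => F (matDiv2 q)) ⟨0, h0K⟩) (show m < m + η / 2 by linarith)
    filter_upwards [hup q hq (η / 2) (by positivity)] with n hn
    dsimp only at hlt
    linarith
  -- The regularized solutions are themselves the bounded, asymptotically feasible family, so
  -- existence for the predual problem is a by-product.
  obtain ⟨q, hqK, hqm⟩ := hM.exists_feasible hΩ (T := T) (f := f) (R := R') (c := m) fun η hη => by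
    obtain ⟨n, h1, h2⟩ := ((hupm η hη).and (hMlim.eventually_le_const hη)).exists
    exact ⟨p n, hpH n, hR' n, h2, h1⟩
  have hqm' : F (matDiv2 q) = m := le_antisymm hqm (hm q hqK)
  refine ⟨q, ⟨hqK, fun q' hq' => ?_⟩, ?_⟩
  · change predualObjective T f q ≤ predualObjective T f q'
    rw [predualObjective_eq hT, predualObjective_eq hT]
    have := hm q' hq'
    rw [← hqm'] at this
    exact sub_le_sub_right this _
  -- midpoints
  have hmidH : ∀ n, (1 / 2 : ℝ) • p n + (1 / 2 : ℝ) • q ∈ H0Div2 Ω := fun n =>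
    (h0Div2 hΩ).add_mem ((h0Div2 hΩ).smul_mem _ (hpH n)) ((h0Div2 hΩ).smul_mem _ hqK.1)
  have hmidN : ∀ n, hDiv2Norm ((1 / 2 : ℝ) • p n + (1 / 2 : ℝ) • q) ≤ R' + hDiv2Norm q := fun n => by
    have h1 : (1 / 2 : ℝ) • p n ∈ H0Div2 Ω := (h0Div2 hΩ).smul_mem _ (hpH n)
    have h2 : (1 / 2 : ℝ) • q ∈ H0Div2 Ω := (h0Div2 hΩ).smul_mem _ hqK.1
    have h3 : ‖divTriple (p n)‖ ≤ R' := by rw [norm_divTriple]; exact hR' n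
    rw [← norm_divTriple, ← norm_divTriple, divTriple_add hΩ h1.1 h2.1,
      divTriple_smul hΩ _ (hpH n).1, divTriple_smul hΩ _ hqK.1.1]
    refine (norm_add_le _ _).trans ?_
    rw [norm_smul, norm_smul, Real.norm_of_nonneg (by norm_num : (0 : ℝ) ≤ 1 / 2)]
    linarith [norm_nonneg (divTriple (p n)), norm_nonneg (divTriple q)]
  -- Lower semicontinuity along the midpoints: their penalties tend to zero by convexity, so values
  -- below m - η infinitely often would produce a feasible field of value at most m - η.
  have hlow : ∀ η : ℝ, 0 < η → ∀ᶠ n in atTop,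
      m - η ≤ F (matDiv2 ((1 / 2 : ℝ) • p n + (1 / 2 : ℝ) • q)) := by
    intro η hη
    by_contra hcon
    rw [not_eventually] at hcon
    obtain ⟨q', hq'K, hq'm⟩ := hM.exists_feasible hΩ (T := T) (f := f) (R := R' + hDiv2Norm q)
      (c := m - η) fun κ hκ => by
        obtain ⟨n, h1, h2⟩ := (hcon.and_eventually (hMlim.eventually_le_const hκ)).exists
        refine ⟨_, hmidH n, hmidN n, ?_, ?_⟩
        · have h3 := hM.midpoint (hpH n) hqK.1
          rw [hKM q hqK] at h3
          linarith
        · have h4 := not_le.1 h1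
          simp only [F] at h4
          linarith
    linarith [hm q' hq'K]
  -- conclusion
  rw [Metric.tendsto_atTop']
  intro δ hδ
  -- The midpoint identity gives ‖·‖²/8 ≤ (m + η)/2 + m/2 - (m - η) = 3η/2, so ‖·‖² ≤ 12η, which is
  -- half of (δ/(A+1))². Using A + 1 avoids dividing by a possibly zero norm.
  set η := (δ / (A + 1)) ^ 2 / 24 with hη
  have hA : 0 ≤ A := norm_nonneg _
  have hη0 : 0 < η := by positivity
  obtain ⟨n0, hn0⟩ := eventually_atTop.1 ((hupm η hη0).and (hlow η hη0))
  refine ⟨n0, fun n hn => ?_⟩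
  obtain ⟨h1, h2⟩ := hn0 n hn.le
  rw [matDiv2_comb hΩ (hpH n) hqK.1] at h2
  have h3 := fidelity_midpoint T f (matDiv2 (p n)) (matDiv2 q)
  have h4 : ‖fidelityOp T (matDiv2 (p n) - matDiv2 q)‖ ^ 2 ≤ 12 * η := by
    simp only [F] at h1 h2 hqm'
    linarith
  have h5 : ‖fidelityOp T (matDiv2 (p n) - matDiv2 q)‖ < δ / (A + 1) := by
    refine lt_of_pow_lt_pow_left₀ 2 (by positivity) ?_
    have : 0 < (δ / (A + 1)) ^ 2 := by positivity
    linarith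
  rw [dist_eq_norm]
  have h6 := norm_le_fidelityOp hT (matDiv2 (p n) - matDiv2 q)
  calc _ ≤ A * ‖fidelityOp T (matDiv2 (p n) - matDiv2 q)‖ := h6
    _ ≤ (A + 1) * ‖fidelityOp T (matDiv2 (p n) - matDiv2 q)‖ := by gcongr; linarith
    _ < (A + 1) * (δ / (A + 1)) := by gcongr
    _ = δ := by field_simp

end Convergence

/-! ### From weak to strong approximation -/

section WeakToStrong

variable {d : ℕ} {Ω : Set (EuclideanSpace ℝ (Fin d))}

/-- Test classes are dense in `L²(Ω)`. -/
theorem exists_testClass_near (hΩ : IsOpen Ω) (u : L2 Ω) {δ : ℝ} (hδ : 0 < δ) :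
    ∃ v, IsTestClass v ∧ ‖u - v‖ < δ := by
  let S : Submodule ℝ (L2 Ω) :=
    { carrier := {u | IsTestClass u}
      add_mem' := fun hu hv => hu.add hv
      zero_mem' := IsTestClass.zero
      smul_mem' := fun c _ hu => hu.smul c }
  -- By duality, density amounts to the fact that only 0 is orthogonal to all test functions.
  have h1 : Sᗮ = ⊥ := by
    refine (Submodule.eq_bot_iff _).2 fun g hg => eq_zero_of_forall_inner hΩ fun φ hφ => ?_
    exact hg _ hφ.isTestClass
  have h2 : S.topologicalClosure = ⊤ := by
    rw [Submodule.topologicalClosure_eq_top_iff]; exact h1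
  have h3 : u ∈ closure (S : Set (L2 Ω)) := by
    change u ∈ S.topologicalClosure
    rw [h2]; trivial
  obtain ⟨v, hv, hlt⟩ := Metric.mem_closure_iff.1 h3 δ hδ
  exact ⟨v, hv, by rwa [← dist_eq_norm]⟩

/-- A bounded sequence that converges when tested with test functions converges weakly. -/
theorem tendsto_inner_of_testClass (hΩ : IsOpen Ω) {w : ℕ → L2 Ω} {w' : L2 Ω} {C : ℝ}
    (hC : ∀ n, ‖w n‖ ≤ C)
    (h : ∀ v, IsTestClass v → Tendsto (fun n => ⟪v, w n⟫_ℝ) atTop (𝓝 ⟪v, w'⟫_ℝ)) (u : L2 Ω) :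
    Tendsto (fun n => ⟪u, w n⟫_ℝ) atTop (𝓝 ⟪u, w'⟫_ℝ) := by
  rw [Metric.tendsto_atTop]
  intro δ hδ
  have hC0 : 0 ≤ C := (norm_nonneg _).trans (hC 0)
  -- Replacing u by v costs at most ‖u - v‖ (C + ‖w'‖) ≤ δ/2 uniformly in n; the extra 1 keeps the
  -- denominator positive.
  obtain ⟨v, hv, hlt⟩ := exists_testClass_near hΩ u
    (show 0 < δ / (2 * (C + ‖w'‖ + 1)) by positivity)
  obtain ⟨n0, hn0⟩ := Metric.tendsto_atTop.1 (h v hv) (δ / 2) (by positivity)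
  refine ⟨n0, fun n hn => ?_⟩
  have h1 := hn0 n hn
  rw [Real.dist_eq] at h1 ⊢
  have h2 : ⟪u, w n⟫_ℝ - ⟪u, w'⟫_ℝ = ⟪u - v, w n - w'⟫_ℝ + (⟪v, w n⟫_ℝ - ⟪v, w'⟫_ℝ) := by
    simp only [inner_sub_left, inner_sub_right]; ring
  have h3 : |⟪u - v, w n - w'⟫_ℝ| ≤ ‖u - v‖ * (C + ‖w'‖) :=
    (abs_real_inner_le_norm _ _).trans
      (mul_le_mul_of_nonneg_left ((norm_sub_le _ _).trans (by linarith [hC n])) (norm_nonneg _))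
  have h4 : ‖u - v‖ * (C + ‖w'‖) ≤ δ / 2 := by
    rw [lt_div_iff₀ (by positivity)] at hlt
    nlinarith [norm_nonneg (u - v), norm_nonneg w']
  rw [h2]
  exact (abs_add_le _ _).trans_lt (by linarith)

/-- Weak limits of sequences in a convex set lie in its closure. -/
theorem exists_near_of_weak {X : Type*} [NormedAddCommGroup X] [InnerProductSpace ℝ X]
    [CompleteSpace X] {S : Set X} (hS : Convex ℝ S) {w : ℕ → X} (hw : ∀ n, w n ∈ S) {w' : X}
    (h : ∀ u, Tendsto (fun n => ⟪u, w n⟫_ℝ) atTop (𝓝 ⟪u, w'⟫_ℝ)) {δ : ℝ} (hδ : 0 < δ) :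
    ∃ v ∈ S, ‖v - w'‖ < δ := by
  have hne : (closure S).Nonempty := ⟨w 0, subset_closure (hw 0)⟩
  obtain ⟨z, hz, hmin⟩ := exists_norm_eq_iInf_of_complete_convex hne isClosed_closure.isComplete
    hS.closure w'
  rw [norm_eq_iInf_iff_real_inner_le_zero hS.closure hz] at hmin
  -- Here z is the projection of w' onto the closure. Its variational inequality ⟨w' - z, wₙ - z⟩ ≤
  -- 0 passes to the weak limit.
  have h1 : ⟪w' - z, w' - z⟫_ℝ ≤ 0 := by
    rw [inner_sub_right]
    refine le_of_tendsto' ((h (w' - z)).sub_const _) fun n => ?_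
    rw [← inner_sub_right]
    exact hmin _ (subset_closure (hw n))
  have h2 : w' - z = 0 := by
    rw [real_inner_self_eq_norm_sq] at h1
    exact norm_eq_zero.1 (pow_eq_zero_iff two_ne_zero |>.1 (le_antisymm h1 (by positivity)))
  rw [sub_eq_zero] at h2
  subst h2
  obtain ⟨v, hv, hlt⟩ := Metric.mem_closure_iff.1 hz δ hδ
  exact ⟨v, hv, by rwa [← dist_eq_norm, dist_comm]⟩

end WeakToStrong

end TGV

end

noncomputable section

namespace TGV

/-! ### A smooth inward field -/

section Geometry

variable {d : ℕ} {Ω : Set (EuclideanSpace ℝ (Fin d))}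

/-- Near a boundary point of a Lipschitz domain there is a cone of inward directions. -/
theorem HasLipschitzBoundary.exists_cone (h : HasLipschitzBoundary Ω)
    {x : EuclideanSpace ℝ (Fin d)} (hx : x ∈ frontier Ω) :
    ∃ (ρ : ℝ) (e : EuclideanSpace ℝ (Fin d)) (c : ℝ), 0 < ρ ∧ ‖e‖ = 1 ∧ 0 < c ∧
      ∀ y ∈ Ω, y ∈ Metric.ball x ρ → ∀ s : ℝ, 0 ≤ s → ∀ w : EuclideanSpace ℝ (Fin d), ‖w‖ ≤ c →
        y - s • (e - w) ∈ Metric.ball x ρ → y - s • (e - w) ∈ Ω := by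
  obtain ⟨ρ, hρ, e, he, K, γ, hγ, hch⟩ := h x hx
  -- The aperture is chosen so that (K + 1)‖w‖ ≤ 1, with K the Lipschitz constant of the chart.
  refine ⟨ρ, e, 1 / ((K : ℝ) + 1), hρ, he, by positivity, fun y hy hyb s hs w hw hz => ?_⟩
  rw [hch _ hz]
  have h1 := (hch y hyb).1 hy
  set P := (Submodule.span ℝ {e})ᗮ.orthogonalProjectionOnto
  have hPe : P e = 0 := Submodule.orthogonalProjectionOnto_orthogonalComplement_singleton_eq_zero e
  have h2 : P (y - s • (e - w)) = P y + s • P w := by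
    rw [map_sub, map_smul, map_sub, hPe]; module
  have h3 : ‖P w‖ ≤ ‖w‖ := Submodule.norm_orthogonalProjectionOnto_apply_le _ _
  have h4 := hγ.dist_le_mul (P y) (P (y - s • (e - w)))
  rw [Real.dist_eq, dist_eq_norm, h2, sub_add_cancel_left, norm_neg, norm_smul,
    Real.norm_of_nonneg hs] at h4
  have h5 : ⟪e, y - s • (e - w)⟫_ℝ = ⟪e, y⟫_ℝ - s * (1 - ⟪e, w⟫_ℝ) := by
    rw [inner_sub_right, real_inner_smul_right, inner_sub_right, real_inner_self_eq_norm_sq, he]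
    ring
  have h6 : ⟪e, w⟫_ℝ ≤ ‖w‖ := by
    have := real_inner_le_norm e w
    rwa [he, one_mul] at this
  have h7 : (K + 1) * ‖w‖ ≤ 1 := by
    rw [le_div_iff₀ (by positivity)] at hw
    linarith
  have h8 : γ (P y) - γ (P y + s • P w) ≤ K * (s * ‖w‖) :=
    (le_abs_self _).trans (h4.trans (by gcongr))
  rw [h2, h5]
  -- The height drops by at least s(1 - ‖w‖) while the graph drops by at most K s‖w‖; the choice of
  -- aperture makes the former at least the latter, so the strict inequality persists.
  nlinarith [mul_le_mul_of_nonneg_left h6 hs, mul_le_mul_of_nonneg_left h7 hs]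

/-- The bumps vanish outside the ball of radius ρ/2, which leaves room ρ/2 for the moves inside the
chart. -/
theorem exists_bump (x : EuclideanSpace ℝ (Fin d)) {ρ : ℝ} (hρ : 0 < ρ) :
    ∃ χ : EuclideanSpace ℝ (Fin d) → ℝ, IsTestFunction Set.univ χ ∧ (∀ y, 0 ≤ χ y) ∧
      (∀ y, χ y ≤ 1) ∧ (∀ y ∈ Metric.ball x (ρ / 4), χ y = 1) ∧
      ∀ y, χ y ≠ 0 → y ∈ Metric.ball x (ρ / 2) := by
  let χ : ContDiffBump x := ⟨ρ / 4, ρ / 2, by positivity, by linarith⟩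
  refine ⟨χ, ⟨χ.contDiff, χ.hasCompactSupport, Set.subset_univ _⟩, fun y => χ.nonneg,
    fun y => χ.le_one, fun y hy => χ.one_of_mem_closedBall (Metric.ball_subset_closedBall hy),
    fun y hy => ?_⟩
  have : y ∈ Function.support χ := hy
  rwa [χ.support_eq] at this

theorem exists_pos_le_of_finset {α : Type*} (s : Finset α) {g : α → ℝ} (h : ∀ x ∈ s, 0 < g x) :
    ∃ c : ℝ, 0 < c ∧ ∀ x ∈ s, c ≤ g x := by
  classical
  induction s using Finset.induction_on with
  | empty => exact ⟨1, one_pos, by simp⟩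
  | insert a s ha ih =>
    obtain ⟨c, hc, hcs⟩ := ih fun x hx => h x (Finset.mem_insert_of_mem hx)
    refine ⟨min c (g a), lt_min hc (h a (Finset.mem_insert_self _ _)), fun x hx => ?_⟩
    rcases Finset.mem_insert.1 hx with rfl | hx
    · exact min_le_right _ _
    · exact (min_le_left _ _).trans (hcs x hx)

/-- The vector field with components `b i`. -/
def field (b : Fin d → EuclideanSpace ℝ (Fin d) → ℝ) (y : EuclideanSpace ℝ (Fin d)) :
    EuclideanSpace ℝ (Fin d) :=
  WithLp.toLp 2 fun i => b i y

/-- On a bounded Lipschitz domain there is a smooth field that points inward, uniformly up to the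
boundary. -/
theorem exists_inward_field (hΩ : IsOpen Ω) (hbdd : Bornology.IsBounded Ω)
    (hlip : HasLipschitzBoundary Ω) :
    ∃ b : Fin d → EuclideanSpace ℝ (Fin d) → ℝ, (∀ i, IsTestFunction Set.univ (b i)) ∧
      ∃ c t₀ : ℝ, 0 < c ∧ 0 < t₀ ∧ ∀ t, 0 < t → t ≤ t₀ → ∀ y ∈ Ω,
        ∀ w : EuclideanSpace ℝ (Fin d), ‖w‖ ≤ c → y + t • (field b y + w) ∈ Ω := by
  choose! ρ e c hρ he hc hcone using fun x hx => hlip.exists_cone (x := x) hx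
  choose! χ hχt hχ0 hχ1 hχone hχsupp using
    fun x (hx : x ∈ frontier Ω) => exists_bump x (hρ x hx)
  have hcl : IsCompact (closure Ω) := hbdd.isCompact_closure
  have hfr : IsCompact (frontier Ω) := hcl.of_isClosed_subset isClosed_frontier
    frontier_subset_closure
  obtain ⟨s, hsf, hcov⟩ := hfr.elim_nhds_subcover (fun x => Metric.ball x (ρ x / 4))
    fun x hx => Metric.ball_mem_nhds x (by have := hρ x hx; positivity)
  set U := ⋃ x ∈ s, Metric.ball x (ρ x / 4)
  have hU : IsOpen U := isOpen_biUnion fun x _ => Metric.isOpen_ball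
  -- What the charts leave uncovered is a compact subset of Ω, so it keeps a positive distance δ
  -- from the complement.
  obtain ⟨δ, hδ, hthick⟩ := (hcl.diff hU).exists_thickening_subset_open hΩ (fun y hy => by
    by_contra hyΩ
    refine hy.2 (hcov ⟨hy.1, ?_⟩)
    rwa [hΩ.interior_eq])
  obtain ⟨c₀, hc₀, hc₀s⟩ := exists_pos_le_of_finset s fun x hx => hc x (hsf x hx)
  obtain ⟨ρ₀, hρ₀, hρ₀s⟩ := exists_pos_le_of_finset s fun x hx => hρ x (hsf x hx)
  set n : ℝ := (s.card : ℝ)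
  have hn : 0 ≤ n := by positivity
  -- The bound on t ensures 2nt < ρ₀/2 and (n + 1)t < δ: 2nt bounds every partial move in the
  -- charts, and (n + 1)t bounds the whole move away from the boundary.
  refine ⟨fun i y => ∑ x ∈ s, (-(e x i)) * χ x y,
    fun i => IsTestFunction.sum _ fun x hx => (hχt x (hsf x hx)).const_mul _,
    min c₀ 1, min ρ₀ δ / (4 * (n + 1)), lt_min hc₀ one_pos, by positivity, ?_⟩
  intro t ht ht0 y hy w hw
  have hwc : ‖w‖ ≤ c₀ := hw.trans (min_le_left _ _)
  have hw1 : ‖w‖ ≤ 1 := hw.trans (min_le_right _ _)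
  rw [le_div_iff₀ (by positivity)] at ht0
  have htρ : t * (2 * n) < ρ₀ / 2 := by
    have := ht0.trans (min_le_left _ _)
    linarith
  have htδ : t * (n + 1) < δ := by
    have := ht0.trans (min_le_right _ _)
    nlinarith
  have hfield : field (fun i y => ∑ x ∈ s, (-(e x i)) * χ x y) y = - ∑ x ∈ s, χ x y • e x := by
    ext i
    simp [field, Finset.sum_apply, mul_comm]
  rw [hfield]
  by_cases hyU : y ∈ U
  · -- near the boundary, move successively along the directions of the charts
    obtain ⟨x0, hx0s, hyx0⟩ : ∃ x ∈ s, y ∈ Metric.ball x (ρ x / 4) := by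
      simpa [U] using hyU
    -- The perturbation w is shared among the charts in proportion to their bumps. One bump equals 1
    -- at y, so σ ≥ 1, and w' = w/σ is no longer than w and stays within every cone.
    set σ := ∑ x ∈ s, χ x y
    have hσ : 1 ≤ σ := by
      rw [← hχone x0 (hsf x0 hx0s) y hyx0]
      exact Finset.single_le_sum (f := fun x => χ x y) (fun x hx => hχ0 x (hsf x hx) y) hx0s
    set w' := σ⁻¹ • w
    have hw' : ‖w'‖ ≤ ‖w‖ := by
      rw [norm_smul, norm_inv, Real.norm_of_nonneg (by linarith)]
      exact mul_le_of_le_one_left (norm_nonneg _) (inv_le_one_of_one_le₀ hσ)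
    have hrew : y + t • (-∑ x ∈ s, χ x y • e x + w)
        = y - t • ∑ x ∈ s, χ x y • (e x - w') := by
      have h1 : ∑ x ∈ s, χ x y • w' = w := by
        rw [← Finset.sum_smul, smul_smul, mul_inv_cancel₀ (by linarith), one_smul]
      simp only [smul_sub, Finset.sum_sub_distrib, h1]
      module
    rw [hrew]
    have hstep : ∀ s' ⊆ s, ‖t • ∑ x ∈ s', χ x y • (e x - w')‖ < ρ₀ / 2 := by
      intro s' hs'
      refine lt_of_le_of_lt ?_ htρ
      rw [norm_smul, Real.norm_of_nonneg ht.le]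
      gcongr
      calc ‖∑ x ∈ s', χ x y • (e x - w')‖ ≤ ∑ x ∈ s', (2 : ℝ) := by
            refine (norm_sum_le _ _).trans (Finset.sum_le_sum fun x hx => ?_)
            have hxf := hsf x (hs' hx)
            rw [norm_smul, Real.norm_of_nonneg (hχ0 x hxf y)]
            have h1 : ‖e x - w'‖ ≤ 2 := by
              have := norm_sub_le (e x) w'
              rw [he x hxf] at this
              linarith
            nlinarith [hχ0 x hxf y, hχ1 x hxf y, norm_nonneg (e x - w')]
        _ ≤ 2 * n := by
            rw [Finset.sum_const, nsmul_eq_mul, mul_comm]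
            have : (s'.card : ℝ) ≤ n := Nat.cast_le.2 (Finset.card_le_card hs')
            linarith
    have hind : ∀ s' ⊆ s, y - t • ∑ x ∈ s', χ x y • (e x - w') ∈ Ω := by
      classical
      intro s'
      induction s' using Finset.induction_on with
      | empty => intro _; simpa using hy
      | insert x s' hx ih =>
        intro hs'
        have hs'' : s' ⊆ s := (Finset.subset_insert _ _).trans hs'
        have hxs : x ∈ s := hs' (Finset.mem_insert_self _ _)
        have hxf := hsf x hxs
        have hprev := ih hs''
        have hsum : y - t • ∑ x ∈ insert x s', χ x y • (e x - w')
            = (y - t • ∑ x ∈ s', χ x y • (e x - w')) - (t * χ x y) • (e x - w') := by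
          rw [Finset.sum_insert hx]; module
        by_cases h0 : χ x y = 0
        · rw [hsum, h0, mul_zero, zero_smul, sub_zero]; exact hprev
        -- An active bump puts y in the half-size ball of its chart, and partial moves are shorter
        -- than ρ₀/2. Both ends of the new step thus lie in the chart, where the cone condition
        -- applies.
        · have hyb := hχsupp x hxf y h0
          have hball : ∀ s'' ⊆ s, y - t • ∑ x ∈ s'', χ x y • (e x - w') ∈ Metric.ball x (ρ x) := by
            intro s'' hs2
            have h1 := hstep s'' hs2
            have h2 := hρ₀s x hxs
            rw [Metric.mem_ball, dist_eq_norm] at hyb ⊢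
            have h3 : y - t • ∑ x ∈ s'', χ x y • (e x - w') - x
                = (y - x) - t • ∑ x ∈ s'', χ x y • (e x - w') := by abel
            rw [h3]
            exact (norm_sub_le _ _).trans_lt (by linarith)
          have h4 := hball _ hs'
          rw [hsum] at h4 ⊢
          exact hcone x hxf _ hprev (hball s' hs'') _ (mul_nonneg ht.le (hχ0 x hxf y)) w'
            (hw'.trans (hwc.trans (hc₀s x hxs))) h4
    exact hind s subset_rfl
  · -- away from the boundary every short move is admissible
    refine hthick (Metric.mem_thickening_iff.2 ⟨y, ⟨subset_closure hy, hyU⟩, ?_⟩)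
    rw [dist_eq_norm, add_sub_cancel_left, norm_smul, Real.norm_of_nonneg ht.le]
    refine lt_of_le_of_lt ?_ htδ
    gcongr
    refine (norm_add_le _ _).trans (add_le_add ?_ hw1)
    rw [norm_neg]
    calc ‖∑ x ∈ s, χ x y • e x‖ ≤ ∑ x ∈ s, (1 : ℝ) := by
          refine (norm_sum_le _ _).trans (Finset.sum_le_sum fun x hx => ?_)
          have hxf := hsf x hx
          rw [norm_smul, Real.norm_of_nonneg (hχ0 x hxf y), he x hxf, mul_one]
          exact hχ1 x hxf y
      _ = n := by simp [n]

end Geometry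

end TGV

end

noncomputable section

namespace TGV

/-! ### Integral operators `g ↦ ∫ k(x - Φ(y)) g(y) dy` -/

section Smear

variable {d : ℕ} {Ω : Set (EuclideanSpace ℝ (Fin d))}
  {k : EuclideanSpace ℝ (Fin d) → ℝ} {Φ : EuclideanSpace ℝ (Fin d) → EuclideanSpace ℝ (Fin d)}
  {g φ : EuclideanSpace ℝ (Fin d) → ℝ}

/-- `x ↦ ∫_Ω k(x - Φ(y)) g(y) dy`. -/
def smear (k : EuclideanSpace ℝ (Fin d) → ℝ)
    (Φ : EuclideanSpace ℝ (Fin d) → EuclideanSpace ℝ (Fin d)) (Ω : Set (EuclideanSpace ℝ (Fin d)))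
    (g : EuclideanSpace ℝ (Fin d) → ℝ) (x : EuclideanSpace ℝ (Fin d)) : ℝ :=
  ∫ y in Ω, k (x - Φ y) * g y

theorem IsTestFunction.exists_bound {U : Set (EuclideanSpace ℝ (Fin d))}
    (hk : IsTestFunction U k) : ∃ C, ∀ x, ‖k x‖ ≤ C :=
  hk.2.1.exists_bound_of_continuous hk.1.continuous

theorem integrable_kernel_mul (hk : IsTestFunction Set.univ k) (hΦ : Continuous Φ)
    (hg : Integrable g (volume.restrict Ω)) (x : EuclideanSpace ℝ (Fin d)) :
    Integrable (fun y => k (x - Φ y) * g y) (volume.restrict Ω) := by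
  obtain ⟨C, hC⟩ := hk.exists_bound
  refine hg.bdd_mul (c := C) ?_ (.of_forall fun y => hC _)
  exact (hk.1.continuous.comp (continuous_const.sub hΦ)).aestronglyMeasurable

theorem integrable_prod_kernel [IsFiniteMeasure (volume.restrict Ω)]
    (hk : IsTestFunction Set.univ k) (hΦ : Continuous Φ)
    (hφ : Integrable φ (volume.restrict Ω)) (hg : Integrable g (volume.restrict Ω)) :
    Integrable (fun z : EuclideanSpace ℝ (Fin d) × EuclideanSpace ℝ (Fin d) =>
      k (z.1 - Φ z.2) * (φ z.1 * g z.2)) ((volume.restrict Ω).prod (volume.restrict Ω)) := by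
  obtain ⟨C, hC⟩ := hk.exists_bound
  refine (hφ.mul_prod hg).bdd_mul (c := C) ?_ (.of_forall fun y => hC _)
  exact (hk.1.continuous.comp
    (continuous_fst.sub (hΦ.comp continuous_snd))).aestronglyMeasurable

theorem integral_mul_smear [IsFiniteMeasure (volume.restrict Ω)]
    (hk : IsTestFunction Set.univ k) (hΦ : Continuous Φ)
    (hφ : Integrable φ (volume.restrict Ω)) (hg : Integrable g (volume.restrict Ω)) :
    ∫ x in Ω, φ x * smear k Φ Ω g x = ∫ y in Ω, g y * ∫ x in Ω, k (x - Φ y) * φ x := by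
  have h := integral_integral_swap (f := fun x y => k (x - Φ y) * (φ x * g y))
    (integrable_prod_kernel hk hΦ hφ hg)
  calc ∫ x in Ω, φ x * smear k Φ Ω g x
      = ∫ x in Ω, ∫ y in Ω, k (x - Φ y) * (φ x * g y) := by
        refine integral_congr_ae (.of_forall fun x => ?_)
        dsimp only [smear]
        rw [← integral_const_mul]
        exact integral_congr_ae (.of_forall fun y => by dsimp only; ring)
    _ = ∫ y in Ω, ∫ x in Ω, k (x - Φ y) * (φ x * g y) := h
    _ = _ := by
        refine integral_congr_ae (.of_forall fun y => ?_)
        dsimp only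
        rw [← integral_const_mul]
        exact integral_congr_ae (.of_forall fun x => by dsimp only; ring)

/-- The integral is a convolution with parameter p, of the kernel z ↦ k(p - Φ(-z)) with the
extension of g by zero, evaluated at 0. The bound on Φ - id confines the supports in z to one
compact set for p near x₀, as smoothness in the parameter requires. -/
theorem contDiff_smear (hk : IsTestFunction Set.univ k) (hΦ : ContDiff ℝ ∞ Φ) {D : ℝ}
    (hD : ∀ y, ‖Φ y - y‖ ≤ D) (hΩ : MeasurableSet Ω) (hg : Integrable g (volume.restrict Ω)) :
    ContDiff ℝ ∞ (smear k Φ Ω g) := by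
  obtain ⟨R, hR⟩ := hk.2.1.isCompact.isBounded.exists_norm_le
  rw [contDiff_iff_contDiffAt]
  intro x₀
  have hf : LocallyIntegrable (Ω.indicator g) volume :=
    ((integrable_indicator_iff hΩ).2 hg).locallyIntegrable
  have hsm : ContDiff ℝ ∞ (fun q : EuclideanSpace ℝ (Fin d) × EuclideanSpace ℝ (Fin d) =>
      k (q.1 - Φ (-q.2))) := hk.1.comp (contDiff_fst.sub (hΦ.comp contDiff_snd.neg))
  have h := contDiffOn_convolution_right_with_param (𝕜 := ℝ) (n := ⊤) (μ := volume)
    (ContinuousLinearMap.mul ℝ ℝ)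
    (f := Ω.indicator g) (g := fun p z => k (p - Φ (-z))) (s := Metric.ball x₀ 1)
    (k := Metric.closedBall 0 (‖x₀‖ + 1 + R + D)) Metric.isOpen_ball
    (isCompact_closedBall _ _) (by
      intro p z hp hz
      by_contra hne
      refine hz ?_
      have h1 := hR _ (subset_tsupport _ hne)
      have h2 := hD (-z)
      have h3 : ‖p‖ ≤ ‖x₀‖ + 1 := by
        have := norm_le_norm_add_norm_sub' p x₀
        rw [Metric.mem_ball, dist_eq_norm] at hp
        linarith
      rw [mem_closedBall_zero_iff]
      have h4 : z = (p - Φ (-z)) + (Φ (-z) - (-z)) - p := by abel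
      rw [h4]
      refine (norm_sub_le _ _).trans ?_
      have := norm_add_le (p - Φ (-z)) (Φ (-z) - (-z))
      linarith) hf hsm.contDiffOn
  have h2 : ContDiffOn ℝ ∞ (fun p : EuclideanSpace ℝ (Fin d) => smear k Φ Ω g p)
      (Metric.ball x₀ 1) := by
    have h3 := h.comp (f := fun p : EuclideanSpace ℝ (Fin d) => (p, (0 : EuclideanSpace ℝ (Fin d))))
      (s := Metric.ball x₀ 1) (contDiff_id.prodMk contDiff_const).contDiffOn
      (fun p hp => ⟨hp, Set.mem_univ _⟩)
    refine h3.congr fun p _ => ?_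
    simp only [Function.comp, convolution, ContinuousLinearMap.mul_apply', zero_sub, neg_neg, smear]
    rw [← integral_indicator hΩ]
    refine integral_congr_ae (.of_forall fun y => ?_)
    by_cases hy : y ∈ Ω
    · simp [hy, mul_comm]
    · simp [hy]
  exact h2.contDiffAt (Metric.ball_mem_nhds x₀ one_pos)

/-- `smear` produces test functions if `Φ` moves `Ω` far enough inside. -/
theorem isTestFunction_smear (hk : IsTestFunction Set.univ k) (hΦ : ContDiff ℝ ∞ Φ) {D δ : ℝ}
    (hD : ∀ y, ‖Φ y - y‖ ≤ D) (hΩ : IsOpen Ω) (hbdd : Bornology.IsBounded Ω) (hδ : 0 < δ)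
    (hkδ : ∀ x, k x ≠ 0 → ‖x‖ ≤ δ) (hin : ∀ y ∈ Ω, ∀ z, ‖z‖ ≤ 2 * δ → Φ y + z ∈ Ω)
    (hg : Integrable g (volume.restrict Ω)) : IsTestFunction Ω (smear k Φ Ω g) := by
  have hsub : tsupport (smear k Φ Ω g) ⊆ Ω := by
    intro x hx
    -- One δ is spent on passing from the closed support to a point of nonzero value, the other on
    -- the radius of the kernel; this is the 2δ in `hin`.
    obtain ⟨x', hx', hlt⟩ := Metric.mem_closure_iff.1 hx δ hδ
    have : ∃ y ∈ Ω, k (x' - Φ y) ≠ 0 := by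
      by_contra! hcon
      refine hx' ?_
      rw [smear, setIntegral_congr_fun (g := fun _ => 0) hΩ.measurableSet (fun y hy => by
        dsimp only; rw [hcon y hy, zero_mul])]
      simp
    obtain ⟨y, hy, hky⟩ := this
    have h1 := hkδ _ hky
    have h2 := hin y hy ((x' - Φ y) + (x - x')) (by
      rw [dist_eq_norm] at hlt
      linarith [norm_add_le (x' - Φ y) (x - x')])
    have h3 : Φ y + (x' - Φ y + (x - x')) = x := by abel
    rwa [h3] at h2
  exact ⟨contDiff_smear hk hΦ hD hΩ.measurableSet hg,
    (hbdd.subset hsub).isCompact_closure.of_isClosed_subset (isClosed_tsupport _)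
      subset_closure, hsub⟩

theorem isTestFunction_translate (hk : IsTestFunction Set.univ k) (z : EuclideanSpace ℝ (Fin d)) :
    IsTestFunction Set.univ (fun x => k (x - z)) :=
  ⟨hk.1.comp (contDiff_id.sub contDiff_const),
    hk.2.1.comp_homeomorph (Homeomorph.subRight z), Set.subset_univ _⟩

theorem partialDeriv_translate (i : Fin d) (z x : EuclideanSpace ℝ (Fin d)) :
    partialDeriv i (fun x => k (x - z)) x = partialDeriv i k (x - z) := by
  unfold partialDeriv
  rw [fderiv_comp_sub]

/-- By Fubini this reduces, for each fixed y, to integrating the translated kernel by parts against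
φ; no differentiation under the integral sign is needed. -/
theorem isWeakPartial_smear [IsFiniteMeasure (volume.restrict Ω)] (i : Fin d)
    (hk : IsTestFunction Set.univ k) (hΦ : Continuous Φ) (hg : Integrable g (volume.restrict Ω))
    (hS : IsTestFunction Ω (smear k Φ Ω g))
    (hS' : IsTestFunction Ω (smear (partialDeriv i k) Φ Ω g)) :
    IsWeakPartial i (toL2 Ω (smear k Φ Ω g)) (toL2 Ω (smear (partialDeriv i k) Φ Ω g)) := by
  rw [isWeakPartial_iff]
  intro φ hφ
  rw [(hφ.partialDeriv i).inner_toL2_toL2 hS, hφ.inner_toL2_toL2 hS',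
    integral_mul_smear hk hΦ (hφ.partialDeriv i).integrable.integrableOn hg,
    integral_mul_smear (hk.partialDeriv i) hΦ hφ.integrable.integrableOn hg, ← integral_neg]
  refine integral_congr_ae (.of_forall fun y => ?_)
  dsimp only
  rw [← mul_neg]
  congr 1
  have h := integral_partialDeriv_mul i (isTestFunction_translate hk (Φ y)) hφ
  simp only [partialDeriv_translate] at h
  linarith

/-- `L²` bound for integral operators. -/
theorem integral_sq_smear_le [IsFiniteMeasure (volume.restrict Ω)]
    (hk : IsTestFunction Set.univ k) (hΦ : Continuous Φ) {A : ℝ} (hA : 0 < A)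
    (h1 : ∀ x, ∫ y in Ω, |k (x - Φ y)| ≤ A) (h2 : ∀ y, ∫ x in Ω, |k (x - Φ y)| ≤ A)
    (hS : IsTestFunction Ω (smear k Φ Ω g)) (hg : MemLp g 2 (volume.restrict Ω)) :
    ∫ x in Ω, smear k Φ Ω g x ^ 2 ≤ A ^ 2 * ∫ y in Ω, g y ^ 2 := by
  set u := smear k Φ Ω g
  have hu2 : Integrable (fun x => u x ^ 2) (volume.restrict Ω) := (hS.memLp Ω 2).integrable_sq
  have hg2 : Integrable (fun x => g x ^ 2) (volume.restrict Ω) := hg.integrable_sq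
  have hg1 : Integrable g (volume.restrict Ω) := hg.integrable (by norm_num)
  have hone : Integrable (fun _ : EuclideanSpace ℝ (Fin d) => (1 : ℝ)) (volume.restrict Ω) :=
    integrable_const _
  have hI := integrable_prod_kernel hk hΦ hS.integrable.integrableOn hg1
  have hI1 := (integrable_prod_kernel hk hΦ hu2 hone).abs
  have hI2 := (integrable_prod_kernel hk hΦ hone hg2).abs
  have e1 : ∀ z : EuclideanSpace ℝ (Fin d) × EuclideanSpace ℝ (Fin d),
      |k (z.1 - Φ z.2) * (u z.1 ^ 2 * 1)| = u z.1 ^ 2 * |k (z.1 - Φ z.2)| := fun z => by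
    rw [abs_mul, mul_one, abs_of_nonneg (sq_nonneg (u z.1)), mul_comm]
  have e2 : ∀ z : EuclideanSpace ℝ (Fin d) × EuclideanSpace ℝ (Fin d),
      |k (z.1 - Φ z.2) * (1 * g z.2 ^ 2)| = g z.2 ^ 2 * |k (z.1 - Φ z.2)| := fun z => by
    rw [abs_mul, one_mul, abs_of_nonneg (sq_nonneg (g z.2)), mul_comm]
  simp only [e1] at hI1
  simp only [e2] at hI2
  have f1 : ∫ z, u z.1 ^ 2 * |k (z.1 - Φ z.2)| ∂((volume.restrict Ω).prod (volume.restrict Ω))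
      ≤ A * ∫ x in Ω, u x ^ 2 := by
    rw [integral_prod _ hI1, ← integral_const_mul]
    refine integral_mono hI1.integral_prod_left (hu2.const_mul A) fun x => ?_
    dsimp only
    rw [integral_const_mul, mul_comm]
    exact mul_le_mul_of_nonneg_right (h1 x) (sq_nonneg _)
  have f2 : ∫ z, g z.2 ^ 2 * |k (z.1 - Φ z.2)| ∂((volume.restrict Ω).prod (volume.restrict Ω))
      ≤ A * ∫ x in Ω, g x ^ 2 := by
    rw [integral_prod_symm _ hI2, ← integral_const_mul]
    refine integral_mono hI2.integral_prod_right (hg2.const_mul A) fun y => ?_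
    dsimp only
    rw [integral_const_mul, mul_comm]
    exact mul_le_mul_of_nonneg_right (h2 y) (sq_nonneg _)
  have f3 : ∫ x in Ω, u x ^ 2 = ∫ z, k (z.1 - Φ z.2) * (u z.1 * g z.2)
      ∂((volume.restrict Ω).prod (volume.restrict Ω)) := by
    rw [integral_prod _ hI]
    refine integral_congr_ae (.of_forall fun x => ?_)
    dsimp only
    rw [pow_two]
    nth_rewrite 2 [show u x = ∫ y in Ω, k (x - Φ y) * g y from rfl]
    rw [← integral_const_mul]
    exact integral_congr_ae (.of_forall fun y => by dsimp only; ring)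
  -- Schur test: Young's inequality with weights 1/(2A) and A/2 makes the u-part exactly half of the
  -- left side, where it is absorbed.
  have f4 : ∫ x in Ω, u x ^ 2 ≤ 1 / (2 * A) * (A * ∫ x in Ω, u x ^ 2)
      + A / 2 * (A * ∫ x in Ω, g x ^ 2) := by
    refine le_trans ?_ (add_le_add (mul_le_mul_of_nonneg_left f1 (by positivity))
      (mul_le_mul_of_nonneg_left f2 (by positivity)))
    rw [f3, ← integral_const_mul, ← integral_const_mul,
      ← integral_add (hI1.const_mul _) (hI2.const_mul _)]
    refine integral_mono hI ((hI1.const_mul _).add (hI2.const_mul _)) fun z => ?_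
    dsimp only
    have g1 : u z.1 * g z.2 ≤ 1 / (2 * A) * u z.1 ^ 2 + A / 2 * g z.2 ^ 2 := by
      have h := sq_nonneg (u z.1 - A * g z.2)
      have : 1 / (2 * A) * u z.1 ^ 2 + A / 2 * g z.2 ^ 2 - u z.1 * g z.2
          = 1 / (2 * A) * (u z.1 - A * g z.2) ^ 2 := by field_simp; ring
      nlinarith [mul_nonneg (show 0 ≤ 1 / (2 * A) by positivity) h]
    have g2 : -(u z.1 * g z.2) ≤ 1 / (2 * A) * u z.1 ^ 2 + A / 2 * g z.2 ^ 2 := by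
      have h := sq_nonneg (u z.1 + A * g z.2)
      have : 1 / (2 * A) * u z.1 ^ 2 + A / 2 * g z.2 ^ 2 + u z.1 * g z.2
          = 1 / (2 * A) * (u z.1 + A * g z.2) ^ 2 := by field_simp; ring
      nlinarith [mul_nonneg (show 0 ≤ 1 / (2 * A) by positivity) h]
    calc k (z.1 - Φ z.2) * (u z.1 * g z.2) ≤ |k (z.1 - Φ z.2)| * |u z.1 * g z.2| := by
          rw [← abs_mul]; exact le_abs_self _
      _ ≤ |k (z.1 - Φ z.2)| * (1 / (2 * A) * u z.1 ^ 2 + A / 2 * g z.2 ^ 2) := by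
          gcongr
          exact abs_le'.2 ⟨g1, g2⟩
      _ = _ := by ring
  have f5 : 1 / (2 * A) * (A * ∫ x in Ω, u x ^ 2) = 1 / 2 * ∫ x in Ω, u x ^ 2 := by
    field_simp
  rw [f5] at f4
  linarith

/-- `smear` with an approximate unit is close to the identity in the weak sense. -/
theorem abs_integral_mul_smear_sub_le [IsFiniteMeasure (volume.restrict Ω)]
    (hΩ : IsOpen Ω) (hk : IsTestFunction Set.univ k) (hΦ : Continuous Φ) {D δ : ℝ}
    (hD : ∀ y, ‖Φ y - y‖ ≤ D) (hk0 : ∀ x, 0 ≤ k x) (hk1 : ∫ x, k x = 1)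
    (hkδ : ∀ x, k x ≠ 0 → ‖x‖ ≤ δ) (hφ : IsTestFunction Ω φ) {L : ℝ≥0}
    (hL : LipschitzWith L φ) (hg : Integrable g (volume.restrict Ω)) :
    |(∫ x in Ω, φ x * smear k Φ Ω g x) - ∫ x in Ω, φ x * g x|
      ≤ L * (δ + D) * ∫ x in Ω, |g x| := by
  rw [integral_mul_smear hk hΦ hφ.integrable.integrableOn hg]
  have hint1 : Integrable (fun y => g y * ∫ x in Ω, k (x - Φ y) * φ x) (volume.restrict Ω) := by
    have h := (integrable_prod_kernel hk hΦ hφ.integrable.integrableOn hg).integral_prod_right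
    refine h.congr (.of_forall fun y => ?_)
    dsimp only
    rw [← integral_const_mul]
    exact integral_congr_ae (.of_forall fun x => by dsimp only; ring)
  have hint2 : Integrable (fun x => φ x * g x) (volume.restrict Ω) := by
    obtain ⟨C, hC⟩ := hφ.exists_bound
    exact hg.bdd_mul (c := C) hφ.1.continuous.aestronglyMeasurable (.of_forall hC)
  rw [← integral_sub hint1 hint2, ← integral_const_mul, ← Real.norm_eq_abs]
  refine norm_integral_le_of_norm_le (hg.abs.const_mul _) ?_
  refine (ae_restrict_iff' hΩ.measurableSet).2 (.of_forall fun y hy => ?_)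
  have hkt := isTestFunction_translate hk (Φ y)
  have e1 : ∫ x in Ω, k (x - Φ y) * φ x = ∫ x, k (x - Φ y) * φ x :=
    setIntegral_eq_integral_of_forall_compl_eq_zero fun x hx => by
      rw [image_eq_zero_of_notMem_tsupport (fun h => hx (hφ.2.2 h)), mul_zero]
  have e2 : ∫ x, k (x - Φ y) = 1 := by rw [integral_sub_right_eq_self k (Φ y), hk1]
  have e3 : (∫ x, k (x - Φ y) * φ x) - φ y = ∫ x, k (x - Φ y) * (φ x - φ y) := by
    have i1 : Integrable fun x => k (x - Φ y) * φ x := (hφ.mul_left hkt.1).integrable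
    have i2 : Integrable fun x => k (x - Φ y) * φ y := hkt.integrable.mul_const _
    simp only [mul_sub]
    rw [integral_sub i1 i2, integral_mul_const, e2, one_mul]
  -- The kernel only sees points x with ‖x - y‖ ≤ δ + D, across which φ varies by at most L(δ + D).
  have e4 : ‖∫ x, k (x - Φ y) * (φ x - φ y)‖ ≤ ∫ x, k (x - Φ y) * (L * (δ + D)) := by
    refine norm_integral_le_of_norm_le (hkt.integrable.mul_const _) (.of_forall fun x => ?_)
    rw [norm_mul, Real.norm_of_nonneg (hk0 _)]
    by_cases hx : k (x - Φ y) = 0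
    · rw [hx, zero_mul, zero_mul]
    · gcongr
      · exact hk0 _
      have h1 := hL.norm_sub_le x y
      refine h1.trans ?_
      gcongr
      have h2 : x - y = (x - Φ y) + (Φ y - y) := by abel
      rw [h2]
      exact (norm_add_le _ _).trans (add_le_add (hkδ _ hx) (hD y))
  rw [integral_mul_const, e2, one_mul] at e4
  have e5 : g y * ∫ x in Ω, k (x - Φ y) * φ x = g y * ∫ x, k (x - Φ y) * φ x := by rw [e1]
  rw [e5, mul_comm (φ y), ← mul_sub, e3, norm_mul, mul_comm, Real.norm_eq_abs (g y)]
  gcongr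

end Smear

/-! ### Changes of variables with antilipschitz maps -/

section Mass

variable {d : ℕ}

/-- Lebesgue measure is a multiple of d-dimensional Hausdorff measure, for which the estimate is the
antilipschitz bound; no Jacobian determinant enters. -/
theorem volume_preimage_le {K : ℝ≥0}
    {Φ : EuclideanSpace ℝ (Fin d) → EuclideanSpace ℝ (Fin d)} (h : AntilipschitzWith K Φ)
    (s : Set (EuclideanSpace ℝ (Fin d))) :
    volume (Φ ⁻¹' s) ≤ (K : ℝ≥0∞) ^ d * volume s := by
  have hv := Measure.isAddLeftInvariant_eq_smul
    (volume : Measure (EuclideanSpace ℝ (Fin d))) (Measure.hausdorffMeasure d)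
  have h1 := h.hausdorffMeasure_preimage_le (d := d) (by positivity) s
  rw [hv, Measure.smul_apply, Measure.smul_apply, ENNReal.smul_def, ENNReal.smul_def, smul_eq_mul,
    smul_eq_mul, mul_left_comm]
  rw [ENNReal.rpow_natCast] at h1
  gcongr

/-- The push-forward of Lebesgue measure under Φ is at most K^d times Lebesgue measure, and the
latter is invariant under z ↦ x - z. -/
theorem integral_comp_le {K : ℝ≥0} {Ω : Set (EuclideanSpace ℝ (Fin d))}
    {Φ : EuclideanSpace ℝ (Fin d) → EuclideanSpace ℝ (Fin d)} (h : AntilipschitzWith K Φ)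
    (hΦ : Continuous Φ) {k : EuclideanSpace ℝ (Fin d) → ℝ} (hk : IsTestFunction Set.univ k)
    (x : EuclideanSpace ℝ (Fin d)) :
    ∫ y in Ω, |k (x - Φ y)| ≤ (K : ℝ) ^ d * ∫ z, |k z| := by
  have hmeas : Measurable fun z => ENNReal.ofReal |k (x - z)| :=
    ((hk.1.continuous.comp (continuous_const.sub continuous_id)).abs.measurable).ennreal_ofReal
  have hmap : Measure.map Φ volume ≤ ((K : ℝ≥0∞) ^ d) • (volume : Measure (EuclideanSpace ℝ (Fin d))) := by
    refine Measure.le_iff.2 fun s hs => ?_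
    rw [Measure.map_apply hΦ.measurable hs, Measure.smul_apply, smul_eq_mul]
    exact volume_preimage_le h s
  have h1 : ∫⁻ y in Ω, ENNReal.ofReal |k (x - Φ y)|
      ≤ (K : ℝ≥0∞) ^ d * ∫⁻ z, ENNReal.ofReal |k z| := by
    calc ∫⁻ y in Ω, ENNReal.ofReal |k (x - Φ y)|
        ≤ ∫⁻ y, ENNReal.ofReal |k (x - Φ y)| := setLIntegral_le_lintegral _ _
      _ = ∫⁻ z, ENNReal.ofReal |k (x - z)| ∂(Measure.map Φ volume) :=
          (lintegral_map hmeas hΦ.measurable).symm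
      _ ≤ ∫⁻ z, ENNReal.ofReal |k (x - z)| ∂((K : ℝ≥0∞) ^ d • volume) :=
          lintegral_mono' hmap le_rfl
      _ = (K : ℝ≥0∞) ^ d * ∫⁻ z, ENNReal.ofReal |k (x - z)| := by
          rw [lintegral_smul_measure, smul_eq_mul]
      _ = _ := by rw [lintegral_sub_left_eq_self fun z => ENNReal.ofReal |k z|]
  have hk1 : Integrable (fun z => |k z|) := hk.integrable.abs
  have h2 : ∫⁻ z, ENNReal.ofReal |k z| = ENNReal.ofReal (∫ z, |k z|) :=
    (ofReal_integral_eq_lintegral_ofReal hk1 (.of_forall fun _ => abs_nonneg _)).symm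
  have hcont : Continuous fun y => |k (x - Φ y)| :=
    (hk.1.continuous.comp (continuous_const.sub hΦ)).abs
  rw [integral_eq_lintegral_of_nonneg_ae (.of_forall fun _ => abs_nonneg _)
    hcont.aestronglyMeasurable]
  refine ENNReal.toReal_le_of_le_ofReal (by positivity) (h1.trans (le_of_eq ?_))
  rw [h2, ENNReal.ofReal_mul (by positivity), ENNReal.ofReal_pow (by positivity),
    ENNReal.ofReal_coe_nnreal]

end Mass

end TGV

end

noncomputable section

namespace TGV

/-! ### Divergences tested up to the boundary -/

section GlobalDiv

variable {d : ℕ} {Ω : Set (EuclideanSpace ℝ (Fin d))}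

/-- `div h = w` when tested with all of `C_c^∞(ℝ^d)`, that is, with vanishing normal trace. -/
def IsGlobalDiv (Ω : Set (EuclideanSpace ℝ (Fin d)))
    (h : Fin d → EuclideanSpace ℝ (Fin d) → ℝ) (w : EuclideanSpace ℝ (Fin d) → ℝ) : Prop :=
  ∀ φ, IsTestFunction Set.univ φ →
    ∑ b, ∫ x in Ω, partialDeriv b φ x * h b x = - ∫ x in Ω, φ x * w x

theorem IsTestClass.inner_partialDeriv (hΩ : IsOpen Ω) {u : L2 Ω} (hu : IsTestClass u) (k : Fin d)
    {φ : EuclideanSpace ℝ (Fin d) → ℝ} (hφ : IsTestFunction Set.univ φ) :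
    ⟪toL2 Ω (partialDeriv k φ), u⟫_ℝ = - ⟪toL2 Ω φ, weakPartial k u⟫_ℝ := by
  obtain ⟨ψ, hψ, rfl⟩ := hu.exists_eq
  rw [(hψ.isWeakPartial k).weakPartial_eq hΩ, (hφ.partialDeriv k).inner_toL2_toL2 hψ,
    hφ.inner_toL2_toL2 (hψ.partialDeriv k), integral_partialDeriv_mul k hφ hψ]

theorem isGlobalDiv_of_inner {q : Fin d → L2 Ω} {w : L2 Ω}
    (h : ∀ φ, IsTestFunction Set.univ φ →
      ∑ k, ⟪toL2 Ω (partialDeriv k φ), q k⟫_ℝ = - ⟪toL2 Ω φ, w⟫_ℝ) :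
    IsGlobalDiv Ω (fun b => q b) w := fun φ hφ => by
  have := h φ hφ
  rw [hφ.inner_toL2] at this
  simpa only [(hφ.partialDeriv _).inner_toL2] using this

/-- True for test fields and closed in the graph norm, hence true on the closure. It encodes the
vanishing of the normal traces without any trace operator. -/
theorem H0Div2_isGlobalDiv (hΩ : IsOpen Ω) {p : L2Mat Ω} (hp : p ∈ H0Div2 Ω) :
    (∀ i, IsGlobalDiv Ω (fun j => p (i, j)) (matDiv p i)) ∧
      IsGlobalDiv Ω (fun i => matDiv p i) (matDiv2 p) := by
  have hcl : IsClosed {x : L2Triple Ω | ∀ φ, IsTestFunction Set.univ φ →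
      (∀ i, ∑ j, ⟪toL2 Ω (partialDeriv j φ), x.fst (i, j)⟫_ℝ
        = - ⟪toL2 Ω φ, x.snd.fst i⟫_ℝ) ∧
      ∑ i, ⟪toL2 Ω (partialDeriv i φ), x.snd.fst i⟫_ℝ = - ⟪toL2 Ω φ, x.snd.snd⟫_ℝ} := by
    have c1 : ∀ ij, Continuous fun x : L2Triple Ω => x.fst ij := fun ij =>
      (PiLp.continuous_apply 2 _ ij).comp continuous_triple_fst
    have c2 : ∀ i, Continuous fun x : L2Triple Ω => x.snd.fst i := fun i =>
      (PiLp.continuous_apply 2 _ i).comp continuous_triple_snd_fst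
    have c3 : Continuous fun x : L2Triple Ω => x.snd.snd := continuous_triple_snd_snd
    simp only [Set.ofPred_forall, Set.ofPred_and]
    refine isClosed_iInter fun φ => isClosed_iInter fun hφ => IsClosed.inter
      (isClosed_iInter fun i => isClosed_eq ?_ ?_) (isClosed_eq ?_ ?_)
    · exact continuous_finsetSum _ fun j _ => continuous_const.inner (c1 (i, j))
    · exact (continuous_const.inner (c2 i)).neg
    · exact continuous_finsetSum _ fun j _ => continuous_const.inner (c2 j)
    · exact (continuous_const.inner c3).neg
  have hmem := closure_minimal (s := (testTriples hΩ : Set (L2Triple Ω))) ?_ hcl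
    ((mem_H0Div2_iff hΩ).1 hp)
  · exact ⟨fun i => isGlobalDiv_of_inner fun φ hφ => (hmem φ hφ).1 i,
      isGlobalDiv_of_inner fun φ hφ => (hmem φ hφ).2⟩
  · rintro _ ⟨ψ, hψ, rfl⟩ φ hφ
    refine ⟨fun i => ?_, ?_⟩
    · change ∑ j, ⟪toL2 Ω (partialDeriv j φ), ψ (i, j)⟫_ℝ = - ⟪toL2 Ω φ, matDiv ψ i⟫_ℝ
      rw [hψ.matDiv_apply hΩ, inner_sum, ← Finset.sum_neg_distrib]
      exact Finset.sum_congr rfl fun j _ => (hψ.2 (i, j)).inner_partialDeriv hΩ j hφ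
    · change ∑ i, ⟪toL2 Ω (partialDeriv i φ), matDiv ψ i⟫_ℝ = - ⟪toL2 Ω φ, matDiv2 ψ⟫_ℝ
      rw [hψ.matDiv2_eq hΩ, inner_sum, ← Finset.sum_neg_distrib]
      exact Finset.sum_congr rfl fun j _ => (hψ.isTestClass_matDiv hΩ j).inner_partialDeriv hΩ j hφ

theorem memLp_continuous_mul (hbdd : Bornology.IsBounded Ω) (hΩ : IsOpen Ω)
    {a g : EuclideanSpace ℝ (Fin d) → ℝ} (ha : Continuous a)
    (hg : MemLp g 2 (volume.restrict Ω)) :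
    MemLp (fun x => a x * g x) 2 (volume.restrict Ω) := by
  obtain ⟨C, hC⟩ := hbdd.isCompact_closure.exists_bound_of_continuousOn ha.continuousOn
  refine hg.of_le_mul (c := C) (ha.aestronglyMeasurable.mul hg.1) ?_
  refine (ae_restrict_iff' hΩ.measurableSet).2 (.of_forall fun x hx => ?_)
  rw [norm_mul]
  exact mul_le_mul_of_nonneg_right (hC x (subset_closure hx)) (norm_nonneg _)

theorem memLp_sum {μ : Measure (EuclideanSpace ℝ (Fin d))} {ι : Type*} (s : Finset ι)
    {g : ι → EuclideanSpace ℝ (Fin d) → ℝ} (hg : ∀ i ∈ s, MemLp (g i) 2 μ) :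
    MemLp (fun x => ∑ i ∈ s, g i x) 2 μ :=
  memLp_finsetSum s hg

theorem IsTestFunction.integrable_mul_of_memLp {U : Set (EuclideanSpace ℝ (Fin d))}
    {φ g : EuclideanSpace ℝ (Fin d) → ℝ} (hφ : IsTestFunction U φ)
    (hg : MemLp g 2 (volume.restrict Ω)) :
    Integrable (fun x => φ x * g x) (volume.restrict Ω) :=
  (hφ.memLp Ω 2).integrable_mul hg

/-- The product rule, obtained by testing with φ a in place of φ. -/
theorem IsGlobalDiv.smooth_mul (hbdd : Bornology.IsBounded Ω) (hΩ : IsOpen Ω)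
    {h : Fin d → EuclideanSpace ℝ (Fin d) → ℝ} {w a : EuclideanSpace ℝ (Fin d) → ℝ}
    (hd : IsGlobalDiv Ω h w) (hh : ∀ b, MemLp (h b) 2 (volume.restrict Ω))
    (hw : MemLp w 2 (volume.restrict Ω)) (ha : ContDiff ℝ ∞ a) :
    IsGlobalDiv Ω (fun b x => a x * h b x)
      (fun x => a x * w x + ∑ b, partialDeriv b a x * h b x) := by
  intro φ hφ
  have haφ : IsTestFunction Set.univ (fun x => φ x * a x) := by
    have := hφ.mul_left ha
    simpa only [mul_comm] using this
  have h1 := hd _ haφ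
  have hda : ∀ b, ContDiff ℝ ∞ (partialDeriv b a) := fun b => contDiff_partialDeriv b ha
  have i1 : ∀ b, Integrable (fun x => partialDeriv b φ x * (a x * h b x)) (volume.restrict Ω) :=
    fun b => (hφ.partialDeriv b).integrable_mul_of_memLp
      (memLp_continuous_mul hbdd hΩ ha.continuous (hh b))
  have i2 : ∀ b, Integrable (fun x => φ x * (partialDeriv b a x * h b x)) (volume.restrict Ω) :=
    fun b => hφ.integrable_mul_of_memLp (memLp_continuous_mul hbdd hΩ (hda b).continuous (hh b))
  have i3 : Integrable (fun x => φ x * (a x * w x)) (volume.restrict Ω) :=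
    hφ.integrable_mul_of_memLp (memLp_continuous_mul hbdd hΩ ha.continuous hw)
  have e1 : ∀ b, ∫ x in Ω, partialDeriv b (fun x => φ x * a x) x * h b x
      = (∫ x in Ω, partialDeriv b φ x * (a x * h b x))
        + ∫ x in Ω, φ x * (partialDeriv b a x * h b x) := fun b => by
    rw [← integral_add (i1 b) (i2 b)]
    refine integral_congr_ae (.of_forall fun x => ?_)
    dsimp only
    rw [partialDeriv_mul b hφ.1 ha]
    ring
  have e2 : ∫ x in Ω, φ x * (a x * w x + ∑ b, partialDeriv b a x * h b x)
      = (∫ x in Ω, φ x * (a x * w x)) + ∑ b, ∫ x in Ω, φ x * (partialDeriv b a x * h b x) := by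
    rw [← integral_finsetSum _ fun b _ => i2 b, ← integral_add i3 (integrable_finsetSum _ fun b _ => i2 b)]
    refine integral_congr_ae (.of_forall fun x => ?_)
    dsimp only
    rw [mul_add, Finset.mul_sum]
  have e3 : ∫ x in Ω, φ x * a x * w x = ∫ x in Ω, φ x * (a x * w x) :=
    integral_congr_ae (.of_forall fun x => by dsimp only; ring)
  rw [e3] at h1
  simp only [e1, Finset.sum_add_distrib] at h1
  rw [e2]
  linarith

theorem IsGlobalDiv.sum {ι : Type*} (s : Finset ι)
    {h : ι → Fin d → EuclideanSpace ℝ (Fin d) → ℝ} {w : ι → EuclideanSpace ℝ (Fin d) → ℝ}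
    (hd : ∀ a ∈ s, IsGlobalDiv Ω (h a) (w a))
    (hh : ∀ a b, MemLp (h a b) 2 (volume.restrict Ω)) (hw : ∀ a, MemLp (w a) 2 (volume.restrict Ω)) :
    IsGlobalDiv Ω (fun b x => ∑ a ∈ s, h a b x) (fun x => ∑ a ∈ s, w a x) := by
  intro φ hφ
  have e1 : ∀ b, ∫ x in Ω, partialDeriv b φ x * ∑ a ∈ s, h a b x
      = ∑ a ∈ s, ∫ x in Ω, partialDeriv b φ x * h a b x := fun b => by
    rw [← integral_finsetSum _ fun a _ => (hφ.partialDeriv b).integrable_mul_of_memLp (hh a b)]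
    simp only [Finset.mul_sum]
  have e2 : ∫ x in Ω, φ x * ∑ a ∈ s, w a x = ∑ a ∈ s, ∫ x in Ω, φ x * w a x := by
    rw [← integral_finsetSum _ fun a _ => hφ.integrable_mul_of_memLp (hw a)]
    simp only [Finset.mul_sum]
  simp only [e1, e2]
  rw [Finset.sum_comm, ← Finset.sum_neg_distrib]
  exact Finset.sum_congr rfl fun a ha => hd a ha φ hφ

end GlobalDiv

/-! ### Pushing a field forward along a small deformation -/

section Transport

variable {d : ℕ} {Ω : Set (EuclideanSpace ℝ (Fin d))} {k : EuclideanSpace ℝ (Fin d) → ℝ}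
  {b : Fin d → EuclideanSpace ℝ (Fin d) → ℝ} {t : ℝ}

/-- The deformation `y ↦ y + t b(y)`. -/
def deform (t : ℝ) (b : Fin d → EuclideanSpace ℝ (Fin d) → ℝ) (y : EuclideanSpace ℝ (Fin d)) :
    EuclideanSpace ℝ (Fin d) := y + t • field b y

/-- The Jacobian matrix of the deformation. -/
def jac (t : ℝ) (b : Fin d → EuclideanSpace ℝ (Fin d) → ℝ) (i a : Fin d)
    (y : EuclideanSpace ℝ (Fin d)) : ℝ := (if i = a then 1 else 0) + t * partialDeriv a (b i) y

theorem contDiff_field (hb : ∀ i, IsTestFunction Set.univ (b i)) : ContDiff ℝ ∞ (field b) :=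
  contDiff_euclidean.2 fun i => (hb i).1

theorem contDiff_deform (hb : ∀ i, IsTestFunction Set.univ (b i)) : ContDiff ℝ ∞ (deform t b) :=
  contDiff_id.add ((contDiff_field hb).const_smul t)

theorem contDiff_jac (hb : ∀ i, IsTestFunction Set.univ (b i)) (i a : Fin d) :
    ContDiff ℝ ∞ (jac t b i a) :=
  contDiff_const.add (contDiff_const.mul (contDiff_partialDeriv a (hb i).1))

theorem partialDeriv_jac (hb : ∀ i, IsTestFunction Set.univ (b i)) (i a c : Fin d)
    (y : EuclideanSpace ℝ (Fin d)) :
    partialDeriv c (jac t b i a) y = t * partialDeriv c (partialDeriv a (b i)) y := by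
  have h : DifferentiableAt ℝ (partialDeriv a (b i)) y :=
    ((contDiff_partialDeriv a (hb i).1).differentiable (by simp)) y
  change fderiv ℝ (fun y => (if i = a then (1 : ℝ) else 0) + t * partialDeriv a (b i) y) y _ = _
  rw [fderiv_const_add, fderiv_const_mul h]
  rfl

theorem partialDeriv_kernel (hk : IsTestFunction Set.univ k)
    (hb : ∀ i, IsTestFunction Set.univ (b i)) (a : Fin d) (x y : EuclideanSpace ℝ (Fin d)) :
    partialDeriv a (fun y => k (x - deform t b y)) y
      = - ∑ i, partialDeriv i k (x - deform t b y) * jac t b i a y := by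
  have hfield : DifferentiableAt ℝ (field b) y := ((contDiff_field hb).differentiable (by simp)) y
  have hfd : ∀ v i, (fderiv ℝ (field b) y v) i = fderiv ℝ (b i) y v := fun v i => by
    have h1 := (EuclideanSpace.proj (𝕜 := ℝ) i).hasFDerivAt.comp y hfield.hasFDerivAt
    have h2 : HasFDerivAt (b i) _ y := h1
    rw [h2.fderiv]
    rfl
  have hdef : HasFDerivAt (deform t b) (ContinuousLinearMap.id ℝ _ + t • fderiv ℝ (field b) y) y :=
    (hasFDerivAt_id y).add (hfield.hasFDerivAt.const_smul t)
  have hkd : HasFDerivAt k (fderiv ℝ k (x - deform t b y)) (x - deform t b y) :=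
    ((hk.1.differentiable (by simp)) _).hasFDerivAt
  have h := hkd.comp y (hdef.const_sub x)
  have hv : EuclideanSpace.single a (1 : ℝ) + t • fderiv ℝ (field b) y (EuclideanSpace.single a 1)
      = ∑ i, jac t b i a y • EuclideanSpace.single i (1 : ℝ) := by
    ext j
    simp only [PiLp.add_apply, PiLp.smul_apply, hfd, WithLp.ofLp_sum, Finset.sum_apply, jac,
      partialDeriv, smul_eq_mul]
    simp
  change fderiv ℝ (k ∘ fun y => x - deform t b y) y (EuclideanSpace.single a 1) = _
  rw [h.fderiv]
  change fderiv ℝ k (x - deform t b y) (-(EuclideanSpace.single a (1 : ℝ)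
    + t • fderiv ℝ (field b) y (EuclideanSpace.single a 1))) = _
  rw [hv, map_neg, map_sum]
  simp only [map_smul, smul_eq_mul, partialDeriv]
  congr 1
  exact Finset.sum_congr rfl fun i _ => mul_comm _ _

theorem exists_norm_field_le (hb : ∀ i, IsTestFunction Set.univ (b i)) :
    ∃ C : ℝ, 0 ≤ C ∧ ∀ y, ‖field b y‖ ≤ C := by
  choose C hC using fun i => (hb i).exists_bound
  refine ⟨∑ i, |C i|, by positivity, fun y => ?_⟩
  exact (norm_piLp_le_sum _).trans (Finset.sum_le_sum fun i _ => (hC i y).trans (le_abs_self _))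

/-- As a function of y the kernel need not vanish near ∂Ω; it is admissible only for divergences
tested on the whole space, which is why `IsGlobalDiv` is needed. -/
theorem isTestFunction_kernel (hk : IsTestFunction Set.univ k)
    (hb : ∀ i, IsTestFunction Set.univ (b i)) (x : EuclideanSpace ℝ (Fin d)) :
    IsTestFunction Set.univ (fun y => k (x - deform t b y)) := by
  refine ⟨hk.1.comp (contDiff_const.sub (contDiff_deform hb)), ?_, Set.subset_univ _⟩
  obtain ⟨R, hR⟩ := hk.2.1.isCompact.isBounded.exists_norm_le
  obtain ⟨C, hC0, hC⟩ := exists_norm_field_le hb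
  refine HasCompactSupport.intro (isCompact_closedBall (0 : EuclideanSpace ℝ (Fin d))
    (‖x‖ + R + |t| * C)) fun y hy => ?_
  by_contra hne
  refine hy ?_
  have h1 := hR _ (subset_tsupport _ hne)
  have h2 : ‖t • field b y‖ ≤ |t| * C := by
    rw [norm_smul, Real.norm_eq_abs]; gcongr; exact hC y
  rw [mem_closedBall_zero_iff]
  have h3 : y = x - (x - deform t b y) - t • field b y := by unfold deform; abel
  rw [h3]
  have h4 := norm_sub_le (x - (x - deform t b y)) (t • field b y)
  have h5 := norm_sub_le x (x - deform t b y)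
  linarith

/-- The Piola identity for `smear`. -/
theorem sum_smear_jac [IsFiniteMeasure (volume.restrict Ω)]
    (hbdd : Bornology.IsBounded Ω) (hΩ : IsOpen Ω)
    (hk : IsTestFunction Set.univ k) (hb : ∀ i, IsTestFunction Set.univ (b i))
    {h : Fin d → EuclideanSpace ℝ (Fin d) → ℝ} {w : EuclideanSpace ℝ (Fin d) → ℝ}
    (hd : IsGlobalDiv Ω h w) (hh : ∀ b, MemLp (h b) 2 (volume.restrict Ω))
    (x : EuclideanSpace ℝ (Fin d)) :
    ∑ i, smear (partialDeriv i k) (deform t b) Ω (fun y => ∑ a, jac t b i a y * h a y) x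
      = smear k (deform t b) Ω w x := by
  have hΦ : Continuous (deform t b) := (contDiff_deform hb).continuous
  -- Test the divergence with y ↦ k(x - Φ(y)); the chain rule produces the Jacobian.
  have h1 := hd _ (isTestFunction_kernel (t := t) hk hb x)
  simp only [partialDeriv_kernel hk hb] at h1
  have hm : ∀ i a, MemLp (fun y => jac t b i a y * h a y) 2 (volume.restrict Ω) := fun i a =>
    memLp_continuous_mul hbdd hΩ (contDiff_jac hb i a).continuous (hh a)
  have hi : ∀ i a, Integrable (fun y => partialDeriv i k (x - deform t b y)
      * (jac t b i a y * h a y)) (volume.restrict Ω) := fun i a =>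
    integrable_kernel_mul (hk.partialDeriv i) hΦ ((hm i a).integrable (by norm_num)) x
  have e1 : ∀ a, ∫ y in Ω, (-∑ i, partialDeriv i k (x - deform t b y) * jac t b i a y) * h a y
      = - ∑ i, ∫ y in Ω, partialDeriv i k (x - deform t b y) * (jac t b i a y * h a y) := fun a => by
    rw [← integral_finsetSum _ fun i _ => hi i a, ← integral_neg]
    refine integral_congr_ae (.of_forall fun y => ?_)
    dsimp only
    rw [neg_mul, Finset.sum_mul]
    simp only [mul_assoc]
  simp only [e1, Finset.sum_neg_distrib, neg_inj] at h1
  rw [smear, ← h1, Finset.sum_comm]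
  refine Finset.sum_congr rfl fun i _ => ?_
  rw [smear, ← integral_finsetSum _ fun a _ => hi i a]
  simp only [Finset.mul_sum]

theorem smear_add_mul [IsFiniteMeasure (volume.restrict Ω)]
    {Φ : EuclideanSpace ℝ (Fin d) → EuclideanSpace ℝ (Fin d)}
    (hk : IsTestFunction Set.univ k) (hΦ : Continuous Φ) (c : ℝ)
    {f g : EuclideanSpace ℝ (Fin d) → ℝ} (hf : MemLp f 2 (volume.restrict Ω))
    (hg : MemLp g 2 (volume.restrict Ω)) (x : EuclideanSpace ℝ (Fin d)) :
    smear k Φ Ω (fun y => f y + c * g y) x = smear k Φ Ω f x + c * smear k Φ Ω g x := by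
  have i1 := integrable_kernel_mul hk hΦ (hf.integrable (by norm_num)) x
  have i2 := integrable_kernel_mul hk hΦ (hg.integrable (by norm_num)) x
  rw [smear, smear, smear, ← integral_const_mul, ← integral_add i1 (i2.const_mul c)]
  exact integral_congr_ae (.of_forall fun y => by dsimp only; ring)

/-! The field `x ↦ ∫ k(x - Φ(y)) DΦ(y) p(y) DΦ(y)ᵀ dy` and its divergences. -/

/-- The integrand `DΦ p DΦᵀ`. -/
def pushMat (t : ℝ) (b : Fin d → EuclideanSpace ℝ (Fin d) → ℝ) (p : L2Mat Ω) (i j : Fin d)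
    (y : EuclideanSpace ℝ (Fin d)) : ℝ :=
  ∑ c, jac t b j c y * ∑ a, jac t b i a y * p (a, c) y

/-- The second order term `∑ ∂_c ∂_a b_i p_{ac}`. -/
def pushRest (b : Fin d → EuclideanSpace ℝ (Fin d) → ℝ) (p : L2Mat Ω) (i : Fin d)
    (y : EuclideanSpace ℝ (Fin d)) : ℝ :=
  ∑ a, ∑ c, partialDeriv c (partialDeriv a (b i)) y * p (a, c) y

/-- The integrand `DΦ div p + D²Φ : p`. -/
def pushVec (t : ℝ) (b : Fin d → EuclideanSpace ℝ (Fin d) → ℝ) (p : L2Mat Ω) (i : Fin d)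
    (y : EuclideanSpace ℝ (Fin d)) : ℝ :=
  (∑ a, jac t b i a y * matDiv p a y) + t * pushRest b p i y

theorem memLp_pushMat (hbdd : Bornology.IsBounded Ω) (hΩ : IsOpen Ω)
    (hb : ∀ i, IsTestFunction Set.univ (b i)) (p : L2Mat Ω) (i j : Fin d) :
    MemLp (pushMat t b p i j) 2 (volume.restrict Ω) :=
  memLp_sum _ fun c _ => memLp_continuous_mul hbdd hΩ (contDiff_jac hb j c).continuous
    (memLp_sum _ fun a _ => memLp_continuous_mul hbdd hΩ (contDiff_jac hb i a).continuous
      (Lp.memLp _))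

theorem memLp_pushRest (hbdd : Bornology.IsBounded Ω) (hΩ : IsOpen Ω)
    (hb : ∀ i, IsTestFunction Set.univ (b i)) (p : L2Mat Ω) (i : Fin d) :
    MemLp (pushRest b p i) 2 (volume.restrict Ω) :=
  memLp_sum _ fun a _ => memLp_sum _ fun c _ => memLp_continuous_mul hbdd hΩ
    (contDiff_partialDeriv c (contDiff_partialDeriv a (hb i).1)).continuous (Lp.memLp _)

theorem memLp_pushVec (hbdd : Bornology.IsBounded Ω) (hΩ : IsOpen Ω)
    (hb : ∀ i, IsTestFunction Set.univ (b i)) (p : L2Mat Ω) (i : Fin d) :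
    MemLp (pushVec t b p i) 2 (volume.restrict Ω) :=
  (memLp_sum _ fun a _ => memLp_continuous_mul hbdd hΩ (contDiff_jac hb i a).continuous
    (Lp.memLp _)).add ((memLp_pushRest hbdd hΩ hb p i).const_mul t)

theorem pushMat_symm {p : L2Mat Ω} (hp : IsSymmField p) (i j : Fin d) :
    pushMat t b p i j = pushMat t b p j i := by
  ext y
  simp only [pushMat, Finset.mul_sum]
  rw [Finset.sum_comm]
  refine Finset.sum_congr rfl fun a _ => Finset.sum_congr rfl fun c _ => ?_
  rw [hp a c]
  ring

/-- The second divergence of the field with integrand `pushMat`. -/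
def pushDiv2 (k : EuclideanSpace ℝ (Fin d) → ℝ) (t : ℝ)
    (b : Fin d → EuclideanSpace ℝ (Fin d) → ℝ) (p : L2Mat Ω) (x : EuclideanSpace ℝ (Fin d)) : ℝ :=
  smear k (deform t b) Ω (matDiv2 p) x
    + t * ∑ i, smear (partialDeriv i k) (deform t b) Ω (pushRest b p i) x

/-- The field with integrand `pushMat`. -/
def pushField (k : EuclideanSpace ℝ (Fin d) → ℝ) (t : ℝ)
    (b : Fin d → EuclideanSpace ℝ (Fin d) → ℝ) (p : L2Mat Ω) : L2Mat Ω :=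
  WithLp.toLp 2 fun ij => toL2 Ω (smear k (deform t b) Ω (pushMat t b p ij.1 ij.2))

theorem toL2_sum {ι : Type*} (s : Finset ι) {g : ι → EuclideanSpace ℝ (Fin d) → ℝ}
    (hg : ∀ i ∈ s, MemLp (g i) 2 (volume.restrict Ω)) :
    toL2 Ω (fun x => ∑ i ∈ s, g i x) = ∑ i ∈ s, toL2 Ω (g i) := by
  classical
  induction s using Finset.induction_on with
  | empty =>
    simp only [Finset.sum_empty]
    exact (toL2_eq (MemLp.zero' ) (Lp.coeFn_zero ℝ 2 _)).symm
  | insert a s ha ih =>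
    simp only [Finset.sum_insert ha]
    have h1 := hg a (Finset.mem_insert_self _ _)
    have h2 := fun i hi => hg i (Finset.mem_insert_of_mem (s := s) (a := i) (b := a) hi)
    rw [toL2_add h1 (memLp_sum s h2), ih h2]

theorem partialDeriv_ne_zero_subset {δ : ℝ} (hkδ : tsupport k ⊆ Metric.closedBall 0 δ) (i : Fin d)
    (x : EuclideanSpace ℝ (Fin d)) (hx : partialDeriv i k x ≠ 0) : ‖x‖ ≤ δ :=
  mem_closedBall_zero_iff.1
    (hkδ (tsupport_partialDeriv_subset i (subset_tsupport (partialDeriv i k) hx)))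

/-- The pushed field is a test field, with explicit divergences. -/
theorem pushField_spec [IsFiniteMeasure (volume.restrict Ω)]
    (hbdd : Bornology.IsBounded Ω) (hΩ : IsOpen Ω)
    (hk : IsTestFunction Set.univ k) (hb : ∀ i, IsTestFunction Set.univ (b i)) {δ : ℝ}
    (hδ : 0 < δ) (hkδ : tsupport k ⊆ Metric.closedBall 0 δ)
    (hin : ∀ y ∈ Ω, ∀ z, ‖z‖ ≤ 2 * δ → deform t b y + z ∈ Ω) {p : L2Mat Ω} (hp : p ∈ H0Div2 Ω) :
    IsTestField (pushField k t b p) ∧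
      (∀ i, matDiv (pushField k t b p) i
        = toL2 Ω (smear k (deform t b) Ω (pushVec t b p i))) ∧
      matDiv2 (pushField k t b p) = toL2 Ω (pushDiv2 k t b p) := by
  have hΦ : ContDiff ℝ ∞ (deform t b) := contDiff_deform hb
  obtain ⟨C, hC0, hC⟩ := exists_norm_field_le hb
  have hD : ∀ y, ‖deform t b y - y‖ ≤ |t| * C := fun y => by
    rw [deform, add_sub_cancel_left, norm_smul, Real.norm_eq_abs]
    gcongr
    exact hC y
  have hk0 : ∀ x, k x ≠ 0 → ‖x‖ ≤ δ := fun x hx =>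
    mem_closedBall_zero_iff.1 (hkδ (subset_tsupport _ hx))
  have hS : ∀ {g : EuclideanSpace ℝ (Fin d) → ℝ}, MemLp g 2 (volume.restrict Ω) →
      IsTestFunction Ω (smear k (deform t b) Ω g) := fun hg =>
    isTestFunction_smear hk hΦ hD hΩ hbdd hδ hk0 hin (hg.integrable (by norm_num))
  have hS' : ∀ (i : Fin d) {g : EuclideanSpace ℝ (Fin d) → ℝ}, MemLp g 2 (volume.restrict Ω) →
      IsTestFunction Ω (smear (partialDeriv i k) (deform t b) Ω g) := fun i _ hg =>
    isTestFunction_smear (hk.partialDeriv i) hΦ hD hΩ hbdd hδ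
      (partialDeriv_ne_zero_subset hkδ i) hin (hg.integrable (by norm_num))
  have hpart : ∀ (i : Fin d) {g : EuclideanSpace ℝ (Fin d) → ℝ},
      MemLp g 2 (volume.restrict Ω) → IsWeakPartial i (toL2 Ω (smear k (deform t b) Ω g))
        (toL2 Ω (smear (partialDeriv i k) (deform t b) Ω g)) := fun i _ hg =>
    isWeakPartial_smear i hk hΦ.continuous (hg.integrable (by norm_num)) (hS hg) (hS' i hg)
  have hmat := memLp_pushMat (t := t) hbdd hΩ hb p
  have hvec := memLp_pushVec (t := t) hbdd hΩ hb p
  have hrest := memLp_pushRest hbdd hΩ hb p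
  obtain ⟨hd1, hd2⟩ := H0Div2_isGlobalDiv hΩ hp
  -- the rows
  have hrow : ∀ i, IsWeakDiv (row (pushField k t b p) i)
      (toL2 Ω (smear k (deform t b) Ω (pushVec t b p i))) := by
    intro i
    -- Row i of DΦ p is a combination of rows of p with smooth coefficients, so the product rule
    -- gives its divergence `pushVec`. The Piola identity then supplies the right factor DΦᵀ.
    have h1 : ∀ a, IsGlobalDiv Ω (fun c y => jac t b i a y * p (a, c) y)
        (fun y => jac t b i a y * matDiv p a y + ∑ c, partialDeriv c (jac t b i a) y * p (a, c) y) :=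
      fun a => (hd1 a).smooth_mul hbdd hΩ (fun c => Lp.memLp _) (Lp.memLp _) (contDiff_jac hb i a)
    have hm1 : ∀ a c, MemLp (fun y => jac t b i a y * p (a, c) y) 2 (volume.restrict Ω) :=
      fun a c => memLp_continuous_mul hbdd hΩ (contDiff_jac hb i a).continuous (Lp.memLp _)
    have h2 := IsGlobalDiv.sum Finset.univ (fun a _ => h1 a) hm1 fun a =>
      (memLp_continuous_mul hbdd hΩ (contDiff_jac hb i a).continuous (Lp.memLp _)).add
        (memLp_sum _ fun c _ => memLp_continuous_mul hbdd hΩ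
          (contDiff_partialDeriv c (contDiff_jac hb i a)).continuous (Lp.memLp _))
    have e1 : (fun y => ∑ a, (jac t b i a y * matDiv p a y
        + ∑ c, partialDeriv c (jac t b i a) y * p (a, c) y)) = pushVec t b p i := by
      ext y
      simp only [pushVec, pushRest, Finset.sum_add_distrib, partialDeriv_jac hb, Finset.mul_sum,
        mul_assoc]
    rw [e1] at h2
    have h3 := sum_smear_jac (t := t) hbdd hΩ hk hb h2 (fun c => memLp_sum _ fun a _ => hm1 a c)
    have h4 : toL2 Ω (smear k (deform t b) Ω (pushVec t b p i))
        = ∑ j, toL2 Ω (smear (partialDeriv j k) (deform t b) Ω (pushMat t b p i j)) := by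
      rw [← toL2_sum _ fun j _ => (hS' j (hmat i j)).memLp Ω 2]
      congr 1
      ext x
      rw [← h3 x]
      rfl
    rw [h4]
    exact isWeakDiv_of_isWeakPartial fun j => hpart j (hmat i j)
  -- the second divergence
  have hdiv2 : IsWeakDiv (WithLp.toLp 2 fun i => toL2 Ω (smear k (deform t b) Ω (pushVec t b p i)))
      (toL2 Ω (pushDiv2 k t b p)) := by
    -- The identity removes the derivative of the kernel only for DΦ div p. The term t (D²b : p) has
    -- no divergence at hand, so there the derivative stays on the kernel.
    have h3 := sum_smear_jac (t := t) hbdd hΩ hk hb hd2 (fun c => Lp.memLp _)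
    have h4 : toL2 Ω (pushDiv2 k t b p)
        = ∑ i, toL2 Ω (smear (partialDeriv i k) (deform t b) Ω (pushVec t b p i)) := by
      rw [← toL2_sum _ fun j _ => (hS' j (hvec j)).memLp Ω 2]
      congr 1
      ext x
      rw [pushDiv2, ← h3 x, Finset.mul_sum, ← Finset.sum_add_distrib]
      refine Finset.sum_congr rfl fun i _ => ?_
      rw [← smear_add_mul (hk.partialDeriv i) hΦ.continuous t (memLp_sum _ fun a _ =>
        memLp_continuous_mul hbdd hΩ (contDiff_jac hb i a).continuous (Lp.memLp _)) (hrest i)]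
      rfl
    rw [h4]
    exact isWeakDiv_of_isWeakPartial fun i => hpart i (hvec i)
  have htest : IsTestField (pushField k t b p) := by
    refine ⟨fun i j => ?_, fun ij => (hS (hmat ij.1 ij.2)).isTestClass⟩
    change toL2 Ω (smear k (deform t b) Ω (pushMat t b p i j))
      = toL2 Ω (smear k (deform t b) Ω (pushMat t b p j i))
    rw [pushMat_symm hp.1.1 i j]
  have hm : ∀ i, matDiv (pushField k t b p) i
      = toL2 Ω (smear k (deform t b) Ω (pushVec t b p i)) := fun i => (hrow i).vecDiv_eq hΩ
  have hm' : matDiv (pushField k t b p)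
      = WithLp.toLp 2 fun i => toL2 Ω (smear k (deform t b) Ω (pushVec t b p i)) := by
    ext1 i
    exact hm i
  refine ⟨htest, hm, ?_⟩
  rw [matDiv2, hm']
  exact hdiv2.vecDiv_eq hΩ

end Transport

end TGV

end

noncomputable section

namespace TGV

/-! ### Pointwise norms -/

section PointwiseNorms

variable {d : ℕ} {r : ℝ≥0∞} [Fact (1 ≤ r)]

theorem piLp_norm_le_sum {ι : Type*} [Fintype ι] (v : ι → ℝ) :
    ‖(WithLp.toLp r v : PiLp r fun _ : ι => ℝ)‖ ≤ ∑ i, |v i| := by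
  classical
  have h : (WithLp.toLp r v : PiLp r fun _ : ι => ℝ)
      = ∑ i, (WithLp.toLp r (Pi.single i (v i)) : PiLp r fun _ : ι => ℝ) := by
    rw [← WithLp.toLp_sum, Finset.univ_sum_single]
  rw [h]
  refine (norm_sum_le _ _).trans (Finset.sum_le_sum fun i _ => ?_)
  exact (PiLp.norm_single (p := r) (fun _ : ι => ℝ) i (v i)).le

/-- The vector of integrals is one Bochner integral in the finite-dimensional ℓ^r space, whose norm
is at most the integral of the norm. The bound on `F` is needed only where k ≠ 0, so only near the
point under consideration in the applications. -/
theorem piLp_norm_integral_le {Y : Type*} [MeasurableSpace Y] {μ : Measure Y} {ι : Type*}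
    [Fintype ι] {k : Y → ℝ} {F : Y → ι → ℝ} (hk0 : ∀ y, 0 ≤ k y) (hk : Integrable k μ)
    (hF : ∀ i, Integrable (fun y => k y * F y i) μ) {c : ℝ}
    (h : ∀ᵐ y ∂μ, k y ≠ 0 → ‖(WithLp.toLp r (F y) : PiLp r fun _ : ι => ℝ)‖ ≤ c) :
    ‖(WithLp.toLp r (fun i => ∫ y, k y * F y i ∂μ) : PiLp r fun _ : ι => ℝ)‖ ≤ c * ∫ y, k y ∂μ := by
  have h1 : (WithLp.toLp r (fun i => ∫ y, k y * F y i ∂μ) : PiLp r fun _ : ι => ℝ)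
      = ∫ y, (WithLp.toLp r (fun i => k y * F y i) : PiLp r fun _ : ι => ℝ) ∂μ := by
    ext i
    rw [eval_integral_piLp hF]
  rw [h1, ← integral_const_mul]
  refine norm_integral_le_of_norm_le (hk.const_mul c) (h.mono fun y hy => ?_)
  have h2 : (WithLp.toLp r (fun i => k y * F y i) : PiLp r fun _ : ι => ℝ)
      = k y • WithLp.toLp r (F y) := rfl
  rw [h2, norm_smul, Real.norm_of_nonneg (hk0 y), mul_comm]
  by_cases hy0 : k y = 0
  · simp [hy0]
  · exact mul_le_mul_of_nonneg_right (hy hy0) (hk0 y)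

theorem vecNorm_nonneg (v : Fin d → ℝ) : 0 ≤ vecNorm r v := norm_nonneg _

theorem vecNorm_le_sum (v : Fin d → ℝ) : vecNorm r v ≤ ∑ i, |v i| := piLp_norm_le_sum v

theorem abs_le_vecNorm (v : Fin d → ℝ) (i : Fin d) : |v i| ≤ vecNorm r v :=
  PiLp.norm_apply_le (WithLp.toLp r v : PiLp r fun _ : Fin d => ℝ) i

theorem vecNorm_add_le (v w : Fin d → ℝ) : vecNorm r (v + w) ≤ vecNorm r v + vecNorm r w :=
  norm_add_le (WithLp.toLp r v : PiLp r fun _ : Fin d => ℝ) (WithLp.toLp r w)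

theorem vecNorm_smul (c : ℝ) (v : Fin d → ℝ) : vecNorm r (c • v) = |c| * vecNorm r v :=
  norm_smul c (WithLp.toLp r v : PiLp r fun _ : Fin d => ℝ)

theorem inducedNorm_nonneg (A : Matrix (Fin d) (Fin d) ℝ) : 0 ≤ inducedNorm r A :=
  Real.sInf_nonneg fun _ hc => hc.1

theorem inducedNorm_le {A : Matrix (Fin d) (Fin d) ℝ} {c : ℝ} (hc : 0 ≤ c)
    (h : ∀ v, vecNorm r (A.mulVec v) ≤ c * vecNorm r v) : inducedNorm r A ≤ c :=
  have hb : BddBelow {c : ℝ | 0 ≤ c ∧ ∀ v : Fin d → ℝ,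
      vecNorm r (A.mulVec v) ≤ c * vecNorm r v} := ⟨0, fun _ hc => hc.1⟩
  csInf_le hb ⟨hc, h⟩

theorem vecNorm_mulVec_le_sum (A : Matrix (Fin d) (Fin d) ℝ) (v : Fin d → ℝ) :
    vecNorm r (A.mulVec v) ≤ (∑ i, ∑ j, |A i j|) * vecNorm r v := by
  refine (vecNorm_le_sum _).trans ?_
  rw [Finset.sum_mul]
  refine Finset.sum_le_sum fun i _ => ?_
  rw [Finset.sum_mul]
  change |∑ j, A i j * v j| ≤ _
  refine (Finset.abs_sum_le_sum_abs _ _).trans (Finset.sum_le_sum fun j _ => ?_)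
  rw [abs_mul]
  exact mul_le_mul_of_nonneg_left (abs_le_vecNorm v j) (abs_nonneg _)

/-- The infimum is itself admissible: for |v|_r > 0 every admissible constant dominates
|Av|_r/|v|_r, and for |v|_r = 0 the explicit constant Σ|A i j| settles the claim. -/
theorem vecNorm_mulVec_le (A : Matrix (Fin d) (Fin d) ℝ) (v : Fin d → ℝ) :
    vecNorm r (A.mulVec v) ≤ inducedNorm r A * vecNorm r v := by
  have hmem : (∑ i, ∑ j, |A i j|) ∈ {c : ℝ | 0 ≤ c ∧ ∀ v : Fin d → ℝ,
      vecNorm r (A.mulVec v) ≤ c * vecNorm r v} := ⟨by positivity, vecNorm_mulVec_le_sum A⟩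
  rcases (vecNorm_nonneg (r := r) v).eq_or_lt with h0 | h0
  · have := hmem.2 v
    rw [← h0, mul_zero] at this ⊢
    exact this
  · rw [← div_le_iff₀ h0]
    exact le_csInf ⟨_, hmem⟩ fun c hc => (div_le_iff₀ h0).2 (hc.2 v)

variable {N : Matrix (Fin d) (Fin d) ℝ → ℝ}

theorem IsMatrixNorm.add_le (hN : IsMatrixNorm r N) (A B : Matrix (Fin d) (Fin d) ℝ) :
    N (A + B) ≤ N A + N B := by
  rcases hN with rfl | rfl
  · exact norm_add_le (WithLp.toLp r (fun ij => A ij.1 ij.2) : PiLp r fun _ : Fin d × Fin d => ℝ)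
      (WithLp.toLp r (fun ij => B ij.1 ij.2))
  · refine inducedNorm_le (add_nonneg (inducedNorm_nonneg A) (inducedNorm_nonneg B)) fun v => ?_
    rw [Matrix.add_mulVec, add_mul]
    exact (vecNorm_add_le _ _).trans (add_le_add (vecNorm_mulVec_le A v) (vecNorm_mulVec_le B v))

theorem IsMatrixNorm.smul_le (hN : IsMatrixNorm r N) {c : ℝ} (hc : 0 ≤ c)
    (A : Matrix (Fin d) (Fin d) ℝ) : N (c • A) ≤ c * N A := by
  rcases hN with rfl | rfl
  · have := norm_smul c
      (WithLp.toLp r (fun ij => A ij.1 ij.2) : PiLp r fun _ : Fin d × Fin d => ℝ)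
    rw [Real.norm_of_nonneg hc] at this
    exact this.le
  · refine inducedNorm_le (mul_nonneg hc (inducedNorm_nonneg A)) fun v => ?_
    rw [Matrix.smul_mulVec, vecNorm_smul, abs_of_nonneg hc, mul_assoc]
    exact mul_le_mul_of_nonneg_left (vecNorm_mulVec_le A v) hc

theorem IsMatrixNorm.abs_apply_le (hN : IsMatrixNorm r N) (A : Matrix (Fin d) (Fin d) ℝ)
    (i j : Fin d) : |A i j| ≤ N A := by
  rcases hN with rfl | rfl
  · exact PiLp.norm_apply_le
      (WithLp.toLp r (fun ij => A ij.1 ij.2) : PiLp r fun _ : Fin d × Fin d => ℝ) (i, j)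
  · have h1 := abs_le_vecNorm (r := r) (A.mulVec (Pi.single j 1)) i
    have h2 := vecNorm_mulVec_le (r := r) A (Pi.single j 1)
    have h3 : vecNorm r (Pi.single j (1 : ℝ)) ≤ 1 := by
      refine (vecNorm_le_sum _).trans (le_of_eq ?_)
      rw [Finset.sum_eq_single j (fun b _ hb => by simp [hb]) (by simp)]
      simp
    rw [Matrix.mulVec_single_one] at h1 h2
    refine h1.trans (h2.trans ?_)
    exact mul_le_of_le_one_right (inducedNorm_nonneg A) h3

theorem IsMatrixNorm.le_sum (hN : IsMatrixNorm r N) (A : Matrix (Fin d) (Fin d) ℝ) :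
    N A ≤ ∑ i, ∑ j, |A i j| := by
  rcases hN with rfl | rfl
  · refine (piLp_norm_le_sum _).trans (le_of_eq ?_)
    rw [Fintype.sum_prod_type]
  · exact inducedNorm_le (by positivity) (vecNorm_mulVec_le_sum A)

/-- The entrywise norm is a vector norm on pairs of indices. For the operator norm, the vector
estimate is applied to F(y)v for each fixed v. -/
theorem IsMatrixNorm.integral_le (hN : IsMatrixNorm r N) {Y : Type*} [MeasurableSpace Y]
    {μ : Measure Y} {k : Y → ℝ} {F : Y → Matrix (Fin d) (Fin d) ℝ} (hk0 : ∀ y, 0 ≤ k y)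
    (hk : Integrable k μ) (hF : ∀ i j, Integrable (fun y => k y * F y i j) μ) {c : ℝ} (hc : 0 ≤ c)
    (h : ∀ᵐ y ∂μ, k y ≠ 0 → N (F y) ≤ c) :
    N (Matrix.of fun i j => ∫ y, k y * F y i j ∂μ) ≤ c * ∫ y, k y ∂μ := by
  rcases hN with rfl | rfl
  · exact piLp_norm_integral_le (F := fun y (ij : Fin d × Fin d) => F y ij.1 ij.2) hk0 hk
      (fun ij => hF ij.1 ij.2) h
  · refine inducedNorm_le (mul_nonneg hc (integral_nonneg hk0)) fun v => ?_
    have e : (Matrix.of fun i j => ∫ y, k y * F y i j ∂μ).mulVec v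
        = fun i => ∫ y, k y * (F y).mulVec v i ∂μ := by
      ext i
      simp only [Matrix.mulVec, dotProduct, Matrix.of_apply]
      simp only [← integral_mul_const]
      rw [← integral_finsetSum _ fun j _ => (hF i j).mul_const _]
      simp only [Finset.mul_sum, mul_assoc]
    have hI : ∀ i, Integrable (fun y => k y * (F y).mulVec v i) μ := fun i => by
      simp only [Matrix.mulVec, dotProduct, Finset.mul_sum, ← mul_assoc]
      exact integrable_finsetSum _ fun j _ => (hF i j).mul_const _
    rw [e, mul_right_comm]
    refine piLp_norm_integral_le (F := fun y => (F y).mulVec v) hk0 hk hI (h.mono fun y hy hky => ?_)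
    exact (vecNorm_mulVec_le (F y) v).trans
      (mul_le_mul_of_nonneg_right (hy hky) (vecNorm_nonneg v))

/-- One factor d² bounds the sum of entries by `N A`, the other counts the entries of B - A. -/
theorem IsMatrixNorm.le_of_close (hN : IsMatrixNorm r N) {A B : Matrix (Fin d) (Fin d) ℝ} {s : ℝ}
    (hs : 0 ≤ s) (h : ∀ i j, |B i j - A i j| ≤ s * ∑ a, ∑ c, |A a c|) :
    N B ≤ (1 + s * (d : ℝ) ^ 4) * N A := by
  have h1 : ∑ a, ∑ c, |A a c| ≤ (d : ℝ) ^ 2 * N A := by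
    calc _ ≤ ∑ _a : Fin d, ∑ _c : Fin d, N A :=
          Finset.sum_le_sum fun a _ => Finset.sum_le_sum fun c _ => hN.abs_apply_le A a c
      _ = _ := by simp; ring
  have h2 : N (B - A) ≤ s * (d : ℝ) ^ 4 * N A := by
    calc _ ≤ ∑ i, ∑ j, |(B - A) i j| := hN.le_sum _
      _ ≤ ∑ _i : Fin d, ∑ _j : Fin d, s * ((d : ℝ) ^ 2 * N A) :=
          Finset.sum_le_sum fun i _ => Finset.sum_le_sum fun j _ =>
            (h i j).trans (mul_le_mul_of_nonneg_left h1 hs)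
      _ = _ := by simp; ring
  have h3 := hN.add_le A (B - A)
  rw [add_sub_cancel] at h3
  linarith

theorem satisfiesBounds_zero {Ω : Set (EuclideanSpace ℝ (Fin d))} (hΩ : IsOpen Ω)
    (hN : IsMatrixNorm r N) {α₀ α₁ : EuclideanSpace ℝ (Fin d) → ℝ} (h₀ : IsWeight Ω α₀)
    (h₁ : IsWeight Ω α₁) : SatisfiesBounds r N α₀ α₁ (0 : L2Mat Ω) := by
  obtain ⟨-, a₀, ha₀, hα₀⟩ := h₀
  obtain ⟨-, a₁, ha₁, hα₁⟩ := h₁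
  have hd : matDiv (0 : L2Mat Ω) = 0 := by
    have h : IsTestField (0 : L2Mat Ω) := (testFields Ω).zero_mem
    have := divTriple_smul hΩ 0 (h.mem_HDiv2 hΩ)
    rw [zero_smul, zero_smul] at this
    rw [matDiv_eq_snd, this]
    rfl
  rw [SatisfiesBounds, hd]
  filter_upwards [Lp.coeFn_zero ℝ 2 (volume.restrict Ω), ae_restrict_mem hΩ.measurableSet]
    with x hx hxΩ
  have e1 : (Matrix.of fun i j => ((0 : L2Mat Ω) (i, j)) x) = (0 : Matrix (Fin d) (Fin d) ℝ) := by
    ext i j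
    exact hx
  have e2 : (fun i => ((0 : L2Vec Ω) i) x) = (0 : Fin d → ℝ) := by
    ext i
    exact hx
  rw [e1, e2]
  refine ⟨?_, ?_⟩
  · have := hN.le_sum 0
    simp only [Matrix.zero_apply, abs_zero, Finset.sum_const_zero] at this
    exact this.trans (ha₀.trans (hα₀ x hxΩ)).le
  · have := vecNorm_le_sum (r := r) (0 : Fin d → ℝ)
    simp only [Pi.zero_apply, abs_zero, Finset.sum_const_zero] at this
    exact this.trans (ha₁.trans (hα₁ x hxΩ)).le

end PointwiseNorms

/-! ### Weights -/

section Weights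

variable {d : ℕ} {Ω : Set (EuclideanSpace ℝ (Fin d))} {α : EuclideanSpace ℝ (Fin d) → ℝ}

theorem IsWeight.exists_le (h : IsWeight Ω α) (hbdd : Bornology.IsBounded Ω) :
    ∃ C : ℝ, 0 < C ∧ ∀ x ∈ Ω, α x ≤ C := by
  obtain ⟨C, hC⟩ := hbdd.isCompact_closure.exists_bound_of_continuousOn h.1
  refine ⟨|C| + 1, by positivity, fun x hx => ?_⟩
  have := hC x (subset_closure hx)
  linarith [le_abs_self C, le_abs_self (α x), Real.norm_eq_abs (α x)]

/-- Uniform continuity on the compact closure with tolerance τa; the lower bound a turns this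
absolute error into a relative one. -/
theorem IsWeight.exists_oscillation (h : IsWeight Ω α) (hbdd : Bornology.IsBounded Ω) {τ : ℝ}
    (hτ : 0 < τ) :
    ∃ ρ : ℝ, 0 < ρ ∧ ∀ x ∈ Ω, ∀ y ∈ Ω, ‖y - x‖ < ρ → α y ≤ (1 + τ) * α x := by
  obtain ⟨hc, a, ha, hα⟩ := h
  have hu := hbdd.isCompact_closure.uniformContinuousOn_of_continuous hc
  obtain ⟨ρ, hρ, hlt⟩ := Metric.uniformContinuousOn_iff.1 hu (τ * a) (by positivity)
  refine ⟨ρ, hρ, fun x hx y hy hxy => ?_⟩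
  have h1 := hlt y (subset_closure hy) x (subset_closure hx) (by rwa [dist_eq_norm])
  rw [Real.dist_eq] at h1
  have h2 := (abs_lt.1 h1).2
  nlinarith [hα x hx]

end Weights

end TGV

end

noncomputable section

namespace TGV

/-! ### Mollifiers -/

section Mollifier

variable {d : ℕ}

/-- Rescaling one fixed bump: a derivative costs 1/δ in L¹, with a constant independent of δ. That
rate is exactly what the factor t in `pushDiv2` can compensate. -/
theorem exists_mollifier (d : ℕ) : ∃ C : ℝ, 0 < C ∧ ∀ δ : ℝ, 0 < δ →
    ∃ k : EuclideanSpace ℝ (Fin d) → ℝ, IsTestFunction Set.univ k ∧ (∀ x, 0 ≤ k x) ∧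
      ∫ x, k x = 1 ∧ tsupport k ⊆ Metric.closedBall 0 δ ∧
      ∀ i, ∫ x, |partialDeriv i k x| ≤ C / δ := by
  let f : ContDiffBump (0 : EuclideanSpace ℝ (Fin d)) := ⟨1 / 2, 1, by norm_num, by norm_num⟩
  set η : EuclideanSpace ℝ (Fin d) → ℝ := f.normed volume with hη
  have hη1 : ContDiff ℝ ∞ η := f.contDiff_normed
  refine ⟨1 + ∑ i, ∫ x, |partialDeriv i η x|, ?_, fun δ hδ => ?_⟩
  · have : 0 ≤ ∑ i, ∫ x, |partialDeriv i η x| :=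
      Finset.sum_nonneg fun i _ => integral_nonneg fun x => abs_nonneg _
    linarith
  set k : EuclideanSpace ℝ (Fin d) → ℝ := fun x => (δ ^ d)⁻¹ * η (δ⁻¹ • x) with hk
  have hδd : δ ^ d ≠ 0 := by positivity
  have hsupp : tsupport k ⊆ Metric.closedBall 0 δ := by
    refine closure_minimal (fun x hx => ?_) Metric.isClosed_closedBall
    have h1 : δ⁻¹ • x ∈ Function.support η := right_ne_zero_of_mul hx
    rw [hη, f.support_normed_eq, mem_ball_zero_iff, norm_smul, norm_inv,
      Real.norm_of_nonneg hδ.le, inv_mul_lt_iff₀ hδ] at h1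
    rw [mem_closedBall_zero_iff]
    exact (h1.trans_eq (mul_one δ)).le
  have hint : ∀ g : EuclideanSpace ℝ (Fin d) → ℝ,
      ∫ x, (δ ^ d)⁻¹ * g (δ⁻¹ • x) = ∫ x, g x := fun g => by
    rw [integral_const_mul, Measure.integral_comp_inv_smul_of_nonneg _ g hδ.le,
      finrank_euclideanSpace, Fintype.card_fin, smul_eq_mul, inv_mul_cancel_left₀ hδd]
  refine ⟨k, ⟨contDiff_const.mul (hη1.comp (contDiff_const_smul _)), ?_, Set.subset_univ _⟩,
    fun x => mul_nonneg (by positivity) (f.nonneg_normed _), ?_, hsupp, fun i => ?_⟩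
  · exact (isCompact_closedBall _ _).of_isClosed_subset (isClosed_tsupport _) hsupp
  · rw [hint, hη, f.integral_normed]
  · have hd : ∀ x, partialDeriv i k x = (δ ^ d)⁻¹ * (δ⁻¹ * partialDeriv i η (δ⁻¹ • x)) := by
      intro x
      have h0 : DifferentiableAt ℝ η (δ⁻¹ • x) := hη1.differentiable (by simp) _
      have h1 : HasFDerivAt (fun x : EuclideanSpace ℝ (Fin d) => δ⁻¹ • x)
          (δ⁻¹ • ContinuousLinearMap.id ℝ _) x := (hasFDerivAt_id (𝕜 := ℝ) x).const_smul δ⁻¹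
      have h2 := (h0.hasFDerivAt.comp x h1).const_mul ((δ ^ d)⁻¹)
      have h3 : fderiv ℝ k x = _ := h2.fderiv
      rw [partialDeriv, h3]
      simp [partialDeriv]
    have e : ∀ x, |partialDeriv i k x| = (δ ^ d)⁻¹ * (δ⁻¹ * |partialDeriv i η (δ⁻¹ • x)|) := by
      intro x
      rw [hd, abs_mul, abs_mul, abs_of_nonneg (by positivity : 0 ≤ (δ ^ d)⁻¹),
        abs_of_nonneg (by positivity : 0 ≤ δ⁻¹)]
    simp only [e]
    rw [hint fun x => δ⁻¹ * |partialDeriv i η x|, integral_const_mul, inv_mul_eq_div]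
    gcongr
    have := Finset.single_le_sum (f := fun i => ∫ x, |partialDeriv i η x|)
      (fun i _ => integral_nonneg fun x => abs_nonneg _) (Finset.mem_univ i)
    linarith

theorem IsTestFunction.exists_lipschitzWith {U : Set (EuclideanSpace ℝ (Fin d))}
    {φ : EuclideanSpace ℝ (Fin d) → ℝ} (h : IsTestFunction U φ) : ∃ L : ℝ≥0, LipschitzWith L φ :=
  h.1.lipschitzWith_of_hasCompactSupport h.2.1 (by simp)

end Mollifier

/-! ### The deformation close to the identity -/

section Deform

variable {d : ℕ} {b : Fin d → EuclideanSpace ℝ (Fin d) → ℝ} {t : ℝ}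

theorem exists_lipschitzWith_field (hb : ∀ i, IsTestFunction Set.univ (b i)) :
    ∃ L : ℝ, 0 ≤ L ∧ ∀ x y, ‖field b x - field b y‖ ≤ L * ‖x - y‖ := by
  choose L hL using fun i => (hb i).exists_lipschitzWith
  refine ⟨∑ i, L i, by positivity, fun x y => (norm_piLp_le_sum _).trans ?_⟩
  rw [Finset.sum_mul]
  exact Finset.sum_le_sum fun i _ => (hL i).norm_sub_le x y

/-- A perturbation of the identity by a map of Lipschitz constant tL < 1 shrinks distances by at
most the factor 1 - tL. -/
theorem antilipschitzWith_deform {L : ℝ} (hL : ∀ x y, ‖field b x - field b y‖ ≤ L * ‖x - y‖)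
    (ht : 0 ≤ t) (htL : t * L < 1) :
    AntilipschitzWith (Real.toNNReal (1 - t * L)⁻¹) (deform t b) := by
  refine AntilipschitzWith.of_le_mul_dist fun x y => ?_
  have h0 : 0 < 1 - t * L := by linarith
  rw [Real.coe_toNNReal _ (by positivity), dist_eq_norm, dist_eq_norm, inv_mul_eq_div,
    le_div_iff₀ h0]
  have h1 : x - y = deform t b x - deform t b y - t • (field b x - field b y) := by
    simp only [deform, smul_sub]; abel
  have h2 := norm_sub_le (deform t b x - deform t b y) (t • (field b x - field b y))
  rw [← h1, norm_smul, Real.norm_of_nonneg ht] at h2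
  have h3 := mul_le_mul_of_nonneg_left (hL x y) ht
  linarith

theorem norm_deform_sub_le {C : ℝ} (hC : ∀ y, ‖field b y‖ ≤ C) (ht : 0 ≤ t)
    (y : EuclideanSpace ℝ (Fin d)) : ‖deform t b y - y‖ ≤ t * C := by
  rw [deform, add_sub_cancel_left, norm_smul, Real.norm_of_nonneg ht]
  exact mul_le_mul_of_nonneg_left (hC y) ht

theorem exists_bound_partialDeriv (hb : ∀ i, IsTestFunction Set.univ (b i)) :
    ∃ β : ℝ, 0 ≤ β ∧ (∀ i a y, |partialDeriv a (b i) y| ≤ β) ∧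
      ∀ i a c y, |partialDeriv c (partialDeriv a (b i)) y| ≤ β := by
  choose C hC using fun i a => ((hb i).partialDeriv a).exists_bound
  choose E hE using fun i a c => (((hb i).partialDeriv a).partialDeriv c).exists_bound
  have hC' : ∀ i a, |C i a| ≤ ∑ i, ∑ a, |C i a| := fun i a =>
    (Finset.single_le_sum (f := fun a => |C i a|) (fun _ _ => abs_nonneg _)
      (Finset.mem_univ a)).trans (Finset.single_le_sum (f := fun i => ∑ a, |C i a|)
        (fun _ _ => by positivity) (Finset.mem_univ i))
  have hE' : ∀ i a c, |E i a c| ≤ ∑ i, ∑ a, ∑ c, |E i a c| := fun i a c =>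
    (Finset.single_le_sum (f := fun c => |E i a c|) (fun _ _ => abs_nonneg _)
      (Finset.mem_univ c)).trans ((Finset.single_le_sum (f := fun a => ∑ c, |E i a c|)
        (fun _ _ => by positivity) (Finset.mem_univ a)).trans
        (Finset.single_le_sum (f := fun i => ∑ a, ∑ c, |E i a c|)
        (fun _ _ => by positivity) (Finset.mem_univ i)))
  have h1 : 0 ≤ ∑ i, ∑ a, |C i a| := by positivity
  have h2 : 0 ≤ ∑ i, ∑ a, ∑ c, |E i a c| := by positivity
  refine ⟨(∑ i, ∑ a, |C i a|) + ∑ i, ∑ a, ∑ c, |E i a c|, by positivity, fun i a y => ?_,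
    fun i a c y => ?_⟩
  · have := (hC i a y).trans (le_abs_self _)
    rw [Real.norm_eq_abs] at this
    linarith [hC' i a]
  · have := (hE i a c y).trans (le_abs_self _)
    rw [Real.norm_eq_abs] at this
    linarith [hE' i a c]

theorem abs_jac_mul_jac_sub_le {β : ℝ} (hβ0 : 0 ≤ β) (hβ : ∀ i a y, |partialDeriv a (b i) y| ≤ β)
    (ht : 0 ≤ t) (ht1 : t ≤ 1) (i j a c : Fin d) (y : EuclideanSpace ℝ (Fin d)) :
    |jac t b j c y * jac t b i a y - (if j = c then 1 else 0) * (if i = a then 1 else 0)|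
      ≤ t * (2 * β + β ^ 2) := by
  have key : ∀ e e' u v : ℝ, |e| ≤ 1 → |e'| ≤ 1 → |u| ≤ β → |v| ≤ β →
      |(e + t * u) * (e' + t * v) - e * e'| ≤ t * (2 * β + β ^ 2) := by
    intro e e' u v he he' hu hv
    have h : (e + t * u) * (e' + t * v) - e * e' = t * (e * v + u * e' + t * (u * v)) := by ring
    rw [h, abs_mul, abs_of_nonneg ht]
    refine mul_le_mul_of_nonneg_left ?_ ht
    have h1 : |e * v| ≤ 1 * β := by rw [abs_mul]; gcongr
    have h2 : |u * e'| ≤ β * 1 := by rw [abs_mul]; gcongr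
    have h3 : |t * (u * v)| ≤ 1 * (β * β) := by
      rw [abs_mul, abs_mul, abs_of_nonneg ht]; gcongr
    have h4 := abs_add_three (e * v) (u * e') (t * (u * v))
    nlinarith
  refine key _ _ _ _ ?_ ?_ (hβ j c y) (hβ i a y) <;> split_ifs <;> simp

theorem abs_pushMat_sub_le {Ω : Set (EuclideanSpace ℝ (Fin d))} {β : ℝ} (hβ0 : 0 ≤ β)
    (hβ : ∀ i a y, |partialDeriv a (b i) y| ≤ β)
    (ht : 0 ≤ t) (ht1 : t ≤ 1) (p : L2Mat Ω) (i j : Fin d) (y : EuclideanSpace ℝ (Fin d)) :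
    |pushMat t b p i j y - p (i, j) y| ≤ t * (2 * β + β ^ 2) * ∑ a, ∑ c, |p (a, c) y| := by
  have h1 : pushMat t b p i j y - p (i, j) y = ∑ c, ∑ a, (jac t b j c y * jac t b i a y
      - (if j = c then 1 else 0) * (if i = a then 1 else 0)) * p (a, c) y := by
    have h2 : p (i, j) y = ∑ c, ∑ a, ((if j = c then (1 : ℝ) else 0) * (if i = a then 1 else 0))
        * p (a, c) y := by simp
    rw [h2, pushMat, ← Finset.sum_sub_distrib]
    refine Finset.sum_congr rfl fun c _ => ?_
    rw [Finset.mul_sum, ← Finset.sum_sub_distrib]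
    exact Finset.sum_congr rfl fun a _ => by ring
  rw [h1, Finset.sum_comm, Finset.mul_sum]
  refine (Finset.abs_sum_le_sum_abs _ _).trans (Finset.sum_le_sum fun a _ => ?_)
  rw [Finset.mul_sum]
  refine (Finset.abs_sum_le_sum_abs _ _).trans (Finset.sum_le_sum fun c _ => ?_)
  rw [abs_mul]
  exact mul_le_mul_of_nonneg_right (abs_jac_mul_jac_sub_le hβ0 hβ ht ht1 i j a c y) (abs_nonneg _)

theorem abs_pushVec_sub_le {Ω : Set (EuclideanSpace ℝ (Fin d))} {β : ℝ}
    (hβ : ∀ i a y, |partialDeriv a (b i) y| ≤ β)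
    (hβ' : ∀ i a c y, |partialDeriv c (partialDeriv a (b i)) y| ≤ β)
    (ht : 0 ≤ t) (p : L2Mat Ω) (i : Fin d) (y : EuclideanSpace ℝ (Fin d)) :
    |pushVec t b p i y - matDiv p i y|
      ≤ t * β * ((∑ a, |matDiv p a y|) + ∑ a, ∑ c, |p (a, c) y|) := by
  have h1 : pushVec t b p i y - matDiv p i y
      = t * ((∑ a, partialDeriv a (b i) y * matDiv p a y) + pushRest b p i y) := by
    have h2 : ∑ a, jac t b i a y * matDiv p a y
        = matDiv p i y + t * ∑ a, partialDeriv a (b i) y * matDiv p a y := by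
      simp only [jac, add_mul, Finset.sum_add_distrib, Finset.mul_sum, mul_assoc]
      simp
    rw [pushVec, h2]; ring
  rw [h1, abs_mul, abs_of_nonneg ht, mul_assoc]
  refine mul_le_mul_of_nonneg_left ((abs_add_le _ _).trans ?_) ht
  rw [mul_add]
  refine add_le_add ?_ ?_
  · rw [Finset.mul_sum]
    refine (Finset.abs_sum_le_sum_abs _ _).trans (Finset.sum_le_sum fun a _ => ?_)
    rw [abs_mul]
    exact mul_le_mul_of_nonneg_right (hβ i a y) (abs_nonneg _)
  · rw [pushRest, Finset.mul_sum]
    refine (Finset.abs_sum_le_sum_abs _ _).trans (Finset.sum_le_sum fun a _ => ?_)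
    rw [Finset.mul_sum]
    refine (Finset.abs_sum_le_sum_abs _ _).trans (Finset.sum_le_sum fun c _ => ?_)
    rw [abs_mul]
    exact mul_le_mul_of_nonneg_right (hβ' i a c y) (abs_nonneg _)

end Deform

/-! ### Estimates in `L²` -/

section SmearNorm

variable {d : ℕ} {Ω : Set (EuclideanSpace ℝ (Fin d))} {k g : EuclideanSpace ℝ (Fin d) → ℝ}
  {Φ : EuclideanSpace ℝ (Fin d) → EuclideanSpace ℝ (Fin d)}

theorem norm_toL2_sq (hg : MemLp g 2 (volume.restrict Ω)) :
    ‖toL2 Ω g‖ ^ 2 = ∫ x in Ω, g x ^ 2 := by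
  rw [← real_inner_self_eq_norm_sq, inner_toL2 hg]
  refine integral_congr_ae ((coeFn_toL2 hg).mono fun x hx => ?_)
  simp only [hx, sq]

/-- In the Schur test, integration in y costs K^d because of Φ, while integration in x is
translation invariant. Since K ≥ 1, the constant K^d A serves for both. -/
theorem norm_toL2_smear_le [IsFiniteMeasure (volume.restrict Ω)]
    (hk : IsTestFunction Set.univ k) {K : ℝ≥0} (hK : 1 ≤ K) (hΦ : AntilipschitzWith K Φ)
    (hΦc : Continuous Φ) {A : ℝ} (hA : 0 < A) (hkA : ∫ x, |k x| ≤ A)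
    (hS : IsTestFunction Ω (smear k Φ Ω g)) (hg : MemLp g 2 (volume.restrict Ω)) :
    ‖toL2 Ω (smear k Φ Ω g)‖ ≤ (K : ℝ) ^ d * A * ‖toL2 Ω g‖ := by
  have hK1 : (1 : ℝ) ≤ (K : ℝ) ^ d := one_le_pow₀ (by exact_mod_cast hK)
  have h := integral_sq_smear_le (A := (K : ℝ) ^ d * A) hk hΦc (by positivity)
    (fun x => (integral_comp_le hΦ hΦc hk x).trans (by gcongr)) (fun y => ?_) hS hg
  · rw [← norm_toL2_sq (hS.memLp Ω 2), ← norm_toL2_sq hg, ← mul_pow] at h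
    exact (sq_le_sq₀ (norm_nonneg _) (by positivity)).1 h
  · calc ∫ x in Ω, |k (x - Φ y)| ≤ ∫ x, |k (x - Φ y)| :=
          setIntegral_le_integral (isTestFunction_translate hk (Φ y)).integrable.abs
            (Eventually.of_forall fun x => abs_nonneg _)
      _ = ∫ x, |k x| := integral_sub_right_eq_self (fun x => |k x|) (Φ y)
      _ ≤ 1 * A := by rwa [one_mul]
      _ ≤ _ := by gcongr

end SmearNorm

end TGV

end

noncomputable section

namespace TGV

/-! ### Convexity of the constraints -/

section Constraints

variable {d : ℕ} {Ω : Set (EuclideanSpace ℝ (Fin d))} {r : ℝ≥0∞} [Fact (1 ≤ r)]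
  {N : Matrix (Fin d) (Fin d) ℝ → ℝ} {α₀ α₁ : EuclideanSpace ℝ (Fin d) → ℝ}

theorem matDiv_comb (hΩ : IsOpen Ω) {p q : L2Mat Ω} (hp : p ∈ H0Div2 Ω) (hq : q ∈ H0Div2 Ω)
    (a b : ℝ) : matDiv (a • p + b • q) = a • matDiv p + b • matDiv q := by
  have hp' := (h0Div2 hΩ).smul_mem a hp
  have hq' := (h0Div2 hΩ).smul_mem b hq
  simp only [matDiv_eq_snd]
  rw [divTriple_add hΩ hp'.1 hq'.1, divTriple_smul hΩ a hp.1, divTriple_smul hΩ b hq.1]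
  rfl

theorem coeFn_comb (u v : L2 Ω) (a b : ℝ) :
    ∀ᵐ x ∂(volume.restrict Ω), (a • u + b • v : L2 Ω) x = a * u x + b * v x := by
  filter_upwards [Lp.coeFn_add (a • u) (b • v), Lp.coeFn_smul a u, Lp.coeFn_smul b v]
    with x h1 h2 h3
  rw [h1, Pi.add_apply, h2, h3]
  rfl

theorem ae_coeFn_comb (hΩ : IsOpen Ω) {p q : L2Mat Ω} (hp : p ∈ H0Div2 Ω) (hq : q ∈ H0Div2 Ω)
    (a b : ℝ) : ∀ᵐ x ∂(volume.restrict Ω),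
      ((Matrix.of fun i j => (a • p + b • q) (i, j) x)
        = a • (Matrix.of fun i j => p (i, j) x) + b • Matrix.of fun i j => q (i, j) x) ∧
      (fun i => matDiv (a • p + b • q) i x)
        = a • (fun i => matDiv p i x) + b • fun i => matDiv q i x := by
  have h1 : ∀ᵐ x ∂(volume.restrict Ω), ∀ ij : Fin d × Fin d,
      (a • p ij + b • q ij : L2 Ω) x = a * p ij x + b * q ij x :=
    ae_all_iff.2 fun ij => coeFn_comb (p ij) (q ij) a b
  have h2 : ∀ᵐ x ∂(volume.restrict Ω), ∀ i : Fin d,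
      (a • matDiv p i + b • matDiv q i : L2 Ω) x = a * matDiv p i x + b * matDiv q i x :=
    ae_all_iff.2 fun i => coeFn_comb (matDiv p i) (matDiv q i) a b
  rw [matDiv_comb hΩ hp hq]
  filter_upwards [h1, h2] with x hx1 hx2
  exact ⟨Matrix.ext fun i j => hx1 (i, j), funext hx2⟩

theorem convex_feasibleSet (hΩ : IsOpen Ω) (hN : IsMatrixNorm r N) :
    Convex ℝ (feasibleSet Ω r N α₀ α₁) := by
  intro p hp q hq a b ha hb hab
  refine ⟨(h0Div2 hΩ).add_mem ((h0Div2 hΩ).smul_mem a hp.1) ((h0Div2 hΩ).smul_mem b hq.1), ?_⟩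
  filter_upwards [ae_coeFn_comb hΩ hp.1 hq.1 a b, hp.2, hq.2] with x hx hpx hqx
  have e : ∀ s : ℝ, a * s + b * s = s := fun s => by rw [← add_mul, hab, one_mul]
  rw [hx.1, hx.2]
  refine ⟨(hN.add_le _ _).trans ?_, (vecNorm_add_le _ _).trans ?_⟩
  · rw [← e (α₀ x)]
    exact add_le_add ((hN.smul_le ha _).trans (mul_le_mul_of_nonneg_left hpx.1 ha))
      ((hN.smul_le hb _).trans (mul_le_mul_of_nonneg_left hqx.1 hb))
  · rw [← e (α₁ x), vecNorm_smul, vecNorm_smul, abs_of_nonneg ha, abs_of_nonneg hb]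
    exact add_le_add (mul_le_mul_of_nonneg_left hpx.2 ha) (mul_le_mul_of_nonneg_left hqx.2 hb)

theorem inv_smul_mem_feasibleSet (hΩ : IsOpen Ω) (hN : IsMatrixNorm r N) {p : L2Mat Ω}
    (hp : p ∈ H0Div2 Ω) {c : ℝ} (hc : 0 < c)
    (h : SatisfiesBounds r N (fun x => c * α₀ x) (fun x => c * α₁ x) p) :
    c⁻¹ • p ∈ feasibleSet Ω r N α₀ α₁ := by
  refine ⟨(h0Div2 hΩ).smul_mem _ hp, ?_⟩
  filter_upwards [ae_coeFn_comb hΩ hp hp c⁻¹ 0, h] with x hx hpx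
  have hc' : 0 ≤ c⁻¹ := by positivity
  simp only [zero_smul, add_zero] at hx
  rw [hx.1, hx.2, vecNorm_smul, abs_of_nonneg hc']
  refine ⟨(hN.smul_le hc' _).trans ?_, ?_⟩
  · rw [inv_mul_le_iff₀ hc]; exact hpx.1
  · rw [inv_mul_le_iff₀ hc]; exact hpx.2

end Constraints

/-! ### Smearing along an inward deformation -/

section InwardSmearing

variable {d : ℕ} {Ω : Set (EuclideanSpace ℝ (Fin d))} {r : ℝ≥0∞} [Fact (1 ≤ r)]
  {N : Matrix (Fin d) (Fin d) ℝ → ℝ} {α₀ α₁ : EuclideanSpace ℝ (Fin d) → ℝ}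
  {k : EuclideanSpace ℝ (Fin d) → ℝ} {b : Fin d → EuclideanSpace ℝ (Fin d) → ℝ} {t δ : ℝ}

/-- `k` is a mollifier of radius `δ` and the deformation `deform t b` moves `Ω` into its interior,
at a distance at least `2 δ` from the complement. -/
structure IsInwardSmearing (Ω : Set (EuclideanSpace ℝ (Fin d)))
    (k : EuclideanSpace ℝ (Fin d) → ℝ) (b : Fin d → EuclideanSpace ℝ (Fin d) → ℝ)
    (t δ : ℝ) : Prop where
  kernel : IsTestFunction Set.univ k
  nonneg : ∀ x, 0 ≤ k x
  integral_eq_one : ∫ x, k x = 1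
  tsupport_subset : tsupport k ⊆ Metric.closedBall 0 δ
  radius_pos : 0 < δ
  field : ∀ i, IsTestFunction Set.univ (b i)
  maps : ∀ y ∈ Ω, ∀ z, ‖z‖ ≤ 2 * δ → deform t b y + z ∈ Ω
  time_nonneg : 0 ≤ t
  time_le_one : t ≤ 1

namespace IsInwardSmearing

theorem norm_le_radius (h : IsInwardSmearing Ω k b t δ) (x : EuclideanSpace ℝ (Fin d))
    (hx : k x ≠ 0) : ‖x‖ ≤ δ :=
  mem_closedBall_zero_iff.1 (h.tsupport_subset (subset_tsupport _ hx))

theorem continuous_deform (h : IsInwardSmearing Ω k b t δ) : Continuous (deform t b) :=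
  (contDiff_deform h.field).continuous

theorem integral_kernel_le (h : IsInwardSmearing Ω k b t δ) {K : ℝ≥0}
    (hK : AntilipschitzWith K (deform t b)) (x : EuclideanSpace ℝ (Fin d)) :
    ∫ y in Ω, k (x - deform t b y) ≤ (K : ℝ) ^ d := by
  have h1 := integral_comp_le (Ω := Ω) hK h.continuous_deform h.kernel x
  simp only [abs_of_nonneg (h.nonneg _), h.integral_eq_one, mul_one] at h1
  exact h1

theorem norm_sub_le_of_kernel_ne_zero (h : IsInwardSmearing Ω k b t δ) {C : ℝ}
    (hC : ∀ y, ‖TGV.field b y‖ ≤ C) {x y : EuclideanSpace ℝ (Fin d)}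
    (hxy : k (x - deform t b y) ≠ 0) : ‖y - x‖ ≤ δ + t * C := by
  have h1 := h.norm_le_radius _ hxy
  have h2 := norm_deform_sub_le hC h.time_nonneg y
  have h3 : y - x = -((x - deform t b y) + (deform t b y - y)) := by abel
  rw [h3, norm_neg]
  exact (norm_add_le _ _).trans (add_le_add h1 h2)

/-- Three relative errors multiply: DΦ p DΦᵀ against p, the oscillation of α₀ over the range δ + tC
of the kernel, and the total mass K^d of the kernel in y. -/
theorem matrixNorm_smear_le [IsFiniteMeasure (volume.restrict Ω)]
    (h : IsInwardSmearing Ω k b t δ) (hΩ : IsOpen Ω)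
    (hbdd : Bornology.IsBounded Ω) (hN : IsMatrixNorm r N) {C β ρ τ : ℝ} (hτ : 0 ≤ τ)
    (hC : ∀ y, ‖TGV.field b y‖ ≤ C) (hβ0 : 0 ≤ β) (hβ : ∀ i a y, |partialDeriv a (b i) y| ≤ β)
    {K : ℝ≥0} (hK : AntilipschitzWith K (deform t b)) (hρ : δ + t * C < ρ)
    (hα0 : ∀ x ∈ Ω, 0 < α₀ x)
    (hα : ∀ x ∈ Ω, ∀ y ∈ Ω, ‖y - x‖ < ρ → α₀ y ≤ (1 + τ) * α₀ x) {p : L2Mat Ω}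
    (hp : ∀ᵐ y ∂(volume.restrict Ω), N (Matrix.of fun i j => p (i, j) y) ≤ α₀ y)
    {x : EuclideanSpace ℝ (Fin d)} (hx : x ∈ Ω) :
    N (Matrix.of fun i j => smear k (deform t b) Ω (pushMat t b p i j) x)
      ≤ (1 + t * (2 * β + β ^ 2) * (d : ℝ) ^ 4) * (1 + τ) * (K : ℝ) ^ d * α₀ x := by
  have ht := h.time_nonneg
  have hc : 0 ≤ (1 + t * (2 * β + β ^ 2) * (d : ℝ) ^ 4) * ((1 + τ) * α₀ x) := by
    have := hα0 x hx
    positivity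
  have hI : ∀ g, Integrable g (volume.restrict Ω) →
      Integrable (fun y => k (x - deform t b y) * g y) (volume.restrict Ω) := fun g hg =>
    integrable_kernel_mul h.kernel h.continuous_deform hg x
  have h1 := hN.integral_le (μ := volume.restrict Ω) (k := fun y => k (x - deform t b y))
    (F := fun y => Matrix.of fun i j => pushMat t b p i j y) (fun y => h.nonneg _)
    (by simpa using hI (fun _ => 1) (integrable_const 1))
    (fun i j => hI _ ((memLp_pushMat hbdd hΩ h.field p i j).integrable (by norm_num))) hc ?_
  · refine h1.trans ((mul_le_mul_of_nonneg_left (h.integral_kernel_le hK x) hc).trans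
      (le_of_eq ?_))
    ring
  · filter_upwards [hp, ae_restrict_mem hΩ.measurableSet] with y hy hyΩ hky
    have h2 := hα x hx y hyΩ ((h.norm_sub_le_of_kernel_ne_zero hC hky).trans_lt hρ)
    have h3 := hN.le_of_close (A := Matrix.of fun i j => p (i, j) y)
      (B := Matrix.of fun i j => pushMat t b p i j y) (s := t * (2 * β + β ^ 2)) (by positivity)
      fun i j => abs_pushMat_sub_le hβ0 hβ ht h.time_le_one p i j y
    exact h3.trans (mul_le_mul_of_nonneg_left (hy.trans h2) (by positivity))

/-- The term t (D²b : p) is not controlled by div p. It is estimated through the global bounds on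
both weights, and division by the lower bound a of α₁ makes the error relative. -/
theorem vecNorm_smear_le [IsFiniteMeasure (volume.restrict Ω)]
    (h : IsInwardSmearing Ω k b t δ) (hΩ : IsOpen Ω)
    (hbdd : Bornology.IsBounded Ω) (hN : IsMatrixNorm r N) {C β ρ τ a A₀ A₁ : ℝ}
    (hτ : 0 ≤ τ) (hC : ∀ y, ‖TGV.field b y‖ ≤ C) (hβ0 : 0 ≤ β)
    (hβ : ∀ i a y, |partialDeriv a (b i) y| ≤ β)
    (hβ' : ∀ i a c y, |partialDeriv c (partialDeriv a (b i)) y| ≤ β)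
    {K : ℝ≥0} (hK : AntilipschitzWith K (deform t b)) (hρ : δ + t * C < ρ)
    (ha : 0 < a) (hα1 : ∀ x ∈ Ω, a < α₁ x)
    (hA₀ : 0 < A₀) (hA₁ : 0 < A₁) (hαA₀ : ∀ x ∈ Ω, α₀ x ≤ A₀) (hαA₁ : ∀ x ∈ Ω, α₁ x ≤ A₁)
    (hα : ∀ x ∈ Ω, ∀ y ∈ Ω, ‖y - x‖ < ρ → α₁ y ≤ (1 + τ) * α₁ x) {p : L2Mat Ω}
    (hp : SatisfiesBounds r N α₀ α₁ p)
    {x : EuclideanSpace ℝ (Fin d)} (hx : x ∈ Ω) :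
    vecNorm r (fun i => smear k (deform t b) Ω (pushVec t b p i) x)
      ≤ (1 + τ + t * (d * β * (d * A₁ + d ^ 2 * A₀) / a)) * (K : ℝ) ^ d * α₁ x := by
  have ht := h.time_nonneg
  have hax := hα1 x hx
  have hc : 0 ≤ (1 + τ + t * (d * β * (d * A₁ + d ^ 2 * A₀) / a)) * α₁ x := by
    have := ha.trans hax
    positivity
  have hI : ∀ g, Integrable g (volume.restrict Ω) →
      Integrable (fun y => k (x - deform t b y) * g y) (volume.restrict Ω) := fun g hg =>
    integrable_kernel_mul h.kernel h.continuous_deform hg x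
  have h1 := piLp_norm_integral_le (r := r) (μ := volume.restrict Ω)
    (k := fun y => k (x - deform t b y))
    (F := fun y i => pushVec t b p i y) (fun y => h.nonneg _)
    (by simpa using hI (fun _ => 1) (integrable_const 1))
    (fun i => hI _ ((memLp_pushVec hbdd hΩ h.field p i).integrable (by norm_num)))
    (c := (1 + τ + t * (d * β * (d * A₁ + d ^ 2 * A₀) / a)) * α₁ x) ?_
  · refine h1.trans ((mul_le_mul_of_nonneg_left (h.integral_kernel_le hK x) hc).trans
      (le_of_eq ?_))
    ring
  · filter_upwards [hp, ae_restrict_mem hΩ.measurableSet] with y hy hyΩ hky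
    have h2 := hα x hx y hyΩ ((h.norm_sub_le_of_kernel_ne_zero hC hky).trans_lt hρ)
    have hM : ∑ a, ∑ c, |p (a, c) y| ≤ (d : ℝ) ^ 2 * A₀ := by
      calc _ ≤ ∑ _a : Fin d, ∑ _c : Fin d, A₀ :=
            Finset.sum_le_sum fun a _ => Finset.sum_le_sum fun c _ =>
              (hN.abs_apply_le (Matrix.of fun i j => p (i, j) y) a c).trans
                (hy.1.trans (hαA₀ y hyΩ))
        _ = _ := by simp; ring
    have hV : ∑ a, |matDiv p a y| ≤ d * A₁ := by
      calc _ ≤ ∑ _a : Fin d, A₁ := Finset.sum_le_sum fun a _ =>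
            (abs_le_vecNorm (r := r) (fun i => matDiv p i y) a).trans (hy.2.trans (hαA₁ y hyΩ))
        _ = _ := by simp
    have h3 : vecNorm r ((fun i => pushVec t b p i y) - fun i => matDiv p i y)
        ≤ t * (d * β * (d * A₁ + d ^ 2 * A₀)) := by
      calc _ ≤ ∑ i, |pushVec t b p i y - matDiv p i y| := vecNorm_le_sum _
        _ ≤ ∑ _i : Fin d, t * β * (d * A₁ + (d : ℝ) ^ 2 * A₀) :=
            Finset.sum_le_sum fun i _ => (abs_pushVec_sub_le hβ hβ' ht p i y).trans
              (mul_le_mul_of_nonneg_left (add_le_add hV hM) (by positivity))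
        _ = _ := by simp; ring
    have h4 := vecNorm_add_le (r := r) (fun i => matDiv p i y)
      ((fun i => pushVec t b p i y) - fun i => matDiv p i y)
    rw [add_sub_cancel] at h4
    have h5 : t * (d * β * (d * A₁ + d ^ 2 * A₀))
        ≤ t * (d * β * (d * A₁ + d ^ 2 * A₀) / a) * α₁ x := by
      rw [mul_div_assoc', div_mul_eq_mul_div, le_div_iff₀ ha]
      exact mul_le_mul_of_nonneg_left hax.le (by positivity)
    have h6 := hy.2
    change vecNorm r (fun i => pushVec t b p i y) ≤ _
    linarith

theorem inv_smul_pushField_mem [IsFiniteMeasure (volume.restrict Ω)]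
    (h : IsInwardSmearing Ω k b t δ) (hΩ : IsOpen Ω)
    (hbdd : Bornology.IsBounded Ω) (hN : IsMatrixNorm r N) {Λ : ℝ} (hΛ : 0 < Λ) {p : L2Mat Ω}
    (hp : p ∈ H0Div2 Ω)
    (h0 : ∀ x ∈ Ω, N (Matrix.of fun i j => smear k (deform t b) Ω (pushMat t b p i j) x)
      ≤ Λ * α₀ x)
    (h1 : ∀ x ∈ Ω, vecNorm r (fun i => smear k (deform t b) Ω (pushVec t b p i) x) ≤ Λ * α₁ x) :
    Λ⁻¹ • pushField k t b p ∈ feasibleSet Ω r N α₀ α₁ := by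
  obtain ⟨hT, hd, -⟩ := pushField_spec hbdd hΩ h.kernel h.field h.radius_pos h.tsupport_subset
    h.maps hp
  refine inv_smul_mem_feasibleSet hΩ hN (hT.mem_H0Div2 hΩ) hΛ ?_
  have hS := fun {g : EuclideanSpace ℝ (Fin d) → ℝ} (hg : MemLp g 2 (volume.restrict Ω)) =>
    coeFn_toL2 ((isTestFunction_smear h.kernel (contDiff_deform h.field)
      (norm_deform_sub_le (exists_norm_field_le h.field).choose_spec.2 h.time_nonneg) hΩ hbdd
      h.radius_pos h.norm_le_radius h.maps (hg.integrable (by norm_num))).memLp Ω 2)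
  have e1 : ∀ᵐ x ∂(volume.restrict Ω), ∀ ij : Fin d × Fin d, pushField k t b p ij x
      = smear k (deform t b) Ω (pushMat t b p ij.1 ij.2) x :=
    ae_all_iff.2 fun ij => hS (memLp_pushMat hbdd hΩ h.field p ij.1 ij.2)
  have e2 : ∀ᵐ x ∂(volume.restrict Ω), ∀ i, matDiv (pushField k t b p) i x
      = smear k (deform t b) Ω (pushVec t b p i) x := by
    simp only [hd]
    exact ae_all_iff.2 fun i => hS (memLp_pushVec hbdd hΩ h.field p i)
  filter_upwards [e1, e2, ae_restrict_mem hΩ.measurableSet] with x hx1 hx2 hxΩ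
  simp only [hx1, hx2]
  exact ⟨h0 x hxΩ, h1 x hxΩ⟩

theorem isTestFunction_smear (h : IsInwardSmearing Ω k b t δ) (hΩ : IsOpen Ω)
    (hbdd : Bornology.IsBounded Ω) {g : EuclideanSpace ℝ (Fin d) → ℝ}
    (hg : Integrable g (volume.restrict Ω)) :
    IsTestFunction Ω (smear k (deform t b) Ω g) ∧
      ∀ i, IsTestFunction Ω (smear (partialDeriv i k) (deform t b) Ω g) := by
  have hD := norm_deform_sub_le (exists_norm_field_le h.field).choose_spec.2 h.time_nonneg
  exact ⟨TGV.isTestFunction_smear h.kernel (contDiff_deform h.field) hD hΩ hbdd h.radius_pos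
    h.norm_le_radius h.maps hg, fun i => TGV.isTestFunction_smear (h.kernel.partialDeriv i)
    (contDiff_deform h.field) hD hΩ hbdd h.radius_pos
    (partialDeriv_ne_zero_subset h.tsupport_subset i) h.maps hg⟩

theorem toL2_pushDiv2 [IsFiniteMeasure (volume.restrict Ω)] (h : IsInwardSmearing Ω k b t δ)
    (hΩ : IsOpen Ω) (hbdd : Bornology.IsBounded Ω) (p : L2Mat Ω) :
    toL2 Ω (pushDiv2 k t b p) = toL2 Ω (smear k (deform t b) Ω (matDiv2 p))
      + t • ∑ i, toL2 Ω (smear (partialDeriv i k) (deform t b) Ω (pushRest b p i)) := by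
  have h1 := ((h.isTestFunction_smear hΩ hbdd
    ((Lp.memLp (matDiv2 p)).integrable (by norm_num))).1).memLp Ω 2
  have h2 : ∀ i, MemLp (smear (partialDeriv i k) (deform t b) Ω (pushRest b p i)) 2
      (volume.restrict Ω) := fun i => ((h.isTestFunction_smear hΩ hbdd
    ((memLp_pushRest hbdd hΩ h.field p i).integrable (by norm_num))).2 i).memLp Ω 2
  have h3 := memLp_sum Finset.univ fun i (_ : i ∈ Finset.univ) => h2 i
  rw [← toL2_sum _ fun i _ => h2 i, ← toL2_const_mul t h3, ← toL2_add h1 (h3.const_mul t)]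
  rfl

/-- The L¹ norm A of the kernel derivative enters multiplied by t; with radius proportional to t
this product stays bounded, but need not be small. -/
theorem norm_pushDiv2_le [IsFiniteMeasure (volume.restrict Ω)] (h : IsInwardSmearing Ω k b t δ)
    (hΩ : IsOpen Ω) (hbdd : Bornology.IsBounded Ω) {K : ℝ≥0} (hK1 : 1 ≤ K)
    (hK : AntilipschitzWith K (deform t b)) {A : ℝ} (hA : 0 < A)
    (hkA : ∀ i, ∫ x, |partialDeriv i k x| ≤ A) (p : L2Mat Ω) :
    ‖toL2 Ω (pushDiv2 k t b p)‖
      ≤ (K : ℝ) ^ d * (‖matDiv2 p‖ + t * A * ∑ i, ‖toL2 Ω (pushRest b p i)‖) := by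
  have hself : toL2 Ω (matDiv2 p) = matDiv2 p := (toL2_eq (Lp.memLp _) EventuallyEq.rfl).symm
  have h1 := norm_toL2_smear_le h.kernel hK1 hK h.continuous_deform one_pos
    (by simp only [abs_of_nonneg (h.nonneg _), h.integral_eq_one, le_refl])
    (h.isTestFunction_smear hΩ hbdd ((Lp.memLp (matDiv2 p)).integrable (by norm_num))).1
    (Lp.memLp (matDiv2 p))
  have h2 := fun i => norm_toL2_smear_le (h.kernel.partialDeriv i) hK1 hK h.continuous_deform hA
    (hkA i) ((h.isTestFunction_smear hΩ hbdd
      ((memLp_pushRest hbdd hΩ h.field p i).integrable (by norm_num))).2 i)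
    (memLp_pushRest hbdd hΩ h.field p i)
  rw [hself, mul_one] at h1
  rw [h.toL2_pushDiv2 hΩ hbdd]
  refine (norm_add_le _ _).trans ?_
  rw [norm_smul, Real.norm_of_nonneg h.time_nonneg, mul_add]
  refine add_le_add h1 ?_
  calc _ ≤ t * ∑ i, (K : ℝ) ^ d * A * ‖toL2 Ω (pushRest b p i)‖ :=
        mul_le_mul_of_nonneg_left ((norm_sum_le _ _).trans (Finset.sum_le_sum fun i _ => h2 i))
          h.time_nonneg
    _ = _ := by rw [← Finset.mul_sum]; ring

/-- Against a fixed test function the derivative moves from the kernel to φ, so the factor t is no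
longer offset by a large kernel norm. This gives weak convergence where the norm estimate gives only
boundedness. -/
theorem abs_inner_pushDiv2_sub_le [IsFiniteMeasure (volume.restrict Ω)]
    (h : IsInwardSmearing Ω k b t δ)
    (hΩ : IsOpen Ω) (hbdd : Bornology.IsBounded Ω) {K : ℝ≥0} (hK1 : 1 ≤ K)
    (hK : AntilipschitzWith K (deform t b)) {C : ℝ} (hC : ∀ y, ‖TGV.field b y‖ ≤ C) (p : L2Mat Ω)
    {φ : EuclideanSpace ℝ (Fin d) → ℝ} (hφ : IsTestFunction Ω φ) {L : ℝ≥0}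
    (hL : LipschitzWith L φ) :
    |⟪toL2 Ω φ, toL2 Ω (pushDiv2 k t b p)⟫_ℝ - ⟪toL2 Ω φ, matDiv2 p⟫_ℝ|
      ≤ L * (δ + t * C) * (∫ x in Ω, |matDiv2 p x|)
        + t * ((K : ℝ) ^ d * ∑ i, ‖toL2 Ω (partialDeriv i φ)‖ * ‖toL2 Ω (pushRest b p i)‖) := by
  have hI : Integrable (matDiv2 p) (volume.restrict Ω) :=
    (Lp.memLp (matDiv2 p)).integrable (by norm_num)
  have hR : ∀ i, Integrable (pushRest b p i) (volume.restrict Ω) := fun i =>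
    (memLp_pushRest hbdd hΩ h.field p i).integrable (by norm_num)
  have h1 := abs_integral_mul_smear_sub_le hΩ h.kernel h.continuous_deform
    (norm_deform_sub_le hC h.time_nonneg) h.nonneg h.integral_eq_one h.norm_le_radius hφ hL hI
  rw [← hφ.inner_toL2_toL2 (h.isTestFunction_smear hΩ hbdd hI).1, ← hφ.inner_toL2] at h1
  have h2 : ∀ i, |⟪toL2 Ω φ, toL2 Ω (smear (partialDeriv i k) (deform t b) Ω (pushRest b p i))⟫_ℝ|
      ≤ (K : ℝ) ^ d * (‖toL2 Ω (partialDeriv i φ)‖ * ‖toL2 Ω (pushRest b p i)‖) := fun i => by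
    have hS := h.isTestFunction_smear hΩ hbdd (hR i)
    have h3 := isWeakPartial_iff.1
      (isWeakPartial_smear i h.kernel h.continuous_deform (hR i) hS.1 (hS.2 i)) φ hφ
    rw [← abs_neg, ← h3]
    refine (abs_real_inner_le_norm _ _).trans ?_
    have h4 := norm_toL2_smear_le h.kernel hK1 hK h.continuous_deform one_pos
      (by simp only [abs_of_nonneg (h.nonneg _), h.integral_eq_one, le_refl]) hS.1
      (memLp_pushRest hbdd hΩ h.field p i)
    rw [mul_one] at h4
    calc _ ≤ ‖toL2 Ω (partialDeriv i φ)‖ * ((K : ℝ) ^ d * ‖toL2 Ω (pushRest b p i)‖) :=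
          mul_le_mul_of_nonneg_left h4 (norm_nonneg _)
      _ = _ := by ring
  rw [h.toL2_pushDiv2 hΩ hbdd, inner_add_right, real_inner_smul_right, inner_sum, add_sub_right_comm]
  refine (abs_add_le _ _).trans (add_le_add h1 ?_)
  rw [abs_mul, abs_of_nonneg h.time_nonneg, Finset.mul_sum]
  exact mul_le_mul_of_nonneg_left ((Finset.abs_sum_le_sum_abs _ _).trans
    (Finset.sum_le_sum fun i _ => h2 i)) h.time_nonneg

end IsInwardSmearing

end InwardSmearing

end TGV

end

noncomputable section

namespace TGV

/-! ### Density of the feasible test fields -/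

section Density

variable {d : ℕ} {Ω : Set (EuclideanSpace ℝ (Fin d))} {r : ℝ≥0∞} [Fact (1 ≤ r)]
  {N : Matrix (Fin d) (Fin d) ℝ → ℝ} {α₀ α₁ : EuclideanSpace ℝ (Fin d) → ℝ}

/-- The inward displacement leaves a gap proportional to t, so the mollification radius can be
proportional to t as well; the bounds are then exceeded by at most the factor 1 + 2τ. -/
theorem exists_feasible_smearing [IsFiniteMeasure (volume.restrict Ω)] (hΩ : IsOpen Ω)
    (hbdd : Bornology.IsBounded Ω) (hlip : HasLipschitzBoundary Ω) (hN : IsMatrixNorm r N)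
    (hα₀ : IsWeight Ω α₀) (hα₁ : IsWeight Ω α₁) :
    ∃ (b : Fin d → EuclideanSpace ℝ (Fin d) → ℝ) (c C A : ℝ), 0 < c ∧ 0 < A ∧
      (∀ y, ‖field b y‖ ≤ C) ∧
      ∀ q ∈ feasibleSet Ω r N α₀ α₁, ∀ τ : ℝ, 0 < τ → ∃ t k, 0 < t ∧ t < τ ∧
        IsInwardSmearing Ω k b t (c * t) ∧ AntilipschitzWith 2 (deform t b) ∧
        (∀ i, ∫ x, |partialDeriv i k x| ≤ A / (c * t)) ∧
        (1 + 2 * τ)⁻¹ • pushField k t b q ∈ feasibleSet Ω r N α₀ α₁ := by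
  obtain ⟨b, hb, c, t₀, hc, ht₀, hin⟩ := exists_inward_field hΩ hbdd hlip
  obtain ⟨C, hC0, hC⟩ := exists_norm_field_le hb
  obtain ⟨L, hL0, hL⟩ := exists_lipschitzWith_field hb
  obtain ⟨β, hβ0, hβ, hβ'⟩ := exists_bound_partialDeriv hb
  obtain ⟨A, hA, hmoll⟩ := exists_mollifier d
  obtain ⟨A₀, hA₀, hαA₀⟩ := hα₀.exists_le hbdd
  obtain ⟨A₁, hA₁, hαA₁⟩ := hα₁.exists_le hbdd
  obtain ⟨-, a₀, ha₀, hαa₀⟩ := id hα₀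
  obtain ⟨-, a₁, ha₁, hαa₁⟩ := id hα₁
  refine ⟨b, c / 2, C, A, by positivity, hA, hC, fun q hq τ hτ => ?_⟩
  obtain ⟨ρ₀, hρ₀, hosc₀⟩ := hα₀.exists_oscillation hbdd hτ
  obtain ⟨ρ₁, hρ₁, hosc₁⟩ := hα₁.exists_oscillation hbdd hτ
  -- Every smallness condition compares a function continuous at t = 0 with a threshold strictly
  -- above its value there. For the last two that value is 1 + τ < 1 + 2τ.
  have small : ∀ {g : ℝ → ℝ} {s : ℝ}, ContinuousAt g 0 → g 0 < s → ∀ᶠ t in 𝓝[>] (0 : ℝ), g t < s :=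
    fun hg hs => (hg.eventually (Iio_mem_nhds hs)).filter_mono nhdsWithin_le_nhds
  have e1 := small (g := fun t => t) (s := τ) (by fun_prop) hτ
  have e2 := small (g := fun t => t) (s := t₀) (by fun_prop) ht₀
  have e3 := small (g := fun t => t) (s := 1) (by fun_prop) one_pos
  have e4 := small (g := fun t => t * L) (s := 1 / 2) (by fun_prop) (by norm_num)
  have e5 := small (g := fun t => c / 2 * t + t * C) (s := ρ₀) (by fun_prop) (by simpa using hρ₀)
  have e6 := small (g := fun t => c / 2 * t + t * C) (s := ρ₁) (by fun_prop) (by simpa using hρ₁)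
  have e7 := small (g := fun t => (1 + t * (2 * β + β ^ 2) * (d : ℝ) ^ 4) * (1 + τ)
    * ((1 - t * L)⁻¹) ^ d) (s := 1 + 2 * τ) (by fun_prop (disch := simp)) (by simp; linarith)
  have e8 := small (g := fun t => (1 + τ + t * (d * β * (d * A₁ + d ^ 2 * A₀) / a₁))
    * ((1 - t * L)⁻¹) ^ d) (s := 1 + 2 * τ) (by fun_prop (disch := simp)) (by simp; linarith)
  obtain ⟨t, ht, h1, h2, h3, h4, h5, h6, h7, h8⟩ := (eventually_mem_nhdsWithin.and (e1.and
    (e2.and (e3.and (e4.and (e5.and (e6.and (e7.and e8)))))))).exists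
  rw [Set.mem_Ioi] at ht
  have hδ : 0 < c / 2 * t := by positivity
  obtain ⟨k, hk, hk0, hk1, hkδ, hkA⟩ := hmoll _ hδ
  -- A displacement of length at most 2 · (c/2)t = ct is t times a perturbation of length at most c,
  -- which the inward field tolerates.
  have hsm : IsInwardSmearing Ω k b t (c / 2 * t) :=
    ⟨hk, hk0, hk1, hkδ, hδ, hb, fun y hy z hz => by
      have := hin t ht h2.le y hy (t⁻¹ • z) (by
        rw [norm_smul, norm_inv, Real.norm_of_nonneg ht.le, inv_mul_le_iff₀ ht]
        linarith)
      rwa [smul_add, smul_inv_smul₀ ht.ne', ← add_assoc] at this, ht.le, h3.le⟩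
  have hK := antilipschitzWith_deform hL ht.le (by linarith)
  have hpos : 0 < 1 - t * L := by linarith
  have hKv : ((Real.toNNReal (1 - t * L)⁻¹ : ℝ≥0) : ℝ) = (1 - t * L)⁻¹ :=
    Real.coe_toNNReal _ (by positivity)
  have hK2 : Real.toNNReal (1 - t * L)⁻¹ ≤ 2 := by
    rw [← NNReal.coe_le_coe, hKv, inv_le_comm₀ hpos (by norm_num)]
    norm_num
    linarith
  refine ⟨t, k, ht, h1, hsm, fun x y => (hK x y).trans (by gcongr), hkA, ?_⟩
  refine hsm.inv_smul_pushField_mem hΩ hbdd hN (by positivity) hq.1 (fun x hx => ?_) fun x hx => ?_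
  · have hb0 := hsm.matrixNorm_smear_le hΩ hbdd hN hτ.le hC hβ0 hβ hK h5
      (fun x hx => ha₀.trans (hαa₀ x hx)) hosc₀ (hq.2.mono fun y hy => hy.1) hx
    rw [hKv] at hb0
    exact hb0.trans (mul_le_mul_of_nonneg_right h7.le (ha₀.trans (hαa₀ x hx)).le)
  · have hb1 := hsm.vecNorm_smear_le hΩ hbdd hN hτ.le hC hβ0 hβ hβ' hK h6 ha₁ hαa₁ hA₀ hA₁
      hαA₀ hαA₁ hosc₁ hq.2 hx
    rw [hKv] at hb1
    exact hb1.trans (mul_le_mul_of_nonneg_right h8.le (ha₁.trans (hαa₁ x hx)).le)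

/-- Feasible test fields approximate every feasible field in the sense of second divergences. -/
theorem exists_feasible_testField_near (hΩ : IsOpen Ω)
    (hbdd : Bornology.IsBounded Ω) (hlip : HasLipschitzBoundary Ω) (hN : IsMatrixNorm r N)
    (hα₀ : IsWeight Ω α₀) (hα₁ : IsWeight Ω α₁) {q : L2Mat Ω} (hq : q ∈ feasibleSet Ω r N α₀ α₁)
    {η : ℝ} (hη : 0 < η) :
    ∃ ψ, IsTestField ψ ∧ ψ ∈ feasibleSet Ω r N α₀ α₁ ∧ ‖matDiv2 ψ - matDiv2 q‖ < η := by
  have : IsFiniteMeasure (volume.restrict Ω) := ⟨by simpa using hbdd.measure_lt_top⟩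
  obtain ⟨b, c, C, A, hc, hA, hC, hex⟩ := exists_feasible_smearing hΩ hbdd hlip hN hα₀ hα₁
  have hτ : ∀ n : ℕ, (0 : ℝ) < 1 / ((n : ℝ) + 1) := fun n => Nat.one_div_pos_of_nat
  choose t k ht htτ hsm hK hkA hfeas using fun n : ℕ => hex q hq (1 / ((n : ℝ) + 1)) (hτ n)
  have hτ0 : Tendsto (fun n : ℕ => 1 / ((n : ℝ) + 1)) atTop (𝓝 0) :=
    tendsto_one_div_add_atTop_nhds_zero_nat
  have ht0 : Tendsto t atTop (𝓝 0) :=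
    squeeze_zero (fun n => (ht n).le) (fun n => (htτ n).le) hτ0
  set s : ℕ → ℝ := fun n => (1 + 2 * (1 / ((n : ℝ) + 1)))⁻¹ with hs
  have hs0 : ∀ n, 0 ≤ s n := fun n => by
    have := hτ n
    simp only [hs]; positivity
  have hs1 : ∀ n, s n ≤ 1 := fun n => inv_le_one_of_one_le₀ (by linarith [hτ n])
  have hst : Tendsto s atTop (𝓝 1) := by
    have := ((hτ0.const_mul 2).const_add 1).inv₀ (by norm_num)
    simpa [hs] using this
  set W : ℕ → L2 Ω := fun n => toL2 Ω (pushDiv2 (k n) (t n) b q) with hW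
  have hspec := fun n => pushField_spec hbdd hΩ (hsm n).kernel (hsm n).field (hsm n).radius_pos
    (hsm n).tsupport_subset (hsm n).maps hq.1
  have hdiv : ∀ n, matDiv2 (s n • pushField (k n) (t n) b q) = s n • W n := fun n => by
    have hm := (hspec n).1.mem_H0Div2 hΩ
    have := matDiv2_comb hΩ hm hm (s n) 0
    simp only [zero_smul, add_zero] at this
    rw [this, (hspec n).2.2]
  -- Here t · A/(ct) = A/c: the second divergences are bounded uniformly in n.
  have hWC : ∀ n, ‖s n • W n‖
      ≤ 2 ^ d * (‖matDiv2 q‖ + A / c * ∑ i, ‖toL2 Ω (pushRest b q i)‖) := fun n => by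
    have h1 := (hsm n).norm_pushDiv2_le hΩ hbdd (by norm_num) (hK n)
      (div_pos hA (hsm n).radius_pos) (hkA n) q
    have h2 : t n * (A / (c * t n)) = A / c := by
      have := (ht n).ne'
      field_simp
    rw [h2] at h1
    rw [norm_smul, Real.norm_of_nonneg (hs0 n)]
    exact (mul_le_of_le_one_left (norm_nonneg _) (hs1 n)).trans h1
  have hWt : ∀ v, IsTestClass v →
      Tendsto (fun n => ⟪v, s n • W n⟫_ℝ) atTop (𝓝 ⟪v, matDiv2 q⟫_ℝ) := fun v hv => by
    obtain ⟨φ, hφ, rfl⟩ := hv.exists_eq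
    obtain ⟨L, hL⟩ := hφ.exists_lipschitzWith
    have h1 := fun n => (hsm n).abs_inner_pushDiv2_sub_le hΩ hbdd (by norm_num) (hK n) hC q hφ hL
    have h2 : Tendsto (fun n => L * (c * t n + t n * C) * (∫ x in Ω, |matDiv2 q x|)
        + t n * (((2 : ℝ≥0) : ℝ) ^ d
          * ∑ i, ‖toL2 Ω (partialDeriv i φ)‖ * ‖toL2 Ω (pushRest b q i)‖)) atTop (𝓝 0) := by
      have := (((((ht0.const_mul c).add (ht0.mul_const C)).const_mul (L : ℝ)).mul_const
        (∫ x in Ω, |matDiv2 q x|)).add (ht0.mul_const (((2 : ℝ≥0) : ℝ) ^ d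
          * ∑ i, ‖toL2 Ω (partialDeriv i φ)‖ * ‖toL2 Ω (pushRest b q i)‖)))
      simpa using this
    have h3 : Tendsto (fun n => ⟪toL2 Ω φ, W n⟫_ℝ) atTop (𝓝 ⟪toL2 Ω φ, matDiv2 q⟫_ℝ) :=
      tendsto_iff_dist_tendsto_zero.2 (squeeze_zero (fun n => dist_nonneg) h1 h2)
    simpa only [real_inner_smul_right, one_mul] using hst.mul h3
  -- Convexity lets the weak limit be approximated in norm by elements of this set, that is, by
  -- second divergences of test fields that are still feasible.
  have hconv : Convex ℝ
      (matDiv2 '' ((testFields Ω : Set (L2Mat Ω)) ∩ feasibleSet Ω r N α₀ α₁)) := by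
    rintro _ ⟨p, hp, rfl⟩ _ ⟨p', hp', rfl⟩ x y hx hy hxy
    exact ⟨_, ((testFields Ω).convex.inter (convex_feasibleSet hΩ hN)) hp hp' hx hy hxy,
      matDiv2_comb hΩ hp.2.1 hp'.2.1 x y⟩
  obtain ⟨_, ⟨ψ, ⟨hψT, hψ⟩, rfl⟩, hlt⟩ := exists_near_of_weak hconv
    (fun n => ⟨_, ⟨(testFields Ω).smul_mem (s n) (hspec n).1, hfeas n⟩, hdiv n⟩)
    (tendsto_inner_of_testClass hΩ hWC hWt) hη
  exact ⟨ψ, hψT, hψ, hlt⟩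

end Density

end TGV

end

/-! ### Existence, uniqueness and convergence combined. -/

theorem proposition4p6 {d : ℕ} (hd : 1 ≤ d) (Ω : Set (EuclideanSpace ℝ (Fin d)))
    (hΩ_open : IsOpen Ω) (hΩ_bdd : Bornology.IsBounded Ω) (hΩ_lip : TGV.HasLipschitzBoundary Ω)
    (r : ℝ≥0∞) [Fact (1 ≤ r)] (N : Matrix (Fin d) (Fin d) ℝ → ℝ) (hN : TGV.IsMatrixNorm r N)
    (α₀ α₁ : EuclideanSpace ℝ (Fin d) → ℝ) (hα₀ : TGV.IsWeight Ω α₀) (hα₁ : TGV.IsWeight Ω α₁)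
    (T : TGV.L2 Ω →L[ℝ] TGV.L2 Ω) (hT : IsUnit (TGV.opB T)) (f : TGV.L2 Ω)
    (M : TGV.L2Mat Ω → ℝ) (hM : TGV.IsPenalty r N α₀ α₁ M) :
    (∀ ε : ℝ, 0 < ε → ∃! p : TGV.L2Mat Ω, TGV.SolvesRegularized T f M ε p) ∧
    (∀ (ε : ℕ → ℝ) (pε : ℕ → TGV.L2Mat Ω), (∀ n, 0 < ε n) → Tendsto ε atTop (𝓝 0) →
      (∀ n, TGV.SolvesRegularized T f M (ε n) (pε n)) →
      ∃ (p : TGV.L2Mat Ω) (s : ℕ → ℕ), TGV.SolvesPredual r N α₀ α₁ T f p ∧ StrictMono s ∧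
        Tendsto (fun k => TGV.matDiv2 (pε (s k))) atTop (𝓝 (TGV.matDiv2 p))) := by
  refine ⟨fun ε hε => TGV.existsUnique_solvesRegularized hΩ_open hT hM hε,
    fun ε pε hε hε0 hp => ?_⟩
  obtain ⟨p, hpsol, hlim⟩ := TGV.tendsto_matDiv2_of_dense hΩ_open hT hM
    (TGV.satisfiesBounds_zero hΩ_open hN hα₀ hα₁) (fun q hq δ hδ => by
      obtain ⟨ψ, hψT, hψ, hlt⟩ := TGV.exists_feasible_testField_near hΩ_open hΩ_bdd hΩ_lip hN
        hα₀ hα₁ hq hδ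
      exact ⟨ψ, hψT.mem_H02Sym hΩ_open, hψ, hlt⟩) hε hε0 hp
  -- The whole sequence converges, so the subsequence can be trivial.
  exact ⟨p, id, hpsol, strictMono_id, hlim⟩
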